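/- Let $m\ge 1$ be a squarefree integer, $\mathbb K=\mathbb Q(\sqrt{-m})\subset\mathbb C$ with ring of integers $\mathcal O$, and let $n\ge 1$, $r\ge 0$ be integers. **Groups and modular forms.** Let $\mathcal H_n=\{Z\in\mathbb C^{n\times n} : \frac1{2i}(Z-\overline Z^{tr})>0\}$. Let $SU(n,n;\mathbb C)$ be the group of $M=\begin{pmatrix}A&B\\C&D\end{pmatrix}\in SL_{2n}(\mathbb C)$ with $\overline M^{tr}JM=J$, $J=\begin{pmatrix}0&-I\\I&0\end{pmatrix}$, and put $M\langle Z\rangle=(AZ+B)(CZ+D)^{-1}$. Let $\Gamma_n(\mathcal O)=SU(n,n;\mathbb C)\cap\mathcal O^{2n\times 2n}$. The extended Hermitian modular group is $$\Delta^*_{n,\mathbb K}=\bigcup_{A\in\mathcal A}\begin{pmatrix}A&0\\0&(\overline A^{tr})^{-1}\end{pmatrix}\Gamma_n(\mathcal O),$$ where $\mathcal A$ is the set of all $A=\frac1u L\in SL_n(\mathbb C)$ with $u\in\mathbb C\setminus\{0\}$, $L\in\mathcal O^{n\times n}$ and $\mathcal I(L)^n=\mathcal O\det(L)$, and $\mathcal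 I(L)$ is the ideal generated by the entries of $L$. A modular form of weight $k\in\mathbb Z$ with respect to $\Delta^*_{n,\mathbb K}$ is a holomorphic function $f:\mathcal H_n\to\mathbb C$ with $f(M\langle Z\rangle)=\det(CZ+D)^{k}f(Z)$ for all $Z\in\mathcal H_n$ and $M\in\Delta^*_{n,\mathbb K}$, which for $n=1$ is also bounded on $\{Z\in\mathcal H_1 : \operatorname{Im} Z\ge 1\}$. **Theta series.** Let $h(x,y)=\overline x^{tr}y$ on $\mathbb C^r$. A theta lattice of rank $r$ is an $\mathcal O$-submodule $\Lambda\subset\mathbb C^r$ which is a $\mathbb Z$-lattice of rank $2r$ and is even and unimodular with respect to $\operatorname{Re} h$. Two such lattices are isometric ($\cong$) if there is an $\mathcal O$-linear bijection between them that preserves $h$. Set $$\Theta(Z,\Lambda)^{(n)}=\sum_{T\ge 0}\#(\Lambda,T)\,e^{i\pi\operatorname{tr}(TZ)},\qquad \#(\Lambda,T)=\#\{\lambda=(\lambda_1,\dots,\lambda_n)\in\Lambda^n : \overline\lambda^{tr}\lambda=T\},$$ the sum being over all positive semidefinite Hermitian $n\times n$ matrices $T$. **Statement.** Let $\Lambda$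 be a theta lattice of rank $r$ such that $\frac1{\sqrt{N(\mathcal I)}}\,\mathcal I\Lambda\cong\Lambda$ for every nonzero ideal $\mathcal I\subseteq\mathcal O$ whose order in the class group of $\mathbb K$ divides $n$. Then all numbers $\#(\Lambda,T)$ are finite, the series $\Theta(Z,\Lambda)^{(n)}$ converges absolutely for every $Z\in\mathcal H_n$, and $Z\mapsto\Theta(Z,\Lambda)^{(n)}$ is a modular form of weight $r$ with respect to $\Delta^*_{n,\mathbb K}$. -/

import Mathlib

open scoped ComplexOrder NumberField Pointwise nonZeroDivisors

noncomputable section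

namespace HermitianTheta

/-- The field `ℚ(√-m)`, as a subfield of `ℂ`. -/
abbrev ImagQuad (m : ℕ) : IntermediateField ℚ ℂ :=
  IntermediateField.adjoin ℚ {((Real.sqrt m : ℝ) : ℂ) * Complex.I}

instance instNumberFieldImagQuad (m : ℕ) : NumberField (ImagQuad m) where
  to_charZero := inferInstance
  to_finiteDimensional := by
    refine IntermediateField.adjoin.finiteDimensional ?_
    refine IsIntegral.of_pow (n := 2) (by norm_num) ?_
    have h : (((Real.sqrt m : ℝ) : ℂ) * Complex.I) ^ 2 = algebraMap ℚ ℂ (-(m : ℚ)) := by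
      rw [mul_pow, Complex.I_sq, ← Complex.ofReal_pow, Real.sq_sqrt (Nat.cast_nonneg m)]
      simp
    rw [h]
    exact isIntegral_algebraMap

/-! ### The Hermitian half space and the groups -/

/-- The special unitary group `SU(n,n;ℂ)`; here `Matrix.J` is the block matrix `(0, -1; 1, 0)`. -/
def specialUnitary (n : ℕ) : Set (Matrix (Fin n ⊕ Fin n) (Fin n ⊕ Fin n) ℂ) :=
  {M | M.det = 1 ∧ M.conjTranspose * Matrix.J (Fin n) ℂ * M = Matrix.J (Fin n) ℂ}

/-- The Hermitian half space of degree `n`. -/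
def halfSpace (n : ℕ) : Set (Matrix (Fin n) (Fin n) ℂ) :=
  {Z | ((1 / (2 * Complex.I)) • (Z - Z.conjTranspose)).PosDef}

/-- `CZ + D`, where `(C, D)` is the lower half of `M`. -/
def denom {n : ℕ} (M : Matrix (Fin n ⊕ Fin n) (Fin n ⊕ Fin n) ℂ)
    (Z : Matrix (Fin n) (Fin n) ℂ) : Matrix (Fin n) (Fin n) ℂ :=
  M.toBlocks₂₁ * Z + M.toBlocks₂₂

/-- `M⟨Z⟩ = (AZ + B)(CZ + D)⁻¹`. -/
def moebius {n : ℕ} (M : Matrix (Fin n ⊕ Fin n) (Fin n ⊕ Fin n) ℂ)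
    (Z : Matrix (Fin n) (Fin n) ℂ) : Matrix (Fin n) (Fin n) ℂ :=
  (M.toBlocks₁₁ * Z + M.toBlocks₁₂) * (denom M Z)⁻¹

/-- The Hermitian modular group `Γ_n(𝓞_K)`. -/
def modularGroup (K : Type*) [Field K] [Algebra K ℂ] (n : ℕ) :
    Set (Matrix (Fin n ⊕ Fin n) (Fin n ⊕ Fin n) ℂ) :=
  {M ∈ specialUnitary n | ∀ i j, ∃ a : 𝓞 K, M i j = algebraMap (𝓞 K) ℂ a}

/-- The ideal generated by the entries of a matrix. -/
def entryIdeal {R : Type*} [CommRing R] {n : ℕ} (L : Matrix (Fin n) (Fin n) R) : Ideal R :=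
  Ideal.span {a | ∃ i j, L i j = a}

/-- The set `𝒜` of all `A = u⁻¹ L ∈ SL_n(ℂ)` with `u ∈ ℂ`, `L` integral over `K`, and
`I(L) ^ n = (det L)`. -/
def leviSet (K : Type*) [Field K] [Algebra K ℂ] (n : ℕ) : Set (Matrix (Fin n) (Fin n) ℂ) :=
  {A | A.det = 1 ∧ ∃ (u : ℂ) (L : Matrix (Fin n) (Fin n) (𝓞 K)), u ≠ 0 ∧
    A = u⁻¹ • L.map (algebraMap (𝓞 K) ℂ) ∧ entryIdeal L ^ n = Ideal.span {L.det}}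

/-- The block matrix `M_A = diag(A, (Āᵗ)⁻¹)`. -/
def leviMatrix {n : ℕ} (A : Matrix (Fin n) (Fin n) ℂ) :
    Matrix (Fin n ⊕ Fin n) (Fin n ⊕ Fin n) ℂ :=
  Matrix.fromBlocks A 0 0 (A.conjTranspose)⁻¹

/-- The extended Hermitian modular group `Δ*_{n,K}`: the union of the cosets `M_A Γ_n(𝓞_K)`
over `A ∈ 𝒜`. -/
def extendedModularGroup (K : Type*) [Field K] [Algebra K ℂ] (n : ℕ) :
    Set (Matrix (Fin n ⊕ Fin n) (Fin n ⊕ Fin n) ℂ) :=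
  {M | ∃ A ∈ leviSet K n, ∃ G ∈ modularGroup K n, M = leviMatrix A * G}

/-- `f` is a Hermitian modular form of degree `n` and weight `k` with respect to `G`.
Only the values of `f` on the half space matter. -/
structure IsModularForm {n : ℕ} (G : Set (Matrix (Fin n ⊕ Fin n) (Fin n ⊕ Fin n) ℂ)) (k : ℤ)
    (f : Matrix (Fin n) (Fin n) ℂ → ℂ) : Prop where
  holomorphic : DifferentiableOn ℂ f (halfSpace n)
  transform : ∀ M ∈ G, ∀ Z ∈ halfSpace n, f (moebius M Z) = (denom M Z).det ^ k * f Z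
  bounded : n = 1 → ∃ C : ℝ, ∀ Z ∈ halfSpace n, (∀ i, 1 ≤ (Z i i).im) → ‖f Z‖ ≤ C

/-! ### Theta lattices -/

/-- The standard Hermitian form on `ℂ^r`, linear in the second variable. -/
def herm {r : ℕ} (x y : Fin r → ℂ) : ℂ := star x ⬝ᵥ y

/-- A theta lattice of rank `r`: an `𝓞_K`-module in `ℂ^r` that is a full `ℤ`-lattice, and is even
and unimodular (equal to its dual) for the form `Re h`. -/
structure IsThetaLattice {K : Type*} [Field K] [Algebra K ℂ] {r : ℕ}
    (Λ : Submodule (𝓞 K) (Fin r → ℂ)) : Prop where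
  discrete : DiscreteTopology Λ
  full : Submodule.span ℝ (Λ : Set (Fin r → ℂ)) = ⊤
  even : ∀ x ∈ Λ, ∃ k : ℤ, (herm x x).re = 2 * k
  unimodular : ∀ x : Fin r → ℂ, x ∈ Λ ↔ ∀ y ∈ Λ, ∃ k : ℤ, (herm x y).re = k

/-- Isometry of Hermitian `𝓞_K`-lattices. -/
def Isometric {K : Type*} [Field K] [Algebra K ℂ] {r : ℕ}
    (Λ₁ Λ₂ : Submodule (𝓞 K) (Fin r → ℂ)) : Prop :=
  ∃ f : Λ₁ ≃ₗ[𝓞 K] Λ₂, ∀ x y : Λ₁, herm (f x : Fin r → ℂ) (f y) = herm (x : Fin r → ℂ) y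

/-- The lattice `N(I)^{-1/2} I Λ`. -/
def idealTwist {K : Type*} [Field K] [NumberField K] [Algebra K ℂ] {r : ℕ}
    (I : Ideal (𝓞 K)) (Λ : Submodule (𝓞 K) (Fin r → ℂ)) : Submodule (𝓞 K) (Fin r → ℂ) :=
  (Real.sqrt (Ideal.absNorm I : ℝ))⁻¹ • (I • Λ)

/-! ### Theta series -/

/-- The set of `n`-tuples of vectors of `Λ` with Gram matrix `T`. -/
def representations {K : Type*} [Field K] [Algebra K ℂ] {r n : ℕ}
    (Λ : Submodule (𝓞 K) (Fin r → ℂ)) (T : Matrix (Fin n) (Fin n) ℂ) :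
    Set (Fin n → Fin r → ℂ) :=
  {v | (∀ i, v i ∈ Λ) ∧ Matrix.of (fun i j => herm (v i) (v j)) = T}

/-- The summand `#(Λ,T) exp(iπ tr(TZ))` of the theta series. -/
def thetaTerm {K : Type*} [Field K] [Algebra K ℂ] {r n : ℕ}
    (Λ : Submodule (𝓞 K) (Fin r → ℂ)) (Z : Matrix (Fin n) (Fin n) ℂ)
    (T : {T : Matrix (Fin n) (Fin n) ℂ // T.PosSemidef}) : ℂ :=
  ((representations Λ T.1).ncard : ℂ) * Complex.exp (Complex.I * Real.pi * (T.1 * Z).trace)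

/-- The theta series of degree `n`, a sum over all positive semidefinite Hermitian `T`. -/
def theta {K : Type*} [Field K] [Algebra K ℂ] {r : ℕ} (n : ℕ)
    (Λ : Submodule (𝓞 K) (Fin r → ℂ)) (Z : Matrix (Fin n) (Fin n) ℂ) : ℂ :=
  ∑' T, thetaTerm Λ Z T

end HermitianTheta

end

/-! Grouping tuples by Gram matrix turns the theta series into the sum of `thetaExp Z V` over all V
in Λ^n (`hasSum_thetaTerm`). A point of the half space makes the exponent coercive and quadratic in
V, locally uniformly in Z (`exists_coercive_ball`), so the sum is dominated by a Gaussian over a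
lattice. Convergence, finiteness of the representation numbers, holomorphy and boundedness all come
from this.

The transformation law is compatible with products, so the matrices satisfying it form a monoid,
`automorphyMonoid`, and only generators have to be checked. Translations act trivially because Λ is
even and integral (`theta_add`). For Z ↦ -Z⁻¹, Poisson summation over the self-dual lattice Λ^n
gives the formula at Z = iY up to a positive constant. The point Y = 1 shows that the constant is 1,
and the identity theorem extends the formula to all Z (`theta_neg_inv`). The leftover root of unity
(-i)^r is 1, as one sees by following the point i through the relation (ST)^3 in degree one
(`neg_I_pow_rank`). For a Levi element A = L/u, the identities det L = u^n and I^n = (det L), with I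
the entry ideal of L, give N(I) = |u|² and show that the class of I has order dividing n. Right
multiplication by L carries Λ^n onto (IΛ)^n. After division by |u| the assumed isometry leads back
to Λ^n. The phase u/|u| does not affect Gram matrices, so the theta series is merely reindexed
(`leviMatrix_mem_of_mem_leviSet`).

It remains to generate the Hermitian modular group by Hermitian unipotents and by Levi elements of
SL_n(𝓞), although 𝓞 need not be principal. This is an induction on n that clears the first row
(`mem_generatedMonoid_succ`). It rests on a stable range statement, that a unimodular pair of rows
(c, d) becomes a unimodular row d + cS for a symmetric integral S (`exists_symmInt_span_eq_top`),
and on transitivity of SL_n on unimodular rows over a Dedekind domain for n ≥ 2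
(`slEquiv_single_of_span_eq_top`). In degree one the determinant condition forces all entries to be
rational integers, and SL₂(ℤ) is generated by S and T (`mem_generatedMonoid_one`). -/

noncomputable section
namespace HermitianTheta

/-! ### Poisson summation and real Gaussian sums. -/

section Poisson

open MeasureTheory Set

variable {ι : Type*}

theorem exists_int_mem_cube (x : ι → ℝ) :
    ∃ k : ι → ℤ, x ∈ {x : ι → ℝ | ∀ i, x i ∈ Ioc (k i : ℝ) (k i + 1)} := by
  refine ⟨fun i => ⌈x i⌉ - 1, fun i => ⟨?_, ?_⟩⟩
  · have := Int.ceil_lt_add_one (x i)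
    push_cast; linarith
  · have := Int.le_ceil (x i)
    push_cast; linarith

/-- Lets a continuous periodic function on ℝ^ι descend to a continuous function on the torus, where
Fourier series are available. -/
theorem isOpenQuotientMap_coe_torus :
    IsOpenQuotientMap (fun (x : ι → ℝ) => (fun i => (x i : UnitAddCircle) : UnitAddTorus ι)) :=
  IsOpenQuotientMap.piMap (f := fun _ (x : ℝ) => (x : UnitAddCircle)) fun _ =>
    QuotientAddGroup.isOpenQuotientMap_mk

variable [Fintype ι]

/-- The integral over `ℝ^ι` is the sum of the integrals over the integral translates of the unit
cube. -/
theorem hasSum_integral_cube {f : (ι → ℝ) → ℂ} (hf : Integrable f) :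
    HasSum (fun k : ι → ℤ =>
      ∫ x in {x : ι → ℝ | ∀ i, x i ∈ Ioc (0 : ℝ) (0 + 1)}, f (x + fun i => (k i : ℝ)))
      (∫ x, f x) := by
  have hm : ∀ a : ι → ℝ, MeasurableSet {x : ι → ℝ | ∀ i, x i ∈ Ioc (a i) (a i + 1)} := fun a =>
    MeasurableSet.univ_pi' (fun i => measurableSet_Ioc)
  have hU : (⋃ k : ι → ℤ, {x : ι → ℝ | ∀ i, x i ∈ Ioc (k i : ℝ) (k i + 1)}) = univ :=
    eq_univ_of_forall fun x => mem_iUnion.2 (exists_int_mem_cube x)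
  have hd : Pairwise (Function.onFun Disjoint
      (fun k : ι → ℤ => {x : ι → ℝ | ∀ i, x i ∈ Ioc (k i : ℝ) (k i + 1)})) := by
    intro k l hkl
    refine Set.disjoint_left.2 fun x hx hy => hkl (funext fun i => ?_)
    have h1 := hx i
    have h2 := hy i
    simp only [mem_Ioc] at h1 h2
    have h3 : (k i : ℝ) < l i + 1 := by linarith
    have h4 : (l i : ℝ) < k i + 1 := by linarith
    have h5 : k i < l i + 1 := by exact_mod_cast h3
    have h6 : l i < k i + 1 := by exact_mod_cast h4
    omega
  have := hasSum_integral_iUnion (μ := volume) (f := f) (fun k : ι → ℤ => hm fun i => (k i : ℝ)) hd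
    (by rw [hU]; exact hf.integrableOn)
  rw [hU, setIntegral_univ] at this
  convert! this using 2 with k
  have h := (measurePreserving_add_right volume (fun i => (k i : ℝ))).setIntegral_preimage_emb
    (measurableEmbedding_addRight _) f {x : ι → ℝ | ∀ i, x i ∈ Ioc (k i : ℝ) (k i + 1)}
  rw [← h]
  congr 2
  ext x
  simp [mem_Ioc, add_comm (x _)]

/-- The Poisson summation formula on `ℝ^ι`, for functions whose translates are locally uniformly
summable. -/
theorem tsum_int_eq_tsum_fourier {f : (ι → ℝ) → ℂ} (hc : Continuous f) (hint : Integrable f)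
    (hb : ∀ R : ℝ, ∃ u : (ι → ℤ) → ℝ, Summable u ∧ ∀ k x, ‖x‖ ≤ R →
      ‖f (x + fun i => (k i : ℝ))‖ ≤ u k)
    (hs : Summable fun k : ι → ℤ =>
      ∫ x, Complex.exp (-(2 * Real.pi * Complex.I * ∑ i, (k i : ℂ) * x i)) * f x) :
    ∑' k : ι → ℤ, f (fun i => (k i : ℝ)) = ∑' k : ι → ℤ,
      ∫ x, Complex.exp (-(2 * Real.pi * Complex.I * ∑ i, (k i : ℂ) * x i)) * f x := by
  -- The periodisation of f. Its Fourier coefficients on the torus are the values of the Fourier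
  -- transform of f at integer points, and the claim is its Fourier series evaluated at 0.
  set F : (ι → ℝ) → ℂ := fun x => ∑' k : ι → ℤ, f (x + fun i => (k i : ℝ)) with hF
  have hper : ∀ (x : ι → ℝ) (l : ι → ℤ), F (x + fun i => (l i : ℝ)) = F x := by
    intro x l
    simp only [hF]
    rw [← (Equiv.addLeft l).tsum_eq (fun k : ι → ℤ => f (x + fun i => (k i : ℝ)))]
    refine tsum_congr fun k => congrArg f ?_
    funext i
    simp [add_assoc]
  have hsum : ∀ x, Summable fun k : ι → ℤ => f (x + fun i => (k i : ℝ)) := by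
    intro x
    obtain ⟨u, hu, hu'⟩ := hb ‖x‖
    exact .of_norm_bounded hu fun k => hu' k x le_rfl
  have hFc : Continuous F := by
    rw [continuous_iff_continuousAt]
    intro x
    obtain ⟨u, hu, hu'⟩ := hb (‖x‖ + 1)
    have : ContinuousOn F (Metric.ball 0 (‖x‖ + 1)) := by
      refine continuousOn_tsum (fun k => ?_) hu fun k y hy => hu' k y ?_
      · exact (hc.comp (continuous_id.add continuous_const)).continuousOn
      · simpa using (mem_ball_zero_iff.1 hy).le
    exact this.continuousAt (Metric.isOpen_ball.mem_nhds (by simp))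
  have hq := isOpenQuotientMap_coe_torus (ι := ι)
  have hlift : ∀ x y : ι → ℝ, (fun i => (x i : UnitAddCircle)) = (fun i => (y i : UnitAddCircle)) →
      F x = F y := by
    intro x y hxy
    have h1 : ∀ i, ∃ l : ℤ, x i = y i + l := by
      intro i
      have := congrFun hxy i
      obtain ⟨l, hl⟩ := AddSubgroup.mem_zmultiples_iff.1 (QuotientAddGroup.eq.1 this)
      refine ⟨-l, ?_⟩
      push_cast
      simp only [zsmul_eq_mul, mul_one] at hl
      linarith
    choose l hl using h1
    rw [← hper y l]
    congr 1
    funext i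
    simp [hl]
  set g : UnitAddTorus ι → ℂ := fun t => F (Function.surjInv hq.surjective t) with hg
  have hgF : ∀ x : ι → ℝ, g (fun i => (x i : UnitAddCircle)) = F x := fun x =>
    hlift _ _ (Function.surjInv_eq hq.surjective _)
  have hgc : Continuous g := by
    rw [hq.isQuotientMap.continuous_iff]
    exact hFc.congr fun x => (hgF x).symm
  set G : C(UnitAddTorus ι, ℂ) := ⟨g, hgc⟩
  have hexp : ∀ (n : ι → ℤ) (x : ι → ℝ), UnitAddTorus.mFourier (-n) (fun i => (x i : UnitAddCircle))
      = Complex.exp (-(2 * Real.pi * Complex.I * ∑ i, (n i : ℂ) * x i)) := by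
    intro n x
    simp only [UnitAddTorus.mFourier, ContinuousMap.coe_mk, fourier_coe_apply]
    rw [← Complex.exp_sum, Finset.mul_sum, ← Finset.sum_neg_distrib]
    congr 1
    refine Finset.sum_congr rfl fun i _ => ?_
    simp
    ring
  have hcoeff : ∀ n : ι → ℤ, UnitAddTorus.mFourierCoeff G n =
      ∫ x, Complex.exp (-(2 * Real.pi * Complex.I * ∑ i, (n i : ℂ) * x i)) * f x := by
    intro n
    rw [UnitAddTorus.mFourierCoeff_eq_integral _ _ (fun _ => 0)]
    have hcont : Continuous fun x : ι → ℝ =>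
        Complex.exp (-(2 * Real.pi * Complex.I * ∑ i, (n i : ℂ) * x i)) := by fun_prop
    have hnorm : ∀ x : ι → ℝ,
        ‖Complex.exp (-(2 * Real.pi * Complex.I * ∑ i, (n i : ℂ) * x i))‖ = 1 := by
      intro x
      rw [Complex.norm_exp]
      have : (-(2 * Real.pi * Complex.I * ∑ i, (n i : ℂ) * x i)) =
        ((-(2 * Real.pi * ∑ i, (n i : ℝ) * x i) : ℝ) : ℂ) * Complex.I := by
        push_cast; ring
      rw [this, Complex.re_ofReal_mul]
      simp
    have h1 : Integrable fun x : ι → ℝ =>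
        Complex.exp (-(2 * Real.pi * Complex.I * ∑ i, (n i : ℂ) * x i)) * f x :=
      hint.bdd_mul (c := 1) hcont.aestronglyMeasurable (.of_forall fun x => (hnorm x).le)
    have h2 := hasSum_integral_cube h1
    rw [← h2.tsum_eq]
    -- Unfolding: the character does not see integral translations, so the cube integrals of the
    -- translates of f add up to the integral over the whole space.
    have hper' : ∀ (x : ι → ℝ) (k : ι → ℤ),
        Complex.exp (-(2 * Real.pi * Complex.I *
          ∑ i, (n i : ℂ) * ((x + fun i => (k i : ℝ)) i : ℝ))) =
        Complex.exp (-(2 * Real.pi * Complex.I * ∑ i, (n i : ℂ) * x i)) := by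
      intro x k
      rw [Complex.exp_eq_exp_iff_exists_int]
      refine ⟨-∑ i, n i * k i, ?_⟩
      push_cast
      simp only [Pi.add_apply, Complex.ofReal_add, Complex.ofReal_intCast, mul_add,
        Finset.sum_add_distrib]
      ring
    obtain ⟨u, hu, hu'⟩ := hb 1
    have hcube : volume {x : ι → ℝ | ∀ i, x i ∈ Ioc (0 : ℝ) (0 + 1)} = 1 := by
      have : {x : ι → ℝ | ∀ i, x i ∈ Ioc (0 : ℝ) (0 + 1)} = univ.pi fun _ => Ioc (0:ℝ) (0+1) := by
        ext; simp
      rw [this, Real.volume_pi_Ioc]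
      simp
    have hcm : MeasurableSet {x : ι → ℝ | ∀ i, x i ∈ Ioc (0 : ℝ) (0 + 1)} :=
      MeasurableSet.univ_pi' (fun i => measurableSet_Ioc)
    have hsmall : ∀ x ∈ {x : ι → ℝ | ∀ i, x i ∈ Ioc (0 : ℝ) (0 + 1)}, ‖x‖ ≤ 1 := by
      intro x hx
      refine (pi_norm_le_iff_of_nonneg zero_le_one).2 fun i => ?_
      have := hx i
      simp only [mem_Ioc, zero_add] at this
      rw [Real.norm_eq_abs, abs_le]
      constructor <;> linarith
    have hFI : ∀ k : ι → ℤ, IntegrableOn (fun x : ι → ℝ =>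
        Complex.exp (-(2 * Real.pi * Complex.I * ∑ i, (n i : ℂ) * x i)) *
          f (x + fun i => (k i : ℝ))) {x : ι → ℝ | ∀ i, x i ∈ Ioc (0 : ℝ) (0 + 1)} := by
      intro k
      have := (h1.comp_add_right fun i => (k i : ℝ))
      refine (this.congr (.of_forall fun x => ?_)).integrableOn
      simp only [hper']
    symm
    simp_rw [hper']
    rw [integral_tsum_of_summable_integral_norm (fun k => hFI k)]
    · refine integral_congr_ae (.of_forall fun x => ?_)
      simp only [smul_eq_mul, hexp]
      rw [show G (fun i => (x i : UnitAddCircle)) = F x from hgF x, hF, tsum_mul_left]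
    · refine Summable.of_nonneg_of_le (fun k => integral_nonneg fun x => norm_nonneg _)
        (fun k => ?_) hu
      have : ∀ x ∈ {x : ι → ℝ | ∀ i, x i ∈ Ioc (0 : ℝ) (0 + 1)},
          ‖‖Complex.exp (-(2 * Real.pi * Complex.I * ∑ i, (n i : ℂ) * x i)) *
          f (x + fun i => (k i : ℝ))‖‖ ≤ u k := by
        intro x hx
        rw [norm_norm, norm_mul, hnorm, one_mul]
        exact hu' k x (hsmall x hx)
      have := norm_setIntegral_le_of_norm_le_const (by rw [hcube]; exact ENNReal.one_lt_top) this
      rw [measureReal_def, hcube] at this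
      simp only [ENNReal.toReal_one, mul_one] at this
      exact (le_abs_self _).trans this
  have hS : Summable (UnitAddTorus.mFourierCoeff G) := by
    simpa only [funext hcoeff] using hs
  have := UnitAddTorus.hasSum_mFourier_series_apply_of_summable hS (fun i => ((0 : ℝ) : UnitAddCircle))
  rw [show G (fun i => ((0:ℝ) : UnitAddCircle)) = F 0 from hgF 0] at this
  have h0 : F 0 = ∑' k : ι → ℤ, f (fun i => (k i : ℝ)) := by
    simp [hF]
  rw [← h0, ← this.tsum_eq]
  refine tsum_congr fun k => ?_
  have h1 : UnitAddTorus.mFourier k (fun i => (((0 : ι → ℝ) i : ℝ) : UnitAddCircle)) = 1 := by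
    have := hexp (-k) 0
    rw [neg_neg] at this
    rw [this]; simp
  have h1' : UnitAddTorus.mFourier k (fun i => ((0 : ℝ) : UnitAddCircle)) = 1 := h1
  rw [h1', hcoeff]; simp

/-- A Gaussian decays faster than any power: t^N/N! ≤ exp t bounds the term by a multiple of
‖x‖^(-2N). With N equal to the rank plus one, the exponent 2N exceeds the rank, so these powers are
summable over the nonzero lattice points. -/
theorem summable_exp_neg_mul_sq_norm {E : Type*} [NormedAddCommGroup E] [NormedSpace ℝ E]
    [FiniteDimensional ℝ E] (L : Submodule ℤ E) [DiscreteTopology L] {c : ℝ} (hc : 0 < c) :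
    Summable fun x : L => Real.exp (-(c * ‖x‖ ^ 2)) := by
  set N := Module.finrank ℤ L + 1
  have h := ZLattice.summable_norm_pow_inv L (2 * N) (by omega)
  refine Summable.of_norm_bounded_eventually (h.mul_left ((N.factorial : ℝ) / c ^ N)) ?_
  refine (Set.finite_singleton (0 : L)).subset fun x hx => ?_
  by_contra hx0
  refine hx ?_
  change ‖Real.exp (-(c * ‖x‖ ^ 2))‖ ≤ (N.factorial : ℝ) / c ^ N * ‖x‖⁻¹ ^ (2 * N)
  have hpos : 0 < ‖x‖ := norm_pos_iff.2 hx0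
  have h1 := Real.pow_div_factorial_le_exp (c * ‖x‖ ^ 2) (by positivity) N
  rw [div_le_iff₀ (by positivity)] at h1
  rw [Real.norm_eq_abs, Real.abs_exp, Real.exp_neg, inv_pow, pow_mul, div_mul_eq_mul_div, ← div_eq_mul_inv,
    div_div, ← mul_pow, mul_comm (‖x‖ ^ 2) c, le_div_iff₀ (by positivity), inv_mul_eq_div,
    div_le_iff₀ (Real.exp_pos _), mul_comm _ (Real.exp _)]
  exact h1

theorem summable_int_exp_neg_mul_sq_norm {c : ℝ} (hc : 0 < c) :
    Summable fun k : ι → ℤ => Real.exp (-(c * ‖fun i => (k i : ℝ)‖ ^ 2)) := by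
  classical
  have h := summable_exp_neg_mul_sq_norm (Submodule.span ℤ (Set.range (Pi.basisFun ℝ ι))) hc
  have hmem : ∀ k : ι → ℤ, (fun i => (k i : ℝ)) ∈
      Submodule.span ℤ (Set.range (Pi.basisFun ℝ ι)) := fun k =>
    ((Pi.basisFun ℝ ι).mem_span_iff_repr_mem ℤ _).2 fun i => ⟨k i, by simp⟩
  have hinj : Function.Injective (fun k : ι → ℤ =>
      (⟨fun i => (k i : ℝ), hmem k⟩ : Submodule.span ℤ (Set.range (Pi.basisFun ℝ ι)))) := by
    intro k l hkl
    funext i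
    have : (k i : ℝ) = l i := congrFun (Subtype.ext_iff.1 hkl) i
    exact_mod_cast this
  exact (h.comp_injective hinj).congr fun k => rfl

/-- Boundedness of B⁻¹ controls ‖x‖ by ‖Bx‖, and the sup norm is at most the Euclidean one. -/
theorem exists_pos_mul_sq_norm_le_sum [DecidableEq ι] {B : Matrix ι ι ℝ} (hB : B.det ≠ 0) :
    ∃ c : ℝ, 0 < c ∧ ∀ x : ι → ℝ, c * ‖x‖ ^ 2 ≤ ∑ i, (B.mulVec x) i ^ 2 := by
  set T := (Matrix.toLin' B⁻¹).toContinuousLinearMap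
  have h1 : ∀ x : ι → ℝ, ‖x‖ ≤ (‖T‖ + 1) * ‖B.mulVec x‖ := by
    intro x
    have := T.le_opNorm (B.mulVec x)
    have h2 : T (B.mulVec x) = x := by
      simp only [T, LinearMap.coe_toContinuousLinearMap', Matrix.toLin'_apply, Matrix.mulVec_mulVec]
      rw [Matrix.nonsing_inv_mul _ (isUnit_iff_ne_zero.2 hB), Matrix.one_mulVec]
    rw [h2] at this
    nlinarith [norm_nonneg (B.mulVec x)]
  have h3 : ∀ y : ι → ℝ, ‖y‖ ^ 2 ≤ ∑ i, y i ^ 2 := by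
    intro y
    have : ‖y‖ ≤ Real.sqrt (∑ i, y i ^ 2) := by
      refine (pi_norm_le_iff_of_nonneg (Real.sqrt_nonneg _)).2 fun i => ?_
      rw [Real.norm_eq_abs]
      refine Real.abs_le_sqrt ?_
      exact Finset.single_le_sum (f := fun i => y i ^ 2) (fun i _ => sq_nonneg _)
        (Finset.mem_univ i)
    calc ‖y‖ ^ 2 ≤ Real.sqrt (∑ i, y i ^ 2) ^ 2 := by gcongr
      _ = _ := Real.sq_sqrt (Finset.sum_nonneg fun i _ => sq_nonneg _)
  have hT : 0 < ‖T‖ + 1 := by positivity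
  refine ⟨((‖T‖ + 1) ^ 2)⁻¹, by positivity, fun x => ?_⟩
  refine le_trans ?_ (h3 _)
  rw [inv_mul_le_iff₀ (by positivity), ← mul_pow]
  gcongr
  exact h1 x

/-- The theta transformation formula for a real positive definite quadratic form. -/
theorem tsum_gaussian_eq [DecidableEq ι] {B : Matrix ι ι ℝ} (hB : B.det ≠ 0) :
    ∑' k : ι → ℤ, Complex.exp (-(Real.pi * ∑ i, (B.mulVec fun j => (k j : ℝ)) i ^ 2 : ℝ)) =
      (|B.det|⁻¹ : ℝ) * ∑' k : ι → ℤ,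
        Complex.exp (-(Real.pi * ∑ i, (B⁻¹.transpose.mulVec fun j => (k j : ℝ)) i ^ 2 : ℝ)) := by
  set f : (ι → ℝ) → ℂ := fun x => Complex.exp (-(Real.pi * ∑ i, (B.mulVec x) i ^ 2 : ℝ)) with hf
  have hinv : B⁻¹ * B = 1 := Matrix.nonsing_inv_mul _ (isUnit_iff_ne_zero.2 hB)
  have hmap := Real.map_matrix_volume_pi_eq_smul_volume_pi hB
  have hme : MeasurableEmbedding (Matrix.toLin' B) := by
    refine (LinearMap.continuous_of_finiteDimensional _).measurableEmbedding fun x y hxy => ?_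
    rw [Matrix.toLin'_apply, Matrix.toLin'_apply] at hxy
    simpa [Matrix.mulVec_mulVec, hinv] using congrArg B⁻¹.mulVec hxy
  have hfour : ∀ k : ι → ℤ,
      ∫ x, Complex.exp (-(2 * Real.pi * Complex.I * ∑ i, (k i : ℂ) * x i)) * f x =
      (|B.det|⁻¹ : ℝ) *
        Complex.exp (-(Real.pi * ∑ i, (B⁻¹.transpose.mulVec fun j => (k j : ℝ)) i ^ 2 : ℝ)) := by
    intro k
    -- Under y = Bx the frequency k becomes w = B⁻ᵀk, which reduces the integral to the standard
    -- Gaussian; the Jacobian contributes |det B|⁻¹.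
    set w := B⁻¹.transpose.mulVec fun j => (k j : ℝ) with hw
    have h1 : ∀ x, Complex.exp (-(2 * Real.pi * Complex.I * ∑ i, (k i : ℂ) * x i)) * f x =
        (fun y : ι → ℝ => Complex.exp (-(Real.pi : ℂ) * ∑ i, (y i : ℂ) ^ 2 +
          ∑ i, (-(2 * Real.pi * Complex.I * w i)) * y i)) (Matrix.toLin' B x) := by
      intro x
      have h2 : ∑ i, (k i : ℝ) * x i = ∑ i, w i * (B.mulVec x) i := by
        change (fun j => (k j : ℝ)) ⬝ᵥ x = w ⬝ᵥ (B.mulVec x)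
        rw [hw, Matrix.mulVec_transpose, Matrix.dotProduct_mulVec, Matrix.vecMul_vecMul, hinv,
          Matrix.vecMul_one]
      have h3 : ∑ i, (k i : ℂ) * x i = ∑ i, (w i : ℂ) * (B.mulVec x) i := by
        exact_mod_cast congrArg (fun t : ℝ => (t : ℂ)) h2
      simp only [hf]
      rw [← Complex.exp_add, h3, Matrix.toLin'_apply]
      congr 1
      push_cast
      simp only [Finset.mul_sum, ← Finset.sum_neg_distrib, ← Finset.sum_add_distrib]
      refine Finset.sum_congr rfl fun i _ => by ring
    rw [integral_congr_ae (.of_forall h1)]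
    rw [← hme.integral_map (fun y : ι → ℝ => Complex.exp (-(Real.pi : ℂ) * ∑ i, (y i : ℂ) ^ 2 +
          ∑ i, (-(2 * Real.pi * Complex.I * w i)) * y i)), hmap, integral_smul_measure,
      GaussianFourier.integral_cexp_neg_mul_sum_add (by simpa using Real.pi_pos)]
    rw [div_self (by exact_mod_cast Real.pi_ne_zero), Complex.one_cpow, one_mul,
      ENNReal.toReal_ofReal (abs_nonneg _), abs_inv, Complex.real_smul]
    congr 2
    push_cast
    rw [div_eq_iff (by norm_num [Real.pi_ne_zero])]
    simp only [mul_pow, neg_sq, Complex.I_sq, Finset.mul_sum, Finset.sum_mul,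
      ← Finset.sum_neg_distrib]
    refine Finset.sum_congr rfl fun i _ => by ring
  have hnorm : ∀ (A : Matrix ι ι ℝ) (x : ι → ℝ),
      ‖Complex.exp (-(Real.pi * ∑ i, (A.mulVec x) i ^ 2 : ℝ))‖ =
        Real.exp (-(Real.pi * ∑ i, (A.mulVec x) i ^ 2)) := by
    intro A x
    rw [← Complex.ofReal_neg, ← Complex.ofReal_exp, Complex.norm_real, Real.norm_eq_abs,
      Real.abs_exp]
  have hbd : ∀ A : Matrix ι ι ℝ, A.det ≠ 0 → ∀ R : ℝ, ∃ u : (ι → ℤ) → ℝ, Summable u ∧ ∀ k x,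
      ‖x‖ ≤ R → ‖Complex.exp (-(Real.pi *
        ∑ i, (A.mulVec (x + fun i => (k i : ℝ))) i ^ 2 : ℝ))‖ ≤ u k := by
    intro A hA R
    obtain ⟨c, hc, hc'⟩ := exists_pos_mul_sq_norm_le_sum hA
    have hpi := Real.pi_pos
    -- From ‖k‖² ≤ 2‖x+k‖² + 2R², half of the quadratic decay survives uniformly in ‖x‖ ≤ R, at the
    -- cost of the constant factor.
    refine ⟨fun k => Real.exp (Real.pi * c * R ^ 2) *
      Real.exp (-(Real.pi * c / 2 * ‖fun i => (k i : ℝ)‖ ^ 2)),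
      (summable_int_exp_neg_mul_sq_norm (by positivity)).mul_left _, fun k x hx => ?_⟩
    rw [hnorm]
    beta_reduce
    rw [← Real.exp_add, Real.exp_le_exp]
    have h1 := hc' (x + fun i => (k i : ℝ))
    have h2 : ‖fun i => (k i : ℝ)‖ ≤ ‖x + fun i => (k i : ℝ)‖ + ‖x‖ := by
      have := norm_sub_le (x + fun i => (k i : ℝ)) x
      simpa using this
    have h3 : ‖fun i => (k i : ℝ)‖ ^ 2 ≤ 2 * ‖x + fun i => (k i : ℝ)‖ ^ 2 + 2 * R ^ 2 := by
      have h4 : ‖x‖ ^ 2 ≤ R ^ 2 := by gcongr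
      nlinarith [sq_nonneg (‖x + fun i => (k i : ℝ)‖ - ‖x‖), norm_nonneg (fun i => (k i : ℝ))]
    have h5 : c * ‖fun i => (k i : ℝ)‖ ^ 2 / 2 - c * R ^ 2 ≤
        ∑ i, (A.mulVec (x + fun i => (k i : ℝ))) i ^ 2 := by
      refine le_trans ?_ h1
      have := mul_le_mul_of_nonneg_left h3 hc.le
      linarith
    have := mul_le_mul_of_nonneg_left h5 hpi.le
    linarith
  have hcont : Continuous f := by
    have : Continuous fun x : ι → ℝ => ∑ i, (B.mulVec x) i ^ 2 :=
      continuous_finsetSum _ fun i _ => ((continuous_apply i).comp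
        (Continuous.matrix_mulVec continuous_const continuous_id)).pow 2
    exact Complex.continuous_exp.comp
      (Complex.continuous_ofReal.comp (continuous_const.mul this)).neg
  have hdet' : B⁻¹.transpose.det ≠ 0 := by
    rw [Matrix.det_transpose, Matrix.det_nonsing_inv]
    simpa using hB
  have hint : Integrable f := by
    have h1 : Integrable (fun y : ι → ℝ => Complex.exp (-(Real.pi : ℂ) * ∑ i, (y i : ℂ) ^ 2 +
          ∑ i, (0 : ℂ) * y i)) (Measure.map (Matrix.toLin' B) volume) := by
      rw [hmap]
      exact (GaussianFourier.integrable_cexp_neg_mul_sum_add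
        (by simpa using Real.pi_pos) _).smul_measure ENNReal.ofReal_ne_top
    rw [hme.integrable_map_iff] at h1
    refine h1.congr (.of_forall fun x => ?_)
    simp [hf, Matrix.toLin'_apply]
  rw [tsum_int_eq_tsum_fourier hcont hint (hbd B hB)]
  · simp_rw [hfour]
    rw [tsum_mul_left]
  · simp_rw [hfour]
    refine Summable.mul_left _ ?_
    obtain ⟨u, hu, hu'⟩ := hbd _ hdet' 0
    refine Summable.of_norm_bounded hu fun k => ?_
    have := hu' k 0 (by simp)
    rwa [zero_add] at this

end Poisson
end HermitianTheta
end

noncomputable section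
namespace HermitianTheta

/-! ### Positivity on the Hermitian half space. -/

section HalfSpace

variable {n : ℕ}

theorem star_dotProduct_conjTranspose_mulVec (Z : Matrix (Fin n) (Fin n) ℂ) (x : Fin n → ℂ) :
    star x ⬝ᵥ Z.conjTranspose.mulVec x = star (star x ⬝ᵥ Z.mulVec x) := by
  rw [Matrix.star_dotProduct, Matrix.star_mulVec, Matrix.conjTranspose_conjTranspose,
    ← Matrix.dotProduct_mulVec]

/-- The Hermitian half space consists of the matrices for which the imaginary part of the
associated sesquilinear form is positive. -/
theorem mem_halfSpace_iff {Z : Matrix (Fin n) (Fin n) ℂ} :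
    Z ∈ halfSpace n ↔ ∀ x : Fin n → ℂ, x ≠ 0 → 0 < (star x ⬝ᵥ Z.mulVec x).im := by
  have hform : ∀ x : Fin n → ℂ,
      star x ⬝ᵥ ((1 / (2 * Complex.I)) • (Z - Z.conjTranspose)).mulVec x =
        ((star x ⬝ᵥ Z.mulVec x).im : ℂ) := by
    intro x
    rw [Matrix.smul_mulVec, Matrix.sub_mulVec, dotProduct_smul, dotProduct_sub,
      star_dotProduct_conjTranspose_mulVec, Complex.star_def, Complex.sub_conj, smul_eq_mul]
    field_simp
    ring_nf
    simp
  have hH : ((1 / (2 * Complex.I)) • (Z - Z.conjTranspose)).IsHermitian := by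
    rw [Matrix.IsHermitian, Matrix.conjTranspose_smul, Matrix.conjTranspose_sub,
      Matrix.conjTranspose_conjTranspose, ← neg_sub Z, smul_neg, ← neg_smul]
    congr 1
    simp
  rw [halfSpace, Set.mem_ofPred_eq, Matrix.posDef_iff_dotProduct_mulVec]
  constructor
  · rintro ⟨-, h⟩ x hx
    have := h hx
    rw [hform] at this
    exact_mod_cast this
  · intro h
    refine ⟨hH, fun {x} hx => ?_⟩
    rw [hform]
    exact_mod_cast h x hx

theorem norm_star_dotProduct_mulVec_le (Z : Fin n → Fin n → ℂ) (x : Fin n → ℂ) :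
    ‖star x ⬝ᵥ (Matrix.of Z).mulVec x‖ ≤ n ^ 2 * ‖Z‖ * ‖x‖ ^ 2 := by
  simp only [dotProduct, Matrix.mulVec, Finset.mul_sum, Matrix.of_apply]
  refine (norm_sum_le _ _).trans ?_
  refine (Finset.sum_le_sum fun i _ => norm_sum_le _ _).trans ?_
  have : ∀ i j, ‖star x i * (Z i j * x j)‖ ≤ ‖Z‖ * ‖x‖ ^ 2 := by
    intro i j
    rw [norm_mul, norm_mul, Pi.star_apply, norm_star]
    have h1 := norm_le_pi_norm x i
    have h2 := norm_le_pi_norm x j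
    have h3 := (norm_le_pi_norm (Z i) j).trans (norm_le_pi_norm Z i)
    calc ‖x i‖ * (‖Z i j‖ * ‖x j‖) ≤ ‖x‖ * (‖Z‖ * ‖x‖) := by gcongr
      _ = _ := by ring
  refine (Finset.sum_le_sum fun i _ => Finset.sum_le_sum fun j _ => this i j).trans ?_
  simp only [Finset.sum_const, Finset.card_univ, Fintype.card_fin, nsmul_eq_mul]
  exact le_of_eq (by ring)

/-- The continuous positive function x ↦ Im(x*Zx) attains its minimum on the unit sphere, and
homogeneity of degree two extends the bound to all x. -/
theorem exists_coercive {Z : Matrix (Fin n) (Fin n) ℂ} (hZ : Z ∈ halfSpace n) :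
    ∃ c : ℝ, 0 < c ∧ ∀ x : Fin n → ℂ, c * ‖x‖ ^ 2 ≤ (star x ⬝ᵥ Z.mulVec x).im := by
  have hcont : Continuous fun x : Fin n → ℂ => (star x ⬝ᵥ Z.mulVec x).im := by
    simp only [dotProduct, Matrix.mulVec, Pi.star_apply]
    fun_prop
  -- The sphere is empty exactly when n = 0.
  rcases (Metric.sphere (0 : Fin n → ℂ) 1).eq_empty_or_nonempty with he | hne
  · refine ⟨1, one_pos, fun x => ?_⟩
    have : x = 0 := by
      by_contra hx
      have : ((‖x‖⁻¹ : ℝ) : ℂ) • x ∈ Metric.sphere (0 : Fin n → ℂ) 1 := by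
        rw [mem_sphere_zero_iff_norm, norm_smul, Complex.norm_real, norm_inv, norm_norm,
          inv_mul_cancel₀ (norm_ne_zero_iff.2 hx)]
      rw [he] at this
      exact this
    subst this
    simp
  obtain ⟨x₀, hx₀, hmin⟩ := (isCompact_sphere (0 : Fin n → ℂ) 1).exists_isMinOn hne hcont.continuousOn
  have hx₀' : x₀ ≠ 0 := by
    rintro rfl
    simp at hx₀
  refine ⟨_, mem_halfSpace_iff.1 hZ x₀ hx₀', fun x => ?_⟩
  by_cases hx : x = 0
  · subst hx; simp
  have hxn : ‖x‖ ≠ 0 := norm_ne_zero_iff.2 hx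
  have hy : ((‖x‖⁻¹ : ℝ) : ℂ) • x ∈ Metric.sphere (0 : Fin n → ℂ) 1 := by
    rw [mem_sphere_zero_iff_norm, norm_smul, Complex.norm_real, norm_inv, norm_norm,
      inv_mul_cancel₀ hxn]
  have h1 := isMinOn_iff.1 hmin _ hy
  have h2 : (star (((‖x‖⁻¹ : ℝ) : ℂ) • x) ⬝ᵥ Z.mulVec (((‖x‖⁻¹ : ℝ) : ℂ) • x)).im =
      (‖x‖ ^ 2)⁻¹ * (star x ⬝ᵥ Z.mulVec x).im := by
    rw [Matrix.mulVec_smul, dotProduct_smul, star_smul, smul_dotProduct, smul_smul, smul_eq_mul,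
      Complex.star_def, Complex.conj_ofReal, ← Complex.ofReal_mul, Complex.im_ofReal_mul]
    congr 1
    rw [← mul_inv, sq]
  rw [h2] at h1
  calc _ ≤ (‖x‖ ^ 2)⁻¹ * (star x ⬝ᵥ Z.mulVec x).im * ‖x‖ ^ 2 := by gcongr
    _ = _ := by field_simp

/-- The coercivity constant of a point of the half space can be chosen locally uniformly. -/
theorem exists_coercive_ball {Z₀ : Fin n → Fin n → ℂ} (hZ₀ : Matrix.of Z₀ ∈ halfSpace n) :
    ∃ c : ℝ, 0 < c ∧ ∃ δ : ℝ, 0 < δ ∧ ∀ Z ∈ Metric.ball Z₀ δ, ∀ x : Fin n → ℂ,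
      c * ‖x‖ ^ 2 ≤ (star x ⬝ᵥ (Matrix.of Z).mulVec x).im := by
  obtain ⟨c, hc, h⟩ := exists_coercive hZ₀
  -- The radius is chosen so that n²‖Z - Z₀‖ ≤ c/2, so a perturbation costs at most half of the
  -- coercivity. The added 1 keeps the denominator positive for n = 0.
  refine ⟨c / 2, by positivity, c / (2 * (n ^ 2 + 1)), by positivity, fun Z hZ x => ?_⟩
  have h1 := norm_star_dotProduct_mulVec_le (Z - Z₀) x
  have h2 : star x ⬝ᵥ (Matrix.of Z).mulVec x =
      star x ⬝ᵥ (Matrix.of Z₀).mulVec x + star x ⬝ᵥ (Matrix.of (Z - Z₀)).mulVec x := by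
    rw [← Matrix.of_sub_of, Matrix.sub_mulVec, dotProduct_sub]; ring
  have h3 := (Complex.abs_im_le_norm (star x ⬝ᵥ (Matrix.of (Z - Z₀)).mulVec x)).trans h1
  rw [mem_ball_iff_norm, lt_div_iff₀ (by positivity)] at hZ
  have h4 : (n : ℝ) ^ 2 * ‖Z - Z₀‖ ≤ c / 2 := by
    nlinarith [norm_nonneg (Z - Z₀)]
  have h5 := mul_le_mul_of_nonneg_right h4 (sq_nonneg ‖x‖)
  have h6 := h x
  have h7 := neg_abs_le (star x ⬝ᵥ (Matrix.of (Z - Z₀)).mulVec x).im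
  rw [h2, Complex.add_im]
  linarith

theorem isOpen_halfSpace : IsOpen (halfSpace n) := by
  have : IsOpen {Z : Fin n → Fin n → ℂ | Matrix.of Z ∈ halfSpace n} := by
    refine Metric.isOpen_iff.2 fun Z hZ => ?_
    obtain ⟨c, hc, δ, hδ, h⟩ := exists_coercive_ball hZ
    refine ⟨δ, hδ, fun Z' hZ' => mem_halfSpace_iff.2 fun x hx => ?_⟩
    have : 0 < ‖x‖ := norm_pos_iff.2 hx
    exact lt_of_lt_of_le (by positivity) (h Z' hZ' x)
  exact this

end HalfSpace

/-! ### The theta series as a sum over Λ^n. -/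

section LatticeSum

variable {K : Type*} [Field K] [Algebra K ℂ] {r n : ℕ}

/-- The lattice `Λ^n`. -/
def tuples (n : ℕ) (Λ : Submodule (𝓞 K) (Fin r → ℂ)) : Submodule ℤ (Fin n → Fin r → ℂ) where
  carrier := {V | ∀ i, V i ∈ Λ}
  add_mem' hV hW i := Λ.add_mem (hV i) (hW i)
  zero_mem' _ := Λ.zero_mem
  smul_mem' c _ hV i := zsmul_mem (hV i) c

theorem discreteTopology_tuples {Λ : Submodule (𝓞 K) (Fin r → ℂ)} (h : DiscreteTopology Λ) :
    DiscreteTopology (tuples n Λ) := by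
  refine DiscreteTopology.of_continuous_injective
    (f := fun (V : tuples n Λ) (i : Fin n) => (⟨V.1 i, V.2 i⟩ : Λ)) ?_ ?_
  · exact continuous_pi fun i => Continuous.subtype_mk
      ((continuous_apply i).comp continuous_subtype_val) _
  · intro V W h
    refine Subtype.ext (funext fun i => ?_)
    exact Subtype.ext_iff.1 (congrFun h i)

/-- The Gram matrix of a tuple of vectors. -/
def gram (V : Fin n → Fin r → ℂ) : Matrix (Fin n) (Fin n) ℂ :=
  Matrix.of fun i j => herm (V i) (V j)

theorem gram_eq (V : Fin n → Fin r → ℂ) :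
    gram V = (Matrix.of V).transpose.conjTranspose * (Matrix.of V).transpose := by
  ext i j
  simp [gram, herm, Matrix.mul_apply, dotProduct]

theorem posSemidef_gram (V : Fin n → Fin r → ℂ) : (gram V).PosSemidef := by
  rw [gram_eq]
  exact Matrix.posSemidef_conjTranspose_mul_self _

/-- With the vectors as columns of X, the Gram matrix is X*X and tr(X*XZ) = tr(XZX*). The trace is
thus a sum over the r coordinates of values of the form of Z, so coercivity of Z passes to tuples.
-/
theorem trace_gram_mul (V : Fin n → Fin r → ℂ) (Z : Matrix (Fin n) (Fin n) ℂ) :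
    (gram V * Z).trace =
      ∑ a, star (fun i => star (V i a)) ⬝ᵥ Z.mulVec (fun i => star (V i a)) := by
  simp only [Matrix.trace, Matrix.diag, Matrix.mul_apply, gram, herm, dotProduct, Matrix.mulVec,
    Matrix.of_apply, Pi.star_apply, star_star, Finset.sum_mul, Finset.mul_sum]
  rw [Finset.sum_comm]
  refine Eq.trans (Finset.sum_congr rfl fun i _ => Finset.sum_comm) ?_
  rw [Finset.sum_comm]
  refine Finset.sum_congr rfl fun i _ => Finset.sum_congr rfl fun j _ =>
    Finset.sum_congr rfl fun k _ => by ring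

theorem sq_norm_le_sum_sq_norm (V : Fin n → Fin r → ℂ) :
    ‖V‖ ^ 2 ≤ ∑ a, ‖fun i => star (V i a)‖ ^ 2 := by
  have h0 : 0 ≤ ∑ a, ‖fun i => star (V i a)‖ ^ 2 := Finset.sum_nonneg fun a _ => sq_nonneg _
  have : ‖V‖ ≤ Real.sqrt (∑ a, ‖fun i => star (V i a)‖ ^ 2) := by
    refine (pi_norm_le_iff_of_nonneg (Real.sqrt_nonneg _)).2 fun i =>
      (pi_norm_le_iff_of_nonneg (Real.sqrt_nonneg _)).2 fun a => Real.le_sqrt_of_sq_le ?_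
    have h1 : ‖V i a‖ ≤ ‖fun i => star (V i a)‖ := by
      simpa using norm_le_pi_norm (fun i => star (V i a)) i
    calc ‖V i a‖ ^ 2 ≤ ‖fun i => star (V i a)‖ ^ 2 := by gcongr
      _ ≤ _ := Finset.single_le_sum (f := fun a => ‖fun i => star (V i a)‖ ^ 2)
        (fun a _ => sq_nonneg _) (Finset.mem_univ a)
  calc ‖V‖ ^ 2 ≤ Real.sqrt (∑ a, ‖fun i => star (V i a)‖ ^ 2) ^ 2 := by gcongr
    _ = _ := Real.sq_sqrt h0

theorem le_im_trace_gram_mul {Z : Matrix (Fin n) (Fin n) ℂ} {c : ℝ} (hc : 0 ≤ c)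
    (h : ∀ x : Fin n → ℂ, c * ‖x‖ ^ 2 ≤ (star x ⬝ᵥ Z.mulVec x).im) (V : Fin n → Fin r → ℂ) :
    c * ‖V‖ ^ 2 ≤ (gram V * Z).trace.im := by
  rw [trace_gram_mul, Complex.im_sum]
  refine (mul_le_mul_of_nonneg_left (sq_norm_le_sum_sq_norm V) hc).trans ?_
  rw [Finset.mul_sum]
  exact Finset.sum_le_sum fun a _ => h _

/-- The exponential attached to a tuple of vectors. -/
def thetaExp (Z : Matrix (Fin n) (Fin n) ℂ) (V : Fin n → Fin r → ℂ) : ℂ :=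
  Complex.exp (Complex.I * Real.pi * (gram V * Z).trace)

theorem norm_thetaExp (Z : Matrix (Fin n) (Fin n) ℂ) (V : Fin n → Fin r → ℂ) :
    ‖thetaExp Z V‖ = Real.exp (-(Real.pi * (gram V * Z).trace.im)) := by
  rw [thetaExp, Complex.norm_exp]
  congr 1
  rw [mul_assoc, Complex.I_mul_re, Complex.im_ofReal_mul]

variable {Λ : Submodule (𝓞 K) (Fin r → ℂ)}

theorem summable_exp_tuples (hΛ : DiscreteTopology Λ) {c : ℝ} (hc : 0 < c) :
    Summable fun V : tuples n Λ => Real.exp (-(c * ‖V.1‖ ^ 2)) := by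
  have := discreteTopology_tuples (n := n) hΛ
  exact summable_exp_neg_mul_sq_norm (tuples n Λ) hc

theorem norm_thetaExp_le {Z : Matrix (Fin n) (Fin n) ℂ} {c : ℝ} (hc : 0 ≤ c)
    (h : ∀ x : Fin n → ℂ, c * ‖x‖ ^ 2 ≤ (star x ⬝ᵥ Z.mulVec x).im) (V : Fin n → Fin r → ℂ) :
    ‖thetaExp Z V‖ ≤ Real.exp (-(Real.pi * c * ‖V‖ ^ 2)) := by
  rw [norm_thetaExp, Real.exp_le_exp, neg_le_neg_iff, mul_assoc]
  exact mul_le_mul_of_nonneg_left (le_im_trace_gram_mul hc h V) Real.pi_pos.le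

theorem summable_thetaExp (hΛ : DiscreteTopology Λ) {Z : Matrix (Fin n) (Fin n) ℂ}
    (hZ : Z ∈ halfSpace n) : Summable fun V : tuples n Λ => thetaExp Z V.1 := by
  obtain ⟨c, hc, h⟩ := exists_coercive hZ
  exact .of_norm_bounded (summable_exp_tuples hΛ (mul_pos Real.pi_pos hc))
    fun V => norm_thetaExp_le hc.le h V.1

/-- The sum over tuples converges absolutely, so it may be taken along the fibres of the Gram map;
the summand is constant on each fibre. -/
theorem hasSum_thetaTerm (hΛ : DiscreteTopology Λ) {Z : Matrix (Fin n) (Fin n) ℂ}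
    (hZ : Z ∈ halfSpace n) :
    HasSum (thetaTerm Λ Z) (∑' V : tuples n Λ, thetaExp Z V.1) := by
  set φ : tuples n Λ → {T : Matrix (Fin n) (Fin n) ℂ // T.PosSemidef} :=
    fun V => ⟨gram V.1, posSemidef_gram V.1⟩ with hφ
  have h := (summable_thetaExp (n := n) hΛ hZ).hasSum.tsum_fiberwise φ
  convert! h using 2 with T
  have h1 : ∀ V : φ ⁻¹' {T},
      thetaExp Z V.1.1 = Complex.exp (Complex.I * Real.pi * (T.1 * Z).trace) := by
    rintro ⟨V, hV⟩
    have : gram V.1 = T.1 := congrArg Subtype.val hV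
    rw [thetaExp, this]
  rw [tsum_congr h1, tsum_const, nsmul_eq_mul, thetaTerm]
  congr 2
  rw [← Nat.card_coe_set_eq]
  refine Nat.card_congr
    ⟨fun V => ⟨⟨V.1, V.2.1⟩, Subtype.ext V.2.2⟩, fun V => ⟨V.1.1, V.1.2, ?_⟩, ?_, ?_⟩
  · exact congrArg Subtype.val V.2
  · intro V; rfl
  · intro V; rfl

theorem theta_eq_tsum (hΛ : DiscreteTopology Λ) {Z : Matrix (Fin n) (Fin n) ℂ}
    (hZ : Z ∈ halfSpace n) : theta n Λ Z = ∑' V : tuples n Λ, thetaExp Z V.1 :=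
  (hasSum_thetaTerm hΛ hZ).tsum_eq

theorem I_smul_one_mem_halfSpace : (Complex.I • 1 : Matrix (Fin n) (Fin n) ℂ) ∈ halfSpace n := by
  refine mem_halfSpace_iff.2 fun x hx => ?_
  rw [Matrix.smul_mulVec, Matrix.one_mulVec, dotProduct_smul, smul_eq_mul, Complex.I_mul_im]
  have := Matrix.dotProduct_star_self_pos_iff.2 hx
  exact (Complex.pos_iff.1 this).1

/-- At Z = i the tuples with Gram matrix T contribute a constant nonzero subfamily of a summable
family, which forces that subfamily to be finite. -/
theorem finite_representations (hΛ : DiscreteTopology Λ) (T : Matrix (Fin n) (Fin n) ℂ) :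
    (representations Λ T).Finite := by
  have h := summable_thetaExp (n := n) (Λ := Λ) hΛ I_smul_one_mem_halfSpace
  set c := Complex.exp (Complex.I * Real.pi * (T * (Complex.I • 1)).trace) with hc
  have h2 := h.comp_injective (i := fun V : representations Λ T => (⟨V.1, V.2.1⟩ : tuples n Λ))
    fun V W hVW => Subtype.ext (congrArg (fun U : tuples n Λ => U.1) hVW)
  have h3 : Summable fun _ : representations Λ T => c := by
    refine h2.congr fun V => ?_
    have : gram V.1 = T := V.2.2
    simp only [Function.comp, thetaExp, this, hc]
  by_contra hinf
  have : Infinite (representations Λ T) := Set.infinite_coe_iff.2 hinf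
  exact Complex.exp_ne_zero _ ((summable_const_iff _).1 h3)

/-- The linear functional `Z ↦ tr(T Z)`. -/
def traceFunctional (T : Matrix (Fin n) (Fin n) ℂ) : (Fin n → Fin n → ℂ) →L[ℂ] ℂ :=
  LinearMap.toContinuousLinearMap
    { toFun := fun Z => (T * Matrix.of Z).trace
      map_add' := fun Z W => by rw [← Matrix.of_add_of, Matrix.mul_add, Matrix.trace_add]
      map_smul' := fun c Z => by
        rw [← Matrix.smul_of, Matrix.mul_smul, Matrix.trace_smul, RingHom.id_apply] }

theorem traceFunctional_apply (T : Matrix (Fin n) (Fin n) ℂ) (Z : Fin n → Fin n → ℂ) :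
    traceFunctional T Z = (T * Matrix.of Z).trace := rfl

theorem norm_traceFunctional_gram_le (V : Fin n → Fin r → ℂ) :
    ‖traceFunctional (gram V)‖ ≤ r * n ^ 2 * ‖V‖ ^ 2 := by
  refine ContinuousLinearMap.opNorm_le_bound _ (by positivity) fun Z => ?_
  rw [traceFunctional_apply, trace_gram_mul]
  refine (norm_sum_le _ _).trans ?_
  have : ∀ a ∈ Finset.univ, ‖star (fun i => star (V i a)) ⬝ᵥ
      (Matrix.of Z).mulVec (fun i => star (V i a))‖ ≤ n ^ 2 * ‖Z‖ * ‖V‖ ^ 2 := by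
    intro a _
    refine (norm_star_dotProduct_mulVec_le Z _).trans ?_
    gcongr
    refine (pi_norm_le_iff_of_nonneg (norm_nonneg _)).2 fun i => ?_
    rw [norm_star]
    exact (norm_le_pi_norm (V i) a).trans (norm_le_pi_norm V i)
  refine (Finset.sum_le_sum this).trans (le_of_eq ?_)
  simp only [Finset.sum_const, Finset.card_univ, Fintype.card_fin, nsmul_eq_mul]
  ring

/-- Absorbs the factor ‖V‖² produced by differentiating a term in Z into half of its exponential
decay. -/
theorem mul_exp_neg_le {a t : ℝ} (ha : 0 < a) :
    t * Real.exp (-(a * t)) ≤ 2 / a * Real.exp (-(a / 2 * t)) := by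
  have h1 : a / 2 * t ≤ Real.exp (a / 2 * t) := by
    have := Real.add_one_le_exp (a / 2 * t)
    linarith
  have h2 : Real.exp (-(a * t)) = Real.exp (-(a / 2 * t)) * Real.exp (-(a / 2 * t)) := by
    rw [← Real.exp_add]; ring_nf
  have h3 : Real.exp (a / 2 * t) * Real.exp (-(a / 2 * t)) = 1 := by
    rw [← Real.exp_add]; simp
  have h4 : t * Real.exp (-(a / 2 * t)) ≤ 2 / a := by
    rw [le_div_iff₀ ha]
    have := mul_le_mul_of_nonneg_right h1 (Real.exp_pos (-(a / 2 * t))).le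
    rw [h3] at this
    linarith
  rw [h2, ← mul_assoc]
  exact mul_le_mul_of_nonneg_right h4 (Real.exp_pos _).le

/-- Termwise differentiation on a ball with a common coercivity constant: the derivative of a term
is its value times a functional of norm O(‖V‖²), so the derivatives have a summable Gaussian
majorant. -/
theorem differentiableAt_tsum_thetaExp (hΛ : DiscreteTopology Λ) {Z₀ : Fin n → Fin n → ℂ}
    (hZ₀ : Matrix.of Z₀ ∈ halfSpace n) :
    DifferentiableAt ℂ (fun Z => ∑' V : tuples n Λ, thetaExp (Matrix.of Z) V.1) Z₀ := by
  obtain ⟨c, hc, δ, hδ, h⟩ := exists_coercive_ball hZ₀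
  have hpi := Real.pi_pos
  have hu : Summable fun V : tuples n Λ => Real.pi * (r * n ^ 2) * (2 / (Real.pi * c)) *
      Real.exp (-(Real.pi * c / 2 * ‖V.1‖ ^ 2)) :=
    (summable_exp_tuples hΛ (by positivity)).mul_left _
  refine (hasFDerivAt_tsum_of_isPreconnected (x₀ := Z₀) (𝕜 := ℂ) 
    (f := fun (V : tuples n Λ) Z => thetaExp (Matrix.of Z) V.1)
    (f' := fun V Z => thetaExp (Matrix.of Z) V.1 • (Complex.I * Real.pi) • traceFunctional (gram V.1))
    hu Metric.isOpen_ball (convex_ball Z₀ δ).isPreconnected (fun V Z _ => ?_) (fun V Z hZ => ?_)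
    (Metric.mem_ball_self hδ) (summable_thetaExp hΛ hZ₀) (Metric.mem_ball_self hδ)).differentiableAt
  · exact ((traceFunctional (gram V.1)).hasFDerivAt.const_mul (Complex.I * Real.pi)).cexp
  · rw [norm_smul, norm_smul]
    have h1 := norm_thetaExp_le hc.le (h Z hZ) V.1
    have h2 := norm_traceFunctional_gram_le V.1
    have h3 : ‖Complex.I * Real.pi‖ = Real.pi := by simp [abs_of_pos hpi]
    rw [h3]
    have h4 := mul_exp_neg_le (a := Real.pi * c) (t := ‖V.1‖ ^ 2) (by positivity)
    calc ‖thetaExp (Matrix.of Z) V.1‖ * (Real.pi * ‖traceFunctional (gram V.1)‖)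
        ≤ Real.exp (-(Real.pi * c * ‖V.1‖ ^ 2)) * (Real.pi * (r * n ^ 2 * ‖V.1‖ ^ 2)) := by gcongr
      _ = Real.pi * (r * n ^ 2) * (‖V.1‖ ^ 2 * Real.exp (-(Real.pi * c * ‖V.1‖ ^ 2))) := by ring
      _ ≤ Real.pi * (r * n ^ 2) * (2 / (Real.pi * c) *
            Real.exp (-(Real.pi * c / 2 * ‖V.1‖ ^ 2))) := by gcongr
      _ = _ := by ring

theorem differentiableOn_theta (hΛ : DiscreteTopology Λ) :
    DifferentiableOn ℂ (theta n Λ) (halfSpace n) :=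
  DifferentiableOn.congr
    (fun _ hZ => (differentiableAt_tsum_thetaExp hΛ hZ).differentiableWithinAt) fun _ hZ => theta_eq_tsum hΛ hZ

/-- In degree one, Im Z ≥ 1 says that 1 is a coercivity constant, so a single Gaussian sum bounds
the series on the whole region. -/
theorem exists_bound_theta (hΛ : DiscreteTopology Λ) (hn : n = 1) :
    ∃ C : ℝ, ∀ Z ∈ halfSpace n, (∀ i, 1 ≤ (Z i i).im) → ‖theta n Λ Z‖ ≤ C := by
  subst hn
  have hs : Summable fun V : tuples 1 Λ => Real.exp (-(Real.pi * 1 * ‖V.1‖ ^ 2)) :=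
    summable_exp_tuples hΛ (by simpa using Real.pi_pos)
  refine ⟨∑' V : tuples 1 Λ, Real.exp (-(Real.pi * 1 * ‖V.1‖ ^ 2)), fun Z hZ hZ1 => ?_⟩
  rw [theta_eq_tsum hΛ hZ]
  refine tsum_of_norm_bounded hs.hasSum fun V => norm_thetaExp_le zero_le_one (fun x => ?_) V.1
  have h1 : star x ⬝ᵥ Z.mulVec x = ((‖x 0‖ ^ 2 : ℝ) : ℂ) * Z 0 0 := by
    simp only [dotProduct, Matrix.mulVec, Finset.univ_unique, Fin.default_eq_zero,
      Finset.sum_singleton, Pi.star_apply, Complex.star_def]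
    rw [mul_left_comm, ← Complex.normSq_eq_conj_mul_self, Complex.normSq_eq_norm_sq, mul_comm]
  have h2 : ‖x‖ = ‖x 0‖ := by
    refine le_antisymm ((pi_norm_le_iff_of_nonneg (norm_nonneg _)).2 fun i => ?_)
      (norm_le_pi_norm x 0)
    rw [Subsingleton.elim i 0]
  rw [h1, h2, Complex.im_ofReal_mul, one_mul]
  exact le_mul_of_one_le_right (sq_nonneg _) (hZ1 0)

end LatticeSum

end HermitianTheta
end

noncomputable section
namespace HermitianTheta

/-! ### The inversion formula at the points iY. -/

section RealInversion

theorem sum_sq_mulVec {ι : Type*} [Fintype ι] (B : Matrix ι ι ℝ) (x : ι → ℝ) :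
    ∑ i, (B.mulVec x) i ^ 2 = x ⬝ᵥ (B.transpose * B).mulVec x := by
  rw [← Matrix.mulVec_mulVec, Matrix.dotProduct_mulVec, Matrix.vecMul_transpose]
  simp [dotProduct, sq]

/-- The theta transformation formula for a positive definite bilinear form. The vectors `U k` are
those of the dual lattice. -/
theorem tsum_exp_bilin {ι W : Type*} [Fintype ι] [DecidableEq ι] [AddCommGroup W] [Module ℝ W]
    (b : Module.Basis ι ℝ W) (β : W →ₗ[ℝ] W →ₗ[ℝ] ℝ) (hsymm : ∀ v w, β v w = β w v)
    (hpos : ∀ v, v ≠ 0 → 0 < β v v) (U : (ι → ℤ) → W) (hU : ∀ k l, β (b l) (U k) = k l) :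
    0 < (Matrix.of fun k l => β (b k) (b l)).det ∧
    ∑' k : ι → ℤ, Complex.exp (-(Real.pi * β (∑ i, k i • b i) (∑ i, k i • b i) : ℝ)) =
      ((Real.sqrt (Matrix.of fun k l => β (b k) (b l)).det)⁻¹ : ℝ) *
        ∑' k : ι → ℤ, Complex.exp (-(Real.pi * β (U k) (U k) : ℝ)) := by
  set G : Matrix ι ι ℝ := Matrix.of fun k l => β (b k) (b l) with hG
  have hquad : ∀ x : ι → ℝ, x ⬝ᵥ G.mulVec x = β (∑ i, x i • b i) (∑ i, x i • b i) := by
    intro x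
    simp only [map_sum, map_smul, LinearMap.sum_apply, LinearMap.smul_apply, smul_eq_mul,
      dotProduct, Matrix.mulVec, hG, Matrix.of_apply, Finset.mul_sum]
    rw [Finset.sum_comm]
    refine Finset.sum_congr rfl fun i _ => Finset.sum_congr rfl fun j _ => ?_
    ring
  have hGpos : G.PosDef := by
    refine Matrix.PosDef.of_dotProduct_mulVec_pos ?_ fun x hx => ?_
    · ext i j
      simp [hG, hsymm (b j)]
    · rw [star_trivial, hquad]
      refine hpos _ fun h => hx ?_
      funext i
      exact (linearIndependent_iff'.1 b.linearIndependent) Finset.univ x h i (Finset.mem_univ i)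
  obtain ⟨B, hBu, hB⟩ : ∃ B : Matrix ι ι ℝ, IsUnit B ∧ G = B.transpose * B := by
    open scoped MatrixOrder Matrix.Norms.L2Operator in
    obtain ⟨B, hB, hG⟩ :=
      CStarAlgebra.isStrictlyPositive_iff_eq_star_mul_self.1 hGpos.isStrictlyPositive
    refine ⟨B, hB, ?_⟩
    rw [hG, Matrix.star_eq_conjTranspose, Matrix.conjTranspose_eq_transpose_of_trivial]
  have hBdet : B.det ≠ 0 := ((Matrix.isUnit_iff_isUnit_det _).1 hBu).ne_zero
  have hdet : G.det = B.det ^ 2 := by rw [hB, Matrix.det_mul, Matrix.det_transpose, sq]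
  refine ⟨hGpos.det_pos, ?_⟩
  have h := tsum_gaussian_eq hBdet
  rw [hdet, Real.sqrt_sq_eq_abs]
  convert! h using 5 with k k
  · rw [sum_sq_mulVec, ← hB, hquad]
    simp
  -- The coordinates c of U k satisfy k = Gc, whence B⁻ᵀk = Bc, and the dual Gaussian becomes the
  -- form evaluated at U k.
  · set c := b.equivFun (U k) with hc
    have hUc : U k = ∑ i, c i • b i := (b.sum_equivFun (U k)).symm
    have hk : (fun j => (k j : ℝ)) = G.mulVec c := by
      funext l
      rw [← hU k l, hUc, map_sum]
      simp [Matrix.mulVec, dotProduct, hG, mul_comm]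
    have hBc : B⁻¹.transpose.mulVec (fun j => (k j : ℝ)) = B.mulVec c := by
      rw [hk, hB, Matrix.mulVec_mulVec, ← Matrix.mul_assoc, ← Matrix.transpose_mul,
        Matrix.mul_nonsing_inv _ (isUnit_iff_ne_zero.2 hBdet), Matrix.transpose_one,
        Matrix.one_mul]
    rw [hBc, sum_sq_mulVec, ← hB, hquad, ← hUc]

variable {K : Type*} [Field K] [Algebra K ℂ] {r n : ℕ}

/-- The matrix of Hermitian products of two tuples of vectors. -/
def crossGram (V W : Fin n → Fin r → ℂ) : Matrix (Fin n) (Fin n) ℂ :=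
  Matrix.of fun i j => herm (V i) (W j)

theorem crossGram_eq (V W : Fin n → Fin r → ℂ) :
    crossGram V W = (Matrix.of V).transpose.conjTranspose * (Matrix.of W).transpose := by
  ext i j
  simp [crossGram, herm, Matrix.mul_apply, dotProduct]

/-- Right multiplication of a tuple of vectors by a matrix. -/
def mulRight (A : Matrix (Fin n) (Fin n) ℂ) :
    (Fin n → Fin r → ℂ) →ₗ[ℂ] (Fin n → Fin r → ℂ) where
  toFun V j := ∑ i, A i j • V i
  map_add' V W := by funext j; simp [Finset.sum_add_distrib]
  map_smul' c V := by funext j; simp [Finset.smul_sum, smul_comm c]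

theorem mulRight_apply (A : Matrix (Fin n) (Fin n) ℂ) (V : Fin n → Fin r → ℂ) (j : Fin n) :
    mulRight A V j = ∑ i, A i j • V i := rfl

theorem of_mulRight (A : Matrix (Fin n) (Fin n) ℂ) (V : Fin n → Fin r → ℂ) :
    (Matrix.of (mulRight A V)).transpose = (Matrix.of V).transpose * A := by
  ext a j
  simp [mulRight_apply, Matrix.mul_apply, mul_comm]

theorem crossGram_mulRight (A : Matrix (Fin n) (Fin n) ℂ) (V W : Fin n → Fin r → ℂ) :
    crossGram V (mulRight A W) = crossGram V W * A := by
  rw [crossGram_eq, of_mulRight, crossGram_eq, Matrix.mul_assoc]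

theorem gram_mulRight (A : Matrix (Fin n) (Fin n) ℂ) (V : Fin n → Fin r → ℂ) :
    gram (mulRight A V) = A.conjTranspose * gram V * A := by
  rw [gram_eq, of_mulRight, gram_eq, Matrix.conjTranspose_mul]
  simp only [Matrix.mul_assoc]

theorem mulRight_mulRight (A B : Matrix (Fin n) (Fin n) ℂ) (V : Fin n → Fin r → ℂ) :
    mulRight A (mulRight B V) = mulRight (B * A) V := by
  have : Matrix.of (mulRight A (mulRight B V)) = Matrix.of (mulRight (B * A) V) := by
    apply Matrix.transpose_injective
    rw [of_mulRight, of_mulRight, of_mulRight, Matrix.mul_assoc]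
  exact Matrix.of.injective this

theorem mulRight_one (V : Fin n → Fin r → ℂ) : mulRight 1 V = V := by
  have : Matrix.of (mulRight 1 V) = Matrix.of V := by
    apply Matrix.transpose_injective
    rw [of_mulRight, Matrix.mul_one]
  exact Matrix.of.injective this

/-- Reading a tuple coordinate by coordinate, the map is r copies of the transpose of A. -/
theorem det_mulRight (A : Matrix (Fin n) (Fin n) ℂ) :
    LinearMap.det (mulRight (r := r) A) = A.det ^ r := by
  set e : (Fin n → Fin r → ℂ) ≃ₗ[ℂ] (Fin r → Fin n → ℂ) :=
    { toFun := fun V a i => V i a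
      invFun := fun V i a => V a i
      map_add' := fun _ _ => rfl
      map_smul' := fun _ _ => rfl
      left_inv := fun _ => rfl
      right_inv := fun _ => rfl } with he
  rw [← LinearMap.det_conj (mulRight A) e]
  have : (e : (Fin n → Fin r → ℂ) →ₗ[ℂ] (Fin r → Fin n → ℂ)) ∘ₗ mulRight A ∘ₗ
      (e.symm : (Fin r → Fin n → ℂ) →ₗ[ℂ] (Fin n → Fin r → ℂ)) =
      LinearMap.pi (fun a => (Matrix.toLin' A.transpose).comp (LinearMap.proj a)) := by
    refine LinearMap.ext fun V => funext fun a => funext fun i => ?_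
    simp [he, mulRight_apply, Matrix.mulVec, dotProduct]
  rw [this, LinearMap.det_pi]
  simp

/-- The real bilinear form `Re tr(V* W Y)`. -/
def traceForm (Y : Matrix (Fin n) (Fin n) ℂ) :
    (Fin n → Fin r → ℂ) →ₗ[ℝ] (Fin n → Fin r → ℂ) →ₗ[ℝ] ℝ :=
  LinearMap.mk₂ ℝ (fun V W => (crossGram V W * Y).trace.re)
    (fun V V' W => by
      have : crossGram (V + V') W = crossGram V W + crossGram V' W := by
        ext i j; simp [crossGram, herm, add_dotProduct]
      rw [this, Matrix.add_mul, Matrix.trace_add, Complex.add_re])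
    (fun c V W => by
      have : crossGram (c • V) W = c • crossGram V W := by
        ext i j; simp [crossGram, herm, smul_dotProduct]
      rw [this, Matrix.smul_mul, Matrix.trace_smul, Complex.smul_re])
    (fun V W W' => by
      have : crossGram V (W + W') = crossGram V W + crossGram V W' := by
        ext i j; simp [crossGram, herm, dotProduct_add]
      rw [this, Matrix.add_mul, Matrix.trace_add, Complex.add_re])
    (fun c V W => by
      have : crossGram V (c • W) = c • crossGram V W := by
        ext i j; simp [crossGram, herm, dotProduct_smul]
      rw [this, Matrix.smul_mul, Matrix.trace_smul, Complex.smul_re])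

theorem traceForm_apply (Y : Matrix (Fin n) (Fin n) ℂ) (V W : Fin n → Fin r → ℂ) :
    traceForm Y V W = (crossGram V W * Y).trace.re := rfl

/-- Moves Y into the second argument, so the dual of Λ^n for the form of Y is the dual for the form
of 1, multiplied on the right by Y⁻¹. -/
theorem traceForm_eq_one (Y : Matrix (Fin n) (Fin n) ℂ) (V W : Fin n → Fin r → ℂ) :
    traceForm Y V W = traceForm 1 V (mulRight Y W) := by
  rw [traceForm_apply, traceForm_apply, crossGram_mulRight, Matrix.mul_one]

theorem conjTranspose_crossGram (V W : Fin n → Fin r → ℂ) :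
    (crossGram V W).conjTranspose = crossGram W V := by
  rw [crossGram_eq, crossGram_eq, Matrix.conjTranspose_mul, Matrix.conjTranspose_conjTranspose]

theorem traceForm_symm {Y : Matrix (Fin n) (Fin n) ℂ} (hY : Y.IsHermitian)
    (V W : Fin n → Fin r → ℂ) : traceForm Y V W = traceForm Y W V := by
  rw [traceForm_apply, traceForm_apply, ← conjTranspose_crossGram W V]
  nth_rewrite 1 [← hY.eq]
  rw [← Matrix.conjTranspose_mul, Matrix.trace_conjTranspose, Complex.star_def, Complex.conj_re,
    Matrix.trace_mul_comm]

theorem I_smul_mem_halfSpace {Y : Matrix (Fin n) (Fin n) ℂ} (hY : Y.PosDef) :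
    Complex.I • Y ∈ halfSpace n := by
  refine mem_halfSpace_iff.2 fun x hx => ?_
  rw [Matrix.smul_mulVec, dotProduct_smul, smul_eq_mul, Complex.I_mul_im]
  exact (Complex.pos_iff.1 (hY.dotProduct_mulVec_pos hx)).1

theorem traceForm_self_pos {Y : Matrix (Fin n) (Fin n) ℂ} (hY : Y.PosDef)
    {V : Fin n → Fin r → ℂ} (hV : V ≠ 0) : 0 < traceForm Y V V := by
  obtain ⟨c, hc, h⟩ := exists_coercive (I_smul_mem_halfSpace hY)
  have h1 := le_im_trace_gram_mul hc.le h V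
  rw [Matrix.mul_smul, Matrix.trace_smul, smul_eq_mul, Complex.I_mul_im] at h1
  have : 0 < ‖V‖ := norm_pos_iff.2 hV
  exact lt_of_lt_of_le (by positivity) h1

theorem thetaExp_I_smul {Y : Matrix (Fin n) (Fin n) ℂ} (hY : Y.IsHermitian)
    (V : Fin n → Fin r → ℂ) :
    thetaExp (Complex.I • Y) V = Complex.exp (-(Real.pi * traceForm Y V V : ℝ)) := by
  have him : (gram V * Y).trace.im = 0 := by
    rw [← Complex.conj_eq_iff_im, ← Complex.star_def, ← Matrix.trace_conjTranspose,
      Matrix.conjTranspose_mul, hY.eq, (posSemidef_gram V).isHermitian.eq, Matrix.trace_mul_comm]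
  have hre : (gram V * Y).trace = (traceForm Y V V : ℂ) := by
    refine Complex.ext rfl ?_
    rw [him, Complex.ofReal_im]
  rw [thetaExp, Matrix.mul_smul, Matrix.trace_smul, hre, smul_eq_mul]
  congr 1
  push_cast
  linear_combination (Real.pi * traceForm Y V V : ℂ) * Complex.I_mul_I

variable {Λ : Submodule (𝓞 K) (Fin r → ℂ)}

theorem span_tuples (h : Submodule.span ℝ (Λ : Set (Fin r → ℂ)) = ⊤) :
    Submodule.span ℝ (tuples n Λ : Set (Fin n → Fin r → ℂ)) = ⊤ := by
  rw [eq_top_iff]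
  intro V _
  have hV : V = ∑ i, LinearMap.single ℝ (fun _ : Fin n => Fin r → ℂ) i (V i) := by
    funext j
    simp [Pi.single_apply]
  rw [hV]
  refine Submodule.sum_mem _ fun i _ => ?_
  have h1 : V i ∈ Submodule.span ℝ (Λ : Set (Fin r → ℂ)) := h ▸ Submodule.mem_top
  refine Submodule.span_induction (p := fun x _ =>
    LinearMap.single ℝ (fun _ : Fin n => Fin r → ℂ) i x ∈
      Submodule.span ℝ (tuples n Λ : Set (Fin n → Fin r → ℂ))) ?_ ?_ ?_ ?_ h1
  · intro x hx
    refine Submodule.subset_span fun j => ?_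
    rw [LinearMap.single_apply, Pi.single_apply]
    split_ifs
    · exact hx
    · exact Λ.zero_mem
  · simp
  · intro x y _ _ hx hy
    rw [map_add]
    exact Submodule.add_mem _ hx hy
  · intro c x _ hx
    rw [map_smul]
    exact Submodule.smul_mem _ _ hx

theorem herm_comm_re (x y : Fin r → ℂ) : (herm x y).re = (herm y x).re := by
  rw [herm, Matrix.star_dotProduct, Complex.star_def, Complex.conj_re, herm]

theorem traceForm_one (V W : Fin n → Fin r → ℂ) :
    traceForm 1 V W = ∑ i, (herm (V i) (W i)).re := by
  rw [traceForm_apply, Matrix.mul_one]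
  simp [Matrix.trace, crossGram]

/-- Unimodularity of Λ passes to Λ^n: for the converse, test against tuples supported in a single
position. -/
theorem mem_tuples_iff_traceForm (hΛ : IsThetaLattice Λ) (V : Fin n → Fin r → ℂ) :
    V ∈ tuples n Λ ↔ ∀ W ∈ tuples n Λ, ∃ k : ℤ, traceForm 1 W V = k := by
  constructor
  · intro hV W hW
    have : ∀ i, ∃ k : ℤ, (herm (W i) (V i)).re = k := fun i =>
      (hΛ.unimodular (W i)).1 (hW i) (V i) (hV i)
    choose k hk using this
    exact ⟨∑ i, k i, by rw [traceForm_one]; simp [hk]⟩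
  · intro h i
    refine (hΛ.unimodular (V i)).2 fun y hy => ?_
    obtain ⟨k, hk⟩ := h (Pi.single i y) fun j => by
      rw [Pi.single_apply]
      split_ifs
      · exact hy
      · exact Λ.zero_mem
    refine ⟨k, ?_⟩
    rw [← hk, traceForm_one, Finset.sum_eq_single i, Pi.single_eq_same, herm_comm_re]
    · intro j _ hj
      rw [Pi.single_eq_of_ne hj]
      simp [herm]
    · simp

/-- The inversion formula on the purely imaginary points, up to the covolume of the lattice. -/
theorem exists_theta_I_smul (hΛ : IsThetaLattice Λ) : ∃ d : ℝ, 0 < d ∧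
    ∀ Y : Matrix (Fin n) (Fin n) ℂ, Y.PosDef →
      ∑' V : tuples n Λ, thetaExp (Complex.I • Y) V.1 =
        ((d * Y.det.re ^ r)⁻¹ : ℝ) * ∑' V : tuples n Λ, thetaExp (Complex.I • Y⁻¹) V.1 := by
  classical
  have hdisc := discreteTopology_tuples (n := n) hΛ.discrete
  have hZ : IsZLattice ℝ (tuples n Λ) := ⟨span_tuples hΛ.full⟩
  have : Module.Finite ℤ (tuples n Λ) := ZLattice.module_finite ℝ _
  have : Module.Free ℤ (tuples n Λ) := ZLattice.module_free ℝ _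
  set ι := Module.Free.ChooseBasisIndex ℤ (tuples n Λ)
  set b₀ : Module.Basis ι ℤ (tuples n Λ) := Module.Free.chooseBasis ℤ (tuples n Λ)
  set b := b₀.ofZLatticeBasis ℝ (tuples n Λ) with hb
  have hbmem : ∀ l, b l ∈ tuples n Λ := fun l => by
    rw [hb, Module.Basis.ofZLatticeBasis_apply]; exact (b₀ l).2
  have hint : ∀ (V : tuples n Λ) (l : ι), ∃ k : ℤ, traceForm 1 (b l) V.1 = k := fun V l =>
    (mem_tuples_iff_traceForm hΛ V.1).1 V.2 _ (hbmem l)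
  choose κ hκ using hint
  have hpos1 : ∀ V : Fin n → Fin r → ℂ, V ≠ 0 → 0 < traceForm 1 V V := fun V hV =>
    traceForm_self_pos Matrix.PosDef.one hV
  have hinj1 : ∀ V : Fin n → Fin r → ℂ, (∀ l, traceForm 1 (b l) V = 0) → V = 0 := by
    intro V hV
    by_contra hne
    have h0 : (traceForm 1).flip V = 0 := b.ext fun l => hV l
    have h1 : traceForm 1 V V = 0 := LinearMap.congr_fun h0 V
    exact (hpos1 V hne).ne' h1
  -- Self-duality of Λ^n: pairing with the basis identifies it with all of ℤ^ι. Definiteness gives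
  -- injectivity, and a real solution of prescribed integral pairings lies in Λ^n again.
  have hbij : Function.Bijective κ := by
    constructor
    · intro V W hVW
      refine Subtype.ext (sub_eq_zero.1 (hinj1 _ fun l => ?_))
      rw [map_sub, hκ, hκ, hVW, sub_self]
    · intro k
      set T : (Fin n → Fin r → ℂ) →ₗ[ℝ] (ι → ℝ) := LinearMap.pi fun l => traceForm 1 (b l)
      have hTinj : Function.Injective T := by
        rw [← LinearMap.ker_eq_bot, LinearMap.ker_eq_bot']
        exact fun V hV => hinj1 V fun l => congrFun hV l
      have hTsurj : Function.Surjective T :=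
        (LinearMap.injective_iff_surjective_of_finrank_eq_finrank (by
          rw [Module.finrank_eq_card_basis b, Module.finrank_fintype_fun_eq_card])).1 hTinj
      obtain ⟨U, hU⟩ := hTsurj fun l => (k l : ℝ)
      have hU' : ∀ l, traceForm 1 (b l) U = k l := fun l => congrFun hU l
      have hUmem : U ∈ tuples n Λ := by
        refine (mem_tuples_iff_traceForm hΛ U).2 fun W hW => ?_
        have hW' : W = ∑ i, b₀.equivFun ⟨W, hW⟩ i • b i := by
          have := congrArg (tuples n Λ).subtype (b₀.sum_equivFun ⟨W, hW⟩)
          rw [map_sum] at this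
          simp only [map_zsmul, Submodule.subtype_apply] at this
          exact this.symm.trans (Finset.sum_congr rfl fun i _ => by
            rw [hb, Module.Basis.ofZLatticeBasis_apply])
        refine ⟨∑ i, b₀.equivFun ⟨W, hW⟩ i * k i, ?_⟩
        have h1 := congrArg (fun W => traceForm 1 W U) hW'
        rw [h1, map_sum, LinearMap.sum_apply]
        push_cast
        refine Finset.sum_congr rfl fun i _ => ?_
        rw [map_zsmul, LinearMap.smul_apply, hU', zsmul_eq_mul]
      refine ⟨⟨U, hUmem⟩, funext fun l => ?_⟩
      have := hκ ⟨U, hUmem⟩ l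
      rw [hU'] at this
      exact_mod_cast this.symm
  set e := Equiv.ofBijective κ hbij with he
  set G₁ : Matrix ι ι ℝ := Matrix.of fun k l => traceForm 1 (b k) (b l) with hG₁
  have hG₁pos : 0 < G₁.det := by
    refine (tsum_exp_bilin b (traceForm 1) (traceForm_symm Matrix.isHermitian_one) hpos1
      (fun k => (e.symm k).1) fun k l => ?_).1
    rw [hκ]
    exact_mod_cast congrFun (e.apply_symm_apply k) l
  -- Only positivity and independence of Y matter for this constant; evaluating at Y = 1 will later
  -- show that it equals 1.
  refine ⟨Real.sqrt G₁.det, Real.sqrt_pos.2 hG₁pos, fun Y hY => ?_⟩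
  have hYdet : IsUnit Y.det := (Matrix.isUnit_iff_isUnit_det _).1 hY.isUnit
  have hYinv : Y⁻¹.IsHermitian := hY.inv.isHermitian
  set U : (ι → ℤ) → (Fin n → Fin r → ℂ) := fun k => mulRight Y⁻¹ (e.symm k).1 with hUdef
  have hU : ∀ k l, traceForm Y (b l) (U k) = k l := by
    intro k l
    rw [traceForm_eq_one, hUdef]
    simp only
    rw [mulRight_mulRight, Matrix.nonsing_inv_mul _ hYdet, mulRight_one, hκ]
    exact_mod_cast congrFun (e.apply_symm_apply k) l
  obtain ⟨hGpos, hmain⟩ := tsum_exp_bilin b (traceForm Y) (traceForm_symm hY.isHermitian)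
    (fun V hV => traceForm_self_pos hY hV) U hU
  -- The Gram matrix for Y is G₁ times the real matrix of right multiplication by Y. A complex
  -- determinant δ has real determinant |δ|², here with δ = (det Y)^r real.
  have hdet : (Matrix.of fun k l => traceForm Y (b k) (b l)).det = G₁.det * (Y.det.re ^ r) ^ 2 := by
    have h1 : (Matrix.of fun k l => traceForm Y (b k) (b l)) =
        G₁ * LinearMap.toMatrix b b ((mulRight Y).restrictScalars ℝ) := by
      ext k l
      rw [Matrix.of_apply, traceForm_eq_one, Matrix.mul_apply]
      have h2 := congrArg (traceForm 1 (b k)) (b.sum_repr (mulRight Y (b l)))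
      rw [← h2, map_sum]
      simp [hG₁, LinearMap.toMatrix_apply, mul_comm]
    rw [h1, Matrix.det_mul, LinearMap.det_toMatrix, LinearMap.det_restrictScalars, det_mulRight,
      Algebra.norm_complex_apply, map_pow]
    have h2 : Y.det = (Y.det.re : ℂ) := by
      have := Complex.pos_iff.1 hY.det_pos
      exact Complex.ext rfl this.2.symm
    rw [h2, Complex.normSq_ofReal, Complex.ofReal_re]
    ring
  rw [hdet, Real.sqrt_mul hG₁pos.le,
    Real.sqrt_sq (pow_nonneg (Complex.pos_iff.1 hY.det_pos).1.le _)] at hmain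
  have hL : ∑' V : tuples n Λ, thetaExp (Complex.I • Y) V.1 = ∑' k : ι → ℤ,
      Complex.exp (-(Real.pi * traceForm Y (∑ i, k i • b i) (∑ i, k i • b i) : ℝ)) := by
    rw [← b₀.equivFun.symm.toEquiv.tsum_eq]
    refine tsum_congr fun k => ?_
    rw [thetaExp_I_smul hY.isHermitian]
    have : ((b₀.equivFun.symm k : tuples n Λ) : Fin n → Fin r → ℂ) = ∑ i, k i • b i := by
      rw [Module.Basis.equivFun_symm_apply]
      simp [hb]
    simp only [LinearEquiv.coe_toEquiv, this]
  have hR : ∑' V : tuples n Λ, thetaExp (Complex.I • Y⁻¹) V.1 =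
      ∑' k : ι → ℤ, Complex.exp (-(Real.pi * traceForm Y (U k) (U k) : ℝ)) := by
    rw [← e.symm.tsum_eq]
    refine tsum_congr fun k => ?_
    rw [thetaExp_I_smul hYinv]
    congr 3
    have : traceForm Y (U k) (U k) = (gram (U k) * Y).trace.re := rfl
    rw [this, hUdef]
    simp only
    rw [gram_mulRight, hYinv.eq, Matrix.mul_assoc, Matrix.nonsing_inv_mul _ hYdet, Matrix.mul_one,
      Matrix.trace_mul_comm]
    rfl
  rw [hL, hR, hmain]

end RealInversion

end HermitianTheta
end

noncomputable section
namespace HermitianTheta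

/-! ### Inversion and translation on the whole half space. -/

section Inversion

variable {n : ℕ}

theorem isUnit_det_of_mem_halfSpace {Z : Matrix (Fin n) (Fin n) ℂ} (hZ : Z ∈ halfSpace n) :
    IsUnit Z.det := by
  rw [isUnit_iff_ne_zero]
  intro h
  obtain ⟨v, hv, hv0⟩ := Matrix.exists_mulVec_eq_zero_iff.2 h
  have := mem_halfSpace_iff.1 hZ v hv
  rw [hv0] at this
  simp at this

/-- For x = Zy, the form of -Z⁻¹ at x is minus the conjugate of the form of Z at y, and the two have
equal imaginary parts. -/
theorem neg_inv_mem_halfSpace {Z : Matrix (Fin n) (Fin n) ℂ} (hZ : Z ∈ halfSpace n) :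
    -Z⁻¹ ∈ halfSpace n := by
  have hu := isUnit_det_of_mem_halfSpace hZ
  refine mem_halfSpace_iff.2 fun x hx => ?_
  set y := Z⁻¹.mulVec x with hy
  have hxy : x = Z.mulVec y := by
    rw [hy, Matrix.mulVec_mulVec, Matrix.mul_nonsing_inv _ hu, Matrix.one_mulVec]
  have hy0 : y ≠ 0 := by
    intro h
    rw [h, Matrix.mulVec_zero] at hxy
    exact hx hxy
  have h1 := mem_halfSpace_iff.1 hZ y hy0
  have h2 : star x ⬝ᵥ (-Z⁻¹).mulVec x = -star (star y ⬝ᵥ Z.mulVec y) := by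
    rw [Matrix.neg_mulVec, dotProduct_neg, ← hy, ← hxy, Matrix.star_dotProduct]
  rw [h2, Complex.neg_im, Complex.star_def, Complex.conj_im, neg_neg]
  exact h1

theorem convex_halfSpace : Convex ℝ (halfSpace n) := by
  intro Z hZ W hW a b ha hb hab
  refine mem_halfSpace_iff.2 fun x hx => ?_
  have h1 := mem_halfSpace_iff.1 hZ x hx
  have h2 := mem_halfSpace_iff.1 hW x hx
  rw [Matrix.add_mulVec, dotProduct_add, Matrix.smul_mulVec, Matrix.smul_mulVec, dotProduct_smul,
    dotProduct_smul, Complex.add_im, Complex.smul_im, Complex.smul_im]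
  simp only [smul_eq_mul]
  rcases ha.eq_or_lt with rfl | ha
  · rw [zero_add] at hab
    subst hab
    linarith
  · have := mul_pos ha h1
    have := mul_nonneg hb h2.le
    linarith

theorem differentiable_det {Z : ℂ → Matrix (Fin n) (Fin n) ℂ}
    (hZ : ∀ i j, Differentiable ℂ fun t => Z t i j) : Differentiable ℂ fun t => (Z t).det := by
  simp only [Matrix.det_apply']
  exact Differentiable.fun_sum fun σ _ =>
    (Differentiable.fun_finsetProd fun i _ => hZ _ _).const_mul _

theorem differentiableAt_inv_apply {Z : ℂ → Matrix (Fin n) (Fin n) ℂ}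
    (hZ : ∀ i j, Differentiable ℂ fun t => Z t i j) {t : ℂ} (ht : (Z t).det ≠ 0) (i j : Fin n) :
    DifferentiableAt ℂ (fun t => (Z t)⁻¹ i j) t := by
  simp only [Matrix.inv_def, Matrix.smul_apply, smul_eq_mul, Ring.inverse_eq_inv',
    Matrix.adjugate_apply]
  refine ((differentiable_det hZ t).inv ht).mul (differentiable_det (fun k l => ?_) t)
  simp only [Matrix.updateRow_apply]
  split_ifs
  · exact differentiable_const _
  · exact hZ k l

variable {K : Type*} [Field K] [Algebra K ℂ] {r : ℕ} {Λ : Submodule (𝓞 K) (Fin r → ℂ)}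

/-- At this point every term is a positive real number. The nonvanishing later allows this theta
value to be cancelled, to determine both the constant and the root of unity in the inversion
formula. -/
theorem theta_I_smul_one_ne_zero (hΛ : DiscreteTopology Λ) :
    theta n Λ (Complex.I • 1) ≠ 0 := by
  have hs := summable_thetaExp (n := n) (Λ := Λ) hΛ I_smul_one_mem_halfSpace
  rw [theta_eq_tsum hΛ I_smul_one_mem_halfSpace]
  have h1 : ∀ V : tuples n Λ, thetaExp (Complex.I • 1) V.1 =
      ((Real.exp (-(Real.pi * traceForm 1 V.1 V.1)) : ℝ) : ℂ) := by
    intro V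
    rw [thetaExp_I_smul Matrix.isHermitian_one]
    push_cast
    rfl
  simp only [h1] at hs ⊢
  rw [← Complex.ofReal_tsum]
  have := (Complex.summable_ofReal.1 hs).tsum_pos (fun V => (Real.exp_pos _).le) 0 (Real.exp_pos _)
  exact_mod_cast this.ne'

theorem differentiableAt_theta (hΛ : DiscreteTopology Λ) {Z : Fin n → Fin n → ℂ}
    (hZ : Matrix.of Z ∈ halfSpace n) :
    DifferentiableAt ℂ (fun Z : Fin n → Fin n → ℂ => theta n Λ (Matrix.of Z)) Z :=
  (differentiableOn_theta hΛ).differentiableAt (isOpen_halfSpace.mem_nhds hZ)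

theorem differentiableAt_theta_comp (hΛ : DiscreteTopology Λ) {Z : ℂ → Matrix (Fin n) (Fin n) ℂ}
    {t : ℂ} (hZ : ∀ i j, DifferentiableAt ℂ (fun t => Z t i j) t) (ht : Z t ∈ halfSpace n) :
    DifferentiableAt ℂ (fun t => theta n Λ (Z t)) t := by
  have h1 : DifferentiableAt ℂ (fun t => (fun i j => Z t i j : Fin n → Fin n → ℂ)) t :=
    differentiableAt_pi.2 fun i => differentiableAt_pi.2 fun j => hZ i j
  exact DifferentiableAt.comp t
    (differentiableAt_theta (Z := (fun i j => Z t i j : Fin n → Fin n → ℂ)) hΛ ht) h1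

theorem theta_I_smul_inv (hΛ : IsThetaLattice Λ) {Y : Matrix (Fin n) (Fin n) ℂ} (hY : Y.PosDef) :
    theta n Λ (Complex.I • Y⁻¹) = Y.det ^ r * theta n Λ (Complex.I • Y) := by
  obtain ⟨d, hd, h⟩ := exists_theta_I_smul (n := n) hΛ
  -- The point Y = 1 is fixed by inversion, and theta does not vanish there.
  have hd1 : d = 1 := by
    have h1 := h 1 Matrix.PosDef.one
    rw [inv_one, ← theta_eq_tsum hΛ.discrete I_smul_one_mem_halfSpace] at h1
    have h2 := mul_right_cancel₀ (theta_I_smul_one_ne_zero (n := n) hΛ.discrete)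
      ((one_mul _).trans h1)
    simp only [Matrix.det_one, Complex.one_re, one_pow, mul_one] at h2
    have h3 : (1 : ℝ) = d⁻¹ := by exact_mod_cast h2
    rw [← inv_inv d, ← h3, inv_one]
  have h1 := h Y hY
  have hpos := Complex.pos_iff.1 hY.det_pos
  have h2 : Y.det = (Y.det.re : ℂ) := Complex.ext rfl hpos.2.symm
  rw [theta_eq_tsum hΛ.discrete (I_smul_mem_halfSpace hY),
    theta_eq_tsum hΛ.discrete (I_smul_mem_halfSpace hY.inv), h1, hd1, one_mul]
  nth_rewrite 1 [h2]
  push_cast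
  rw [← mul_assoc, mul_inv_cancel₀, one_mul]
  exact pow_ne_zero _ (by exact_mod_cast hpos.1.ne')

theorem posDef_of_isHermitian_of_mem_halfSpace {Y : Matrix (Fin n) (Fin n) ℂ}
    (hY : Y.IsHermitian) (h : Complex.I • Y ∈ halfSpace n) : Y.PosDef := by
  refine .of_dotProduct_mulVec_pos hY fun x hx => ?_
  have h1 := mem_halfSpace_iff.1 h x hx
  rw [Matrix.smul_mulVec, dotProduct_smul, smul_eq_mul, Complex.I_mul_im] at h1
  refine Complex.pos_iff.2 ⟨h1, ?_⟩
  have h2 := star_dotProduct_conjTranspose_mulVec Y x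
  rw [hY.eq, Complex.star_def] at h2
  exact (Complex.conj_eq_iff_im.1 h2.symm).symm

/-- The inversion formula for the theta series. -/
theorem theta_neg_inv (hΛ : IsThetaLattice Λ) {Z : Matrix (Fin n) (Fin n) ℂ}
    (hZ : Z ∈ halfSpace n) :
    theta n Λ (-Z⁻¹) = ((-Complex.I) ^ n * Z.det) ^ r * theta n Λ Z := by
  set X : Matrix (Fin n) (Fin n) ℂ := (1 / 2 : ℂ) • (Z + Z.conjTranspose) with hX
  set Y : Matrix (Fin n) (Fin n) ℂ := (1 / (2 * Complex.I)) • (Z - Z.conjTranspose) with hYdef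
  have hY : Y.PosDef := hZ
  have hXH : X.IsHermitian := by
    rw [Matrix.IsHermitian, hX, Matrix.conjTranspose_smul, Matrix.conjTranspose_add,
      Matrix.conjTranspose_conjTranspose, add_comm]
    simp
  -- A complex line through Z, at t = 1, with iY at t = 0. For t = is the point is i(sX + Y) with sX
  -- + Y Hermitian, so the known case of the formula covers the imaginary axis near 0, and
  -- one-variable analytic continuation reaches t = 1.
  set W : ℂ → Matrix (Fin n) (Fin n) ℂ := fun t => t • X + Complex.I • Y with hW
  have hW1 : W 1 = Z := by
    ext i j
    simp only [hW, hX, hYdef, Matrix.add_apply, Matrix.smul_apply, Matrix.sub_apply, smul_eq_mul]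
    field_simp
    ring
  have hW0 : W 0 ∈ halfSpace n := by
    simp only [hW, zero_smul, zero_add]
    exact I_smul_mem_halfSpace hY
  have hWd : ∀ i j, Differentiable ℂ fun t => W t i j := by
    intro i j
    simp only [hW, Matrix.add_apply, Matrix.smul_apply, smul_eq_mul]
    fun_prop
  have hWc : Continuous W := by
    refine continuous_matrix fun i j => (hWd i j).continuous
  set U : Set ℂ := W ⁻¹' halfSpace n with hU
  have hUo : IsOpen U := isOpen_halfSpace.preimage hWc
  have hUc : Convex ℝ U := by
    intro s hs t ht a b ha hb hab
    have h1 := convex_halfSpace (show W s ∈ halfSpace n from hs) (show W t ∈ halfSpace n from ht)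
      ha hb hab
    have h2 : W (a • s + b • t) = a • W s + b • W t := by
      ext i j
      have hab' : (a : ℂ) + b = 1 := by exact_mod_cast hab
      simp only [hW, Matrix.add_apply, Matrix.smul_apply, smul_eq_mul, Complex.real_smul]
      linear_combination (-(Complex.I * Y i j)) * hab'
    change W (a • s + b • t) ∈ halfSpace n
    rw [h2]
    exact h1
  set h : ℂ → ℂ := fun t => theta n Λ (-(W t)⁻¹) -
    ((-Complex.I) ^ n * (W t).det) ^ r * theta n Λ (W t) with hh
  have hdiff : DifferentiableOn ℂ h U := by
    intro t ht
    have ht' : W t ∈ halfSpace n := ht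
    refine DifferentiableAt.differentiableWithinAt ?_
    refine DifferentiableAt.sub ?_ (DifferentiableAt.mul ?_ ?_)
    · refine differentiableAt_theta_comp hΛ.discrete (Z := fun t => -(W t)⁻¹) (fun i j => ?_)
        (neg_inv_mem_halfSpace ht')
      exact (differentiableAt_inv_apply hWd (isUnit_det_of_mem_halfSpace ht').ne_zero i j).neg
    · exact (((differentiable_det hWd).const_mul _).pow r) t
    · exact differentiableAt_theta_comp hΛ.discrete (fun i j => hWd i j t) ht'
  have hzero : ∀ s : ℝ, Complex.I * s ∈ U → h (Complex.I * s) = 0 := by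
    intro s hs
    have hWs : W (Complex.I * s) = Complex.I • ((s : ℂ) • X + Y) := by
      simp only [hW, smul_add, smul_smul]
    have hherm : ((s : ℂ) • X + Y).IsHermitian := by
      refine Matrix.IsHermitian.add ?_ hY.isHermitian
      rw [Matrix.IsHermitian, Matrix.conjTranspose_smul, hXH.eq]
      simp
    have hs' : Complex.I • ((s : ℂ) • X + Y) ∈ halfSpace n := hWs ▸ hs
    have hpd := posDef_of_isHermitian_of_mem_halfSpace hherm hs'
    have hinv : -(Complex.I • ((s : ℂ) • X + Y))⁻¹ = Complex.I • ((s : ℂ) • X + Y)⁻¹ := by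
      have hu : IsUnit ((s : ℂ) • X + Y).det :=
        (Matrix.isUnit_iff_isUnit_det _).1 hpd.isUnit
      rw [neg_eq_iff_eq_neg]
      refine Matrix.inv_eq_right_inv ?_
      rw [Matrix.mul_neg, Matrix.smul_mul, Matrix.mul_smul, smul_smul, Complex.I_mul_I,
        Matrix.mul_nonsing_inv _ hu]
      simp
    simp only [hh]
    rw [hWs, hinv, theta_I_smul_inv hΛ hpd, Matrix.det_smul, Fintype.card_fin, ← mul_assoc,
      ← mul_pow]
    simp
  have hfreq : ∃ᶠ z in nhdsWithin (0 : ℂ) {0}ᶜ, h z = 0 := by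
    have ht : Filter.Tendsto (fun s : ℝ => Complex.I * s) (nhdsWithin 0 {0}ᶜ)
        (nhdsWithin (0 : ℂ) {0}ᶜ) := by
      refine tendsto_nhdsWithin_iff.2 ⟨?_, ?_⟩
      · have : Filter.Tendsto (fun s : ℝ => Complex.I * s) (nhds 0) (nhds (Complex.I * (0 : ℝ))) :=
          (continuous_const.mul Complex.continuous_ofReal).tendsto 0
        simp only [Complex.ofReal_zero, mul_zero] at this
        exact this.mono_left nhdsWithin_le_nhds
      · filter_upwards [self_mem_nhdsWithin] with s hs
        simpa using hs
    have hev : ∀ᶠ s : ℝ in nhdsWithin 0 {0}ᶜ, h (Complex.I * s) = 0 := by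
      have h1 : ∀ᶠ z in nhdsWithin (0 : ℂ) {0}ᶜ, z ∈ U :=
        nhdsWithin_le_nhds (hUo.mem_nhds hW0)
      filter_upwards [ht.eventually h1] with s hs
      exact hzero s hs
    exact ht.frequently hev.frequently
  have := (hdiff.analyticOnNhd hUo).eqOn_zero_of_preconnected_of_frequently_eq_zero
    hUc.isPreconnected hW0 hfreq
  have h1 : h 1 = 0 := this (show W 1 ∈ halfSpace n from hW1 ▸ hZ)
  simp only [hh] at h1
  rw [hW1] at h1
  exact sub_eq_zero.1 h1

theorem herm_smul_right (x y : Fin r → ℂ) (c : ℂ) : herm x (c • y) = c * herm x y := by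
  rw [herm, dotProduct_smul, smul_eq_mul, herm]

theorem algebraMap_smul_mem (a : 𝓞 K) {x : Fin r → ℂ} (hx : x ∈ Λ) :
    algebraMap (𝓞 K) ℂ a • x ∈ Λ := by
  rw [algebraMap_smul]
  exact Λ.smul_mem a hx

/-- The evenness of a theta lattice, for tuples of vectors. -/
theorem exists_trace_gram_mul_eq (hΛ : IsThetaLattice Λ) {S : Matrix (Fin n) (Fin n) ℂ}
    (hS : S.IsHermitian) (hdiag : ∀ i, ∃ k : ℤ, S i i = k)
    (hint : ∀ i j, ∃ a : 𝓞 K, S i j = algebraMap (𝓞 K) ℂ a)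
    {V : Fin n → Fin r → ℂ} (hV : V ∈ tuples n Λ) : ∃ k : ℤ, (gram V * S).trace = 2 * k := by
  -- Split S into its diagonal D, its strictly upper part N and N*. The diagonal contributes an even
  -- integer because Λ is even; N and N* contribute conjugate traces, so together they give twice an
  -- integral real part.
  set D : Matrix (Fin n) (Fin n) ℂ := Matrix.of fun i j => if i = j then S i j else 0 with hD
  set N : Matrix (Fin n) (Fin n) ℂ := Matrix.of fun i j => if i < j then S i j else 0 with hN
  have hSd : S = D + (N + N.conjTranspose) := by
    ext i j
    have hij : S i j = star (S j i) := (hS.apply i j).symm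
    simp only [hD, hN, Matrix.add_apply, Matrix.of_apply, Matrix.conjTranspose_apply]
    rcases lt_trichotomy i j with h | h | h
    · simp [h, h.ne, h.asymm]
    · simp [h]
    · simp [h, h.ne', h.asymm, hij]
  have hherm : ∀ i, ((herm (V i) (V i)).re : ℂ) = herm (V i) (V i) := by
    intro i
    refine Complex.conj_eq_iff_re.1 ?_
    rw [← Complex.star_def, herm, ← Matrix.star_dotProduct]
  have h1 : ∃ k : ℤ, (gram V * D).trace = 2 * k := by
    choose s hs using hdiag
    have : ∀ i, ∃ k : ℤ, (herm (V i) (V i)).re = 2 * k := fun i => hΛ.even _ (hV i)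
    choose k hk using this
    refine ⟨∑ i, k i * s i, ?_⟩
    simp only [Matrix.trace, Matrix.diag, Matrix.mul_apply, hD, Matrix.of_apply, mul_ite, mul_zero,
      Finset.sum_ite_eq', Finset.mem_univ, if_true, gram]
    push_cast
    rw [Finset.mul_sum]
    refine Finset.sum_congr rfl fun i _ => ?_
    rw [← hherm, hk, hs]
    push_cast
    ring
  have h2 : ∃ k : ℤ, (gram V * N).trace.re = k := by
    have : ∀ i j, ∃ k : ℤ, (gram V i j * N j i).re = k := by
      intro i j
      simp only [hN, Matrix.of_apply]
      split_ifs
      · obtain ⟨a, ha⟩ := hint j i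
        rw [ha]
        obtain ⟨k, hk⟩ := (hΛ.unimodular (V i)).1 (hV i) _ (algebraMap_smul_mem a (hV j))
        refine ⟨k, ?_⟩
        rw [← hk, herm_smul_right, mul_comm]
        rfl
      · exact ⟨0, by simp⟩
    choose k hk using this
    refine ⟨∑ i, ∑ j, k i j, ?_⟩
    simp [Matrix.trace, Matrix.mul_apply, hk]
  obtain ⟨k, hk⟩ := h1
  obtain ⟨l, hl⟩ := h2
  have h3 : (gram V * N.conjTranspose).trace = star (gram V * N).trace := by
    rw [← Matrix.trace_conjTranspose, Matrix.conjTranspose_mul,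
      (posSemidef_gram V).isHermitian.eq, Matrix.trace_mul_comm]
  refine ⟨k + l, ?_⟩
  rw [hSd, Matrix.mul_add, Matrix.mul_add, Matrix.trace_add, Matrix.trace_add, hk, h3,
    Complex.star_def, Complex.add_conj, hl]
  push_cast
  ring

theorem add_mem_halfSpace {Z S : Matrix (Fin n) (Fin n) ℂ} (hZ : Z ∈ halfSpace n)
    (hS : S.IsHermitian) : Z + S ∈ halfSpace n := by
  refine mem_halfSpace_iff.2 fun x hx => ?_
  have h1 := mem_halfSpace_iff.1 hZ x hx
  have h2 := star_dotProduct_conjTranspose_mulVec S x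
  rw [hS.eq, Complex.star_def] at h2
  rw [Matrix.add_mulVec, dotProduct_add, Complex.add_im, Complex.conj_eq_iff_im.1 h2.symm, add_zero]
  exact h1

/-- The theta series is invariant under integral translations. -/
theorem theta_add (hΛ : IsThetaLattice Λ) {S : Matrix (Fin n) (Fin n) ℂ}
    (hS : S.IsHermitian) (hdiag : ∀ i, ∃ k : ℤ, S i i = k)
    (hint : ∀ i j, ∃ a : 𝓞 K, S i j = algebraMap (𝓞 K) ℂ a)
    {Z : Matrix (Fin n) (Fin n) ℂ} (hZ : Z ∈ halfSpace n) :
    theta n Λ (Z + S) = theta n Λ Z := by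
  rw [theta_eq_tsum hΛ.discrete hZ, theta_eq_tsum hΛ.discrete (add_mem_halfSpace hZ hS)]
  refine tsum_congr fun V => ?_
  obtain ⟨k, hk⟩ := exists_trace_gram_mul_eq hΛ hS hdiag hint V.2
  rw [thetaExp, thetaExp, Complex.exp_eq_exp_iff_exists_int]
  refine ⟨k, ?_⟩
  rw [Matrix.mul_add, Matrix.trace_add, hk]
  ring

theorem smul_one_mem_halfSpace {z : ℂ} (hz : 0 < z.im) :
    (z • 1 : Matrix (Fin n) (Fin n) ℂ) ∈ halfSpace n := by
  refine mem_halfSpace_iff.2 fun x hx => ?_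
  have h1 := Complex.pos_iff.1 (Matrix.dotProduct_star_self_pos_iff.2 hx)
  rw [Matrix.smul_mulVec, Matrix.one_mulVec, dotProduct_smul, smul_eq_mul, Complex.mul_im,
    ← h1.2, mul_zero, zero_add]
  exact mul_pos hz h1.1

/-- The rank of a theta lattice is divisible by `4`. -/
theorem neg_I_pow_rank (hΛ : IsThetaLattice Λ) : (-Complex.I) ^ r = 1 := by
  have hT : ∀ z : ℂ, 0 < z.im → theta 1 Λ ((z + 1) • 1) = theta 1 Λ (z • 1) := by
    intro z hz
    rw [add_smul, one_smul]
    refine theta_add hΛ Matrix.isHermitian_one (fun i => ⟨1, by simp⟩) (fun i j => ?_)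
      (smul_one_mem_halfSpace hz)
    exact ⟨1, by rw [Subsingleton.elim i j]; simp⟩
  have hJ : ∀ z : ℂ, 0 < z.im →
      theta 1 Λ ((-z⁻¹) • 1) = (-Complex.I * z) ^ r * theta 1 Λ (z • 1) := by
    intro z hz
    have hz0 : z ≠ 0 := by rintro rfl; simp at hz
    have h1 := theta_neg_inv hΛ (smul_one_mem_halfSpace (n := 1) hz)
    have h2 : (z • 1 : Matrix (Fin 1) (Fin 1) ℂ)⁻¹ = z⁻¹ • 1 := by
      refine Matrix.inv_eq_right_inv ?_
      rw [Matrix.smul_mul, Matrix.mul_smul, smul_smul, mul_inv_cancel₀ hz0]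
      simp
    rw [h2, ← neg_smul] at h1
    rw [h1]
    simp
  -- The point i travels i, 1+i, (-1+i)/2, (1+i)/2, -1+i, i under alternating translations and
  -- inversions. The two automorphy factors collected have product (-i)^r, and theta is nonzero at
  -- i.
  have e1 : -(Complex.I + 1)⁻¹ = (-1 + Complex.I) / 2 := by
    rw [neg_eq_iff_eq_neg]
    exact inv_eq_of_mul_eq_one_right (by linear_combination (-1 / 2 : ℂ) * Complex.I_sq)
  have e2 : -((-1 + Complex.I) / 2 + 1)⁻¹ = -1 + Complex.I := by
    rw [neg_eq_iff_eq_neg]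
    exact inv_eq_of_mul_eq_one_right (by linear_combination (-1 / 2 : ℂ) * Complex.I_sq)
  have h1 := hJ (Complex.I + 1) (by simp)
  rw [hT _ (by simp), e1] at h1
  have h2 := hJ ((-1 + Complex.I) / 2 + 1) (by simp)
  rw [hT _ (by simp), e2, h1] at h2
  have h3 := hT (-1 + Complex.I) (by simp)
  rw [h2] at h3
  have e3 : -1 + Complex.I + 1 = Complex.I := by ring
  rw [e3, ← mul_assoc, ← mul_pow] at h3
  have h4 := mul_right_cancel₀ (theta_I_smul_one_ne_zero (n := 1) hΛ.discrete) ((one_mul _).trans h3)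
  rw [h4]
  congr 1
  linear_combination (-(Complex.I + Complex.I ^ 2 / 2)) * Complex.I_sq

end Inversion
end HermitianTheta
end

noncomputable section
namespace HermitianTheta

/-! ### Automorphy factors and the action of the generators. -/

section Cocycle

variable {n : ℕ}

theorem mem_specialUnitary_fromBlocks {A B C D : Matrix (Fin n) (Fin n) ℂ} :
    Matrix.fromBlocks A B C D ∈ specialUnitary n ↔ (Matrix.fromBlocks A B C D).det = 1 ∧
      C.conjTranspose * A = A.conjTranspose * C ∧ A.conjTranspose * D - C.conjTranspose * B = 1 ∧
      D.conjTranspose * A - B.conjTranspose * C = 1 ∧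
      D.conjTranspose * B = B.conjTranspose * D := by
  rw [specialUnitary, Set.mem_ofPred_eq]
  refine and_congr_right fun _ => ?_
  rw [Matrix.fromBlocks_conjTranspose, Matrix.J, Matrix.fromBlocks_multiply,
    Matrix.fromBlocks_multiply, Matrix.fromBlocks_inj]
  simp only [Matrix.mul_zero, Matrix.mul_one, zero_add, add_zero, Matrix.mul_neg, Matrix.neg_mul]
  refine and_congr ?_ (and_congr ?_ (and_congr ?_ ?_))
  · rw [add_neg_eq_zero]
  · rw [← neg_inj, neg_neg]
    simp [sub_eq_add_neg]
  · simp [sub_eq_add_neg]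
  · rw [add_neg_eq_zero]

/-- Invariance of J evaluated on the column with blocks Z and 1, which M sends to the column with
blocks AZ + B and CZ + D. -/
theorem conjTranspose_denom_mul_sub {M : Matrix (Fin n ⊕ Fin n) (Fin n ⊕ Fin n) ℂ}
    (hM : M ∈ specialUnitary n) (Z : Matrix (Fin n) (Fin n) ℂ) :
    (denom M Z).conjTranspose * (M.toBlocks₁₁ * Z + M.toBlocks₁₂) -
      (M.toBlocks₁₁ * Z + M.toBlocks₁₂).conjTranspose * denom M Z = Z - Z.conjTranspose := by
  rw [← M.fromBlocks_toBlocks, mem_specialUnitary_fromBlocks] at hM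
  obtain ⟨-, h1, h2, h3, h4⟩ := hM
  set A := M.toBlocks₁₁
  set B := M.toBlocks₁₂
  set C := M.toBlocks₂₁
  set D := M.toBlocks₂₂
  have e2 : A.conjTranspose * D = 1 + C.conjTranspose * B := by rw [← h2]; abel
  have e3 : D.conjTranspose * A = 1 + B.conjTranspose * C := by rw [← h3]; abel
  change (C * Z + D).conjTranspose * (A * Z + B) - (A * Z + B).conjTranspose * (C * Z + D) = _
  simp only [Matrix.conjTranspose_add, Matrix.conjTranspose_mul, Matrix.add_mul, Matrix.mul_add]
  have f1 : Z.conjTranspose * C.conjTranspose * (A * Z) =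
      Z.conjTranspose * A.conjTranspose * (C * Z) := by
    rw [Matrix.mul_assoc, ← Matrix.mul_assoc C.conjTranspose, h1]; simp only [Matrix.mul_assoc]
  have f2 : Z.conjTranspose * A.conjTranspose * D = Z.conjTranspose +
      Z.conjTranspose * C.conjTranspose * B := by
    rw [Matrix.mul_assoc, e2, Matrix.mul_add, Matrix.mul_one, Matrix.mul_assoc]
  have f3 : D.conjTranspose * (A * Z) = Z + B.conjTranspose * (C * Z) := by
    rw [← Matrix.mul_assoc, e3, Matrix.add_mul, Matrix.one_mul, Matrix.mul_assoc]
  rw [f1, f2, f3, h4]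
  abel

/-- This one identity yields both the invertibility of CZ + D, since a kernel vector would make the
right side vanish, and the stability of the half space. -/
theorem star_mulVec_denom {M : Matrix (Fin n ⊕ Fin n) (Fin n ⊕ Fin n) ℂ}
    (hM : M ∈ specialUnitary n) (Z : Matrix (Fin n) (Fin n) ℂ) (x : Fin n → ℂ) :
    (star ((denom M Z).mulVec x) ⬝ᵥ (M.toBlocks₁₁ * Z + M.toBlocks₁₂).mulVec x).im =
      (star x ⬝ᵥ Z.mulVec x).im := by
  have h := congrArg (fun N => (star x ⬝ᵥ Matrix.mulVec N x).im) (conjTranspose_denom_mul_sub hM Z)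
  set P := M.toBlocks₁₁ * Z + M.toBlocks₁₂
  set Q := denom M Z
  have h1 : star x ⬝ᵥ (Q.conjTranspose * P).mulVec x = star (Q.mulVec x) ⬝ᵥ P.mulVec x := by
    rw [← Matrix.mulVec_mulVec, Matrix.dotProduct_mulVec, Matrix.star_mulVec]
  have h2 : star x ⬝ᵥ (P.conjTranspose * Q).mulVec x =
      star (star (Q.mulVec x) ⬝ᵥ P.mulVec x) := by
    rw [← Matrix.mulVec_mulVec, Matrix.dotProduct_mulVec, ← Matrix.star_mulVec,
      Matrix.star_dotProduct]
  simp only [Matrix.sub_mulVec, dotProduct_sub, h1, h2, star_dotProduct_conjTranspose_mulVec,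
    Complex.sub_im, Complex.star_def, Complex.conj_im] at h
  linarith

theorem isUnit_det_denom {M : Matrix (Fin n ⊕ Fin n) (Fin n ⊕ Fin n) ℂ}
    (hM : M ∈ specialUnitary n) {Z : Matrix (Fin n) (Fin n) ℂ} (hZ : Z ∈ halfSpace n) :
    IsUnit (denom M Z).det := by
  rw [isUnit_iff_ne_zero]
  intro h
  obtain ⟨v, hv, hv0⟩ := Matrix.exists_mulVec_eq_zero_iff.2 h
  have h1 := star_mulVec_denom hM Z v
  rw [hv0] at h1
  have h2 := mem_halfSpace_iff.1 hZ v hv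
  simp only [star_zero, zero_dotProduct, Complex.zero_im] at h1
  exact h2.ne h1

theorem moebius_mem_halfSpace {M : Matrix (Fin n ⊕ Fin n) (Fin n ⊕ Fin n) ℂ}
    (hM : M ∈ specialUnitary n) {Z : Matrix (Fin n) (Fin n) ℂ} (hZ : Z ∈ halfSpace n) :
    moebius M Z ∈ halfSpace n := by
  have hu := isUnit_det_denom hM hZ
  refine mem_halfSpace_iff.2 fun y hy => ?_
  set x := (denom M Z)⁻¹.mulVec y with hx
  have hxy : y = (denom M Z).mulVec x := by
    rw [hx, Matrix.mulVec_mulVec, Matrix.mul_nonsing_inv _ hu, Matrix.one_mulVec]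
  have hx0 : x ≠ 0 := by
    intro h
    rw [h, Matrix.mulVec_zero] at hxy
    exact hy hxy
  rw [moebius, ← Matrix.mulVec_mulVec, ← hx]
  nth_rewrite 1 [hxy]
  rw [star_mulVec_denom hM]
  exact mem_halfSpace_iff.1 hZ x hx0

/-- The cocycle relation behind the closure of `automorphyMonoid` under products. -/
theorem denom_mul (M N : Matrix (Fin n ⊕ Fin n) (Fin n ⊕ Fin n) ℂ)
    {Z : Matrix (Fin n) (Fin n) ℂ} (hu : IsUnit (denom N Z).det) :
    denom (M * N) Z = denom M (moebius N Z) * denom N Z := by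
  have h1 : (M * N).toBlocks₂₁ = M.toBlocks₂₁ * N.toBlocks₁₁ + M.toBlocks₂₂ * N.toBlocks₂₁ := by
    ext i j
    simp [Matrix.toBlocks₂₁, Matrix.mul_apply, Matrix.toBlocks₁₁, Matrix.toBlocks₂₂]
  have h2 : (M * N).toBlocks₂₂ = M.toBlocks₂₁ * N.toBlocks₁₂ + M.toBlocks₂₂ * N.toBlocks₂₂ := by
    ext i j
    simp [Matrix.toBlocks₂₁, Matrix.mul_apply, Matrix.toBlocks₁₂, Matrix.toBlocks₂₂]
  rw [denom, h1, h2, denom, moebius, Matrix.add_mul _ _ (denom N Z), ← Matrix.mul_assoc M.toBlocks₂₁,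
    Matrix.mul_assoc _ _ (denom N Z), Matrix.nonsing_inv_mul _ hu, Matrix.mul_one, denom]
  simp only [Matrix.add_mul, Matrix.mul_add, Matrix.mul_assoc]
  abel

theorem moebius_mul (M N : Matrix (Fin n ⊕ Fin n) (Fin n ⊕ Fin n) ℂ)
    {Z : Matrix (Fin n) (Fin n) ℂ} (hu : IsUnit (denom N Z).det) :
    moebius (M * N) Z = moebius M (moebius N Z) := by
  have h1 : (M * N).toBlocks₁₁ = M.toBlocks₁₁ * N.toBlocks₁₁ + M.toBlocks₁₂ * N.toBlocks₂₁ := by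
    ext i j
    simp [Matrix.toBlocks₂₁, Matrix.mul_apply, Matrix.toBlocks₁₁, Matrix.toBlocks₁₂]
  have h2 : (M * N).toBlocks₁₂ = M.toBlocks₁₁ * N.toBlocks₁₂ + M.toBlocks₁₂ * N.toBlocks₂₂ := by
    ext i j
    simp [Matrix.toBlocks₁₁, Matrix.mul_apply, Matrix.toBlocks₁₂, Matrix.toBlocks₂₂]
  have h3 : (M * N).toBlocks₁₁ * Z + (M * N).toBlocks₁₂ =
      (M.toBlocks₁₁ * moebius N Z + M.toBlocks₁₂) * denom N Z := by
    rw [h1, h2, moebius, Matrix.add_mul _ _ (denom N Z), ← Matrix.mul_assoc M.toBlocks₁₁,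
      Matrix.mul_assoc _ _ (denom N Z), Matrix.nonsing_inv_mul _ hu, Matrix.mul_one, denom]
    simp only [Matrix.add_mul, Matrix.mul_add, Matrix.mul_assoc]
    abel
  rw [moebius, h3, denom_mul M N hu, Matrix.mul_inv_rev, Matrix.mul_assoc,
    Matrix.mul_nonsing_inv_cancel_left _ _ hu, ← moebius]

theorem mul_mem_specialUnitary {M N : Matrix (Fin n ⊕ Fin n) (Fin n ⊕ Fin n) ℂ}
    (hM : M ∈ specialUnitary n) (hN : N ∈ specialUnitary n) : M * N ∈ specialUnitary n := by
  refine ⟨by rw [Matrix.det_mul, hM.1, hN.1, mul_one], ?_⟩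
  calc (M * N).conjTranspose * Matrix.J (Fin n) ℂ * (M * N)
      = N.conjTranspose * (M.conjTranspose * Matrix.J (Fin n) ℂ * M) * N := by
        rw [Matrix.conjTranspose_mul]; simp only [Matrix.mul_assoc]
    _ = _ := by rw [hM.2, hN.2]

/-- The elements of `SU(n,n;ℂ)` for which `f` transforms like a modular form of weight `k`. -/
def automorphyMonoid (f : Matrix (Fin n) (Fin n) ℂ → ℂ) (k : ℤ) :
    Submonoid (Matrix (Fin n ⊕ Fin n) (Fin n ⊕ Fin n) ℂ) where
  carrier := {M | M ∈ specialUnitary n ∧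
    ∀ Z ∈ halfSpace n, f (moebius M Z) = (denom M Z).det ^ k * f Z}
  mul_mem' {M N} hM hN := by
    refine ⟨mul_mem_specialUnitary hM.1 hN.1, fun Z hZ => ?_⟩
    have hu := isUnit_det_denom hN.1 hZ
    rw [moebius_mul M N hu, hM.2 _ (moebius_mem_halfSpace hN.1 hZ), hN.2 Z hZ, denom_mul M N hu,
      Matrix.det_mul, mul_zpow, mul_assoc]
  one_mem' := by
    refine ⟨⟨Matrix.det_one, by simp⟩, fun Z hZ => ?_⟩
    have h1 : denom (1 : Matrix (Fin n ⊕ Fin n) (Fin n ⊕ Fin n) ℂ) Z = 1 := by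
      rw [denom, ← Matrix.fromBlocks_one, Matrix.toBlocks_fromBlocks₂₁, Matrix.toBlocks_fromBlocks₂₂,
        Matrix.zero_mul, zero_add]
    have h2 : moebius (1 : Matrix (Fin n ⊕ Fin n) (Fin n ⊕ Fin n) ℂ) Z = Z := by
      rw [moebius, h1, ← Matrix.fromBlocks_one, Matrix.toBlocks_fromBlocks₁₁,
        Matrix.toBlocks_fromBlocks₁₂, Matrix.one_mul, add_zero, inv_one, Matrix.mul_one]
    rw [h1, h2]; simp

variable {K : Type*} [Field K] [Algebra K ℂ] {r : ℕ} {Λ : Submodule (𝓞 K) (Fin r → ℂ)}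

theorem upper_mem_automorphyMonoid (hΛ : IsThetaLattice Λ) {S : Matrix (Fin n) (Fin n) ℂ}
    (hS : S.IsHermitian) (hdiag : ∀ i, ∃ k : ℤ, S i i = k)
    (hint : ∀ i j, ∃ a : 𝓞 K, S i j = algebraMap (𝓞 K) ℂ a) :
    Matrix.fromBlocks 1 S 0 1 ∈ automorphyMonoid (theta n Λ) r := by
  refine ⟨mem_specialUnitary_fromBlocks.2 ⟨by simp, by simp, by simp, by simp, ?_⟩, fun Z hZ => ?_⟩
  · simp [hS.eq]
  · have h1 : denom (Matrix.fromBlocks 1 S 0 1) Z = 1 := by simp [denom]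
    rw [moebius, h1]
    simp only [Matrix.toBlocks_fromBlocks₁₁, Matrix.toBlocks_fromBlocks₁₂, inv_one,
      Matrix.mul_one, Matrix.det_one, one_zpow, one_mul]
    exact theta_add hΛ hS hdiag hint hZ

theorem J_eq : Matrix.J (Fin n) ℂ = Matrix.fromBlocks 1 (-1) 0 1 * Matrix.fromBlocks 1 0 1 1 *
    Matrix.fromBlocks 1 (-1) 0 1 := by
  simp [Matrix.J, Matrix.fromBlocks_multiply]

theorem J_mem_automorphyMonoid (hΛ : IsThetaLattice Λ) :
    Matrix.J (Fin n) ℂ ∈ automorphyMonoid (theta n Λ) r := by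
  have hdet : (Matrix.J (Fin n) ℂ).det = 1 := by
    rw [J_eq]; simp
  refine ⟨mem_specialUnitary_fromBlocks.2 ⟨hdet, by simp, by simp, by simp, by simp⟩,
    fun Z hZ => ?_⟩
  have h1 : denom (Matrix.J (Fin n) ℂ) Z = Z := by simp [denom, Matrix.J]
  have h2 : moebius (Matrix.J (Fin n) ℂ) Z = -Z⁻¹ := by
    rw [moebius, h1]; simp [Matrix.J]
  rw [h1, h2, theta_neg_inv hΛ hZ, mul_pow, ← pow_mul, mul_comm n r, pow_mul, neg_I_pow_rank hΛ,
    one_pow, one_mul, zpow_natCast]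

/-- Conjugating an upper unipotent by J gives a lower one. Since only a monoid is available, J⁻¹ is
written as J³. -/
theorem lower_mem_automorphyMonoid (hΛ : IsThetaLattice Λ) {S : Matrix (Fin n) (Fin n) ℂ}
    (hS : S.IsHermitian) (hdiag : ∀ i, ∃ k : ℤ, S i i = k)
    (hint : ∀ i j, ∃ a : 𝓞 K, S i j = algebraMap (𝓞 K) ℂ a) :
    Matrix.fromBlocks 1 0 S 1 ∈ automorphyMonoid (theta n Λ) r := by
  have h1 : Matrix.fromBlocks 1 0 S 1 = Matrix.J (Fin n) ℂ * Matrix.fromBlocks 1 (-S) 0 1 *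
      (Matrix.J (Fin n) ℂ * Matrix.J (Fin n) ℂ * Matrix.J (Fin n) ℂ) := by
    simp [Matrix.J, Matrix.fromBlocks_multiply]
  rw [h1]
  have hJ := J_mem_automorphyMonoid (n := n) hΛ
  refine mul_mem (mul_mem hJ (upper_mem_automorphyMonoid hΛ hS.neg (fun i => ?_) fun i j => ?_))
    (mul_mem (mul_mem hJ hJ) hJ)
  · obtain ⟨k, hk⟩ := hdiag i
    exact ⟨-k, by simp [hk]⟩
  · obtain ⟨a, ha⟩ := hint i j
    exact ⟨-a, by simp [ha]⟩

/-- The action is Z ↦ AZA*, and cyclicity of the trace moves A onto the tuple, replacing V by VA.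
The bijection σ then reindexes the sum, and det A = 1 makes the automorphy factor trivial. -/
theorem leviMatrix_mem_automorphyMonoid (hΛ : DiscreteTopology Λ) {A : Matrix (Fin n) (Fin n) ℂ}
    (hA : A.det = 1) (σ : tuples n Λ ≃ tuples n Λ)
    (hσ : ∀ V : tuples n Λ, gram (mulRight A V.1) = gram (σ V).1) (k : ℤ) :
    leviMatrix A ∈ automorphyMonoid (theta n Λ) k := by
  have hA' : IsUnit A.conjTranspose.det := by rw [Matrix.det_conjTranspose, hA]; simp
  have hSU : leviMatrix A ∈ specialUnitary n := by
    refine mem_specialUnitary_fromBlocks.2 ⟨?_, by simp, ?_, ?_, by simp⟩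
    · rw [Matrix.det_fromBlocks_zero₂₁, hA, Matrix.det_nonsing_inv, Matrix.det_conjTranspose, hA]
      simp
    · simp [Matrix.mul_nonsing_inv _ hA']
    · rw [Matrix.conjTranspose_nonsing_inv, Matrix.conjTranspose_conjTranspose,
        Matrix.nonsing_inv_mul _ (by rw [hA]; simp)]
      simp
  have h1 : ∀ Z, denom (leviMatrix A) Z = A.conjTranspose⁻¹ := by intro Z; simp [denom, leviMatrix]
  have h2 : ∀ Z, moebius (leviMatrix A) Z = A * Z * A.conjTranspose := by
    intro Z
    rw [moebius, h1, Matrix.nonsing_inv_nonsing_inv _ hA']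
    simp [leviMatrix]
  refine ⟨hSU, fun Z hZ => ?_⟩
  have hZ' := moebius_mem_halfSpace hSU hZ
  rw [h1, Matrix.det_nonsing_inv, Matrix.det_conjTranspose, hA]
  simp only [star_one, Ring.inverse_one, one_zpow, one_mul]
  rw [theta_eq_tsum hΛ hZ', theta_eq_tsum hΛ hZ]
  refine Eq.trans (tsum_congr fun V => ?_) (σ.tsum_eq fun V => thetaExp Z V.1)
  rw [thetaExp, thetaExp, ← hσ, gram_mulRight, h2]
  congr 2
  rw [← Matrix.mul_assoc, Matrix.trace_mul_comm, ← Matrix.mul_assoc, ← Matrix.mul_assoc]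

end Cocycle
end HermitianTheta
end

noncomputable section
namespace HermitianTheta

/-! ### Conjugation and norms in ℚ(√-m). -/

section ImagQuad

variable {m : ℕ}

theorem sqrt_mul_I_sq (m : ℕ) :
    (((Real.sqrt m : ℝ) : ℂ) * Complex.I) ^ 2 = -(m : ℂ) := by
  rw [mul_pow, Complex.I_sq, ← Complex.ofReal_pow, Real.sq_sqrt (Nat.cast_nonneg m)]
  simp

/-- The elements of `ℚ(√-m)` in coordinates. -/
theorem exists_rat_of_mem_imagQuad {x : ℂ} (hx : x ∈ ImagQuad m) :
    ∃ p q : ℚ, x = p + q * (((Real.sqrt m : ℝ) : ℂ) * Complex.I) := by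
  set α : ℂ := ((Real.sqrt m : ℝ) : ℂ) * Complex.I with hα
  have hα2 : α ^ 2 = -(m : ℂ) := sqrt_mul_I_sq m
  refine IntermediateField.adjoin_induction ℚ (p := fun x _ => ∃ p q : ℚ, x = p + q * α)
    ?_ ?_ ?_ ?_ ?_ hx
  · rintro x rfl
    exact ⟨0, 1, by simp [hα]⟩
  · intro x
    exact ⟨x, 0, by simp⟩
  · rintro x y _ _ ⟨p, q, rfl⟩ ⟨p', q', rfl⟩
    exact ⟨p + p', q + q', by push_cast; ring⟩
  · rintro x _ ⟨p, q, rfl⟩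
    refine ⟨p / (p ^ 2 + m * q ^ 2), -q / (p ^ 2 + m * q ^ 2), ?_⟩
    have hprod : ((p : ℂ) + q * α) * (p - q * α) = ((p ^ 2 + m * q ^ 2 : ℚ) : ℂ) := by
      push_cast
      linear_combination (-(q : ℂ) ^ 2) * hα2
    have hconj : star ((p : ℂ) + q * α) = p - q * α := by
      simp [hα, sub_eq_add_neg]
    by_cases h0 : (p : ℂ) + q * α = 0
    · rw [h0, zero_mul, eq_comm, Rat.cast_eq_zero] at hprod
      rw [h0, hprod]
      simp
    · have h1 : (p : ℂ) - q * α ≠ 0 := by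
        rw [← hconj]
        exact star_ne_zero.2 h0
      have hN : ((p ^ 2 + m * q ^ 2 : ℚ) : ℂ) ≠ 0 := hprod ▸ mul_ne_zero h0 h1
      rw [Rat.cast_div, Rat.cast_div, ← hprod]
      push_cast
      field_simp
      ring
  · rintro x y _ _ ⟨p, q, rfl⟩ ⟨p', q', rfl⟩
    refine ⟨p * p' - m * q * q', p * q' + q * p', ?_⟩
    push_cast
    linear_combination ((q : ℂ) * q') * hα2

theorem conj_mem_imagQuad {x : ℂ} (hx : x ∈ ImagQuad m) : star x ∈ ImagQuad m := by
  obtain ⟨p, q, rfl⟩ := exists_rat_of_mem_imagQuad hx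
  have hα : ((Real.sqrt m : ℝ) : ℂ) * Complex.I ∈ ImagQuad m :=
    IntermediateField.mem_adjoin_simple_self ℚ _
  have : star ((p : ℂ) + q * (((Real.sqrt m : ℝ) : ℂ) * Complex.I)) =
      p - q * (((Real.sqrt m : ℝ) : ℂ) * Complex.I) := by simp [sub_eq_add_neg]
  rw [this]
  exact sub_mem (SubfieldClass.ratCast_mem _ p) (mul_mem (SubfieldClass.ratCast_mem _ q) hα)

/-- Complex conjugation on `ℚ(√-m)`. -/
def conjAlgHom (m : ℕ) : ImagQuad m →ₐ[ℚ] ImagQuad m where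
  toFun x := ⟨star x.1, conj_mem_imagQuad x.2⟩
  map_one' := Subtype.ext (star_one ℂ)
  map_mul' x y := Subtype.ext (star_mul' x.1 y.1)
  map_zero' := Subtype.ext (star_zero ℂ)
  map_add' x y := Subtype.ext (star_add x.1 y.1)
  commutes' q := Subtype.ext (by simp)

/-- Complex conjugation on the ring of integers of `ℚ(√-m)`. -/
instance starRingOfIntegers (m : ℕ) : StarRing (𝓞 (ImagQuad m)) where
  star x := ⟨conjAlgHom m x.1, x.2.map ((conjAlgHom m).restrictScalars ℤ)⟩
  star_involutive x := by
    apply NumberField.RingOfIntegers.ext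
    exact Subtype.ext (star_star _)
  star_mul x y := by
    apply NumberField.RingOfIntegers.ext
    exact Subtype.ext (star_mul _ _)
  star_add x y := by
    apply NumberField.RingOfIntegers.ext
    exact Subtype.ext (star_add _ _)

theorem algebraMap_ringOfIntegers_injective :
    Function.Injective (algebraMap (𝓞 (ImagQuad m)) ℂ) := by
  intro x y h
  apply NumberField.RingOfIntegers.ext
  exact Subtype.ext h

/-- A conjugation-invariant element has no √-m component, hence is rational, and ℤ is integrally
closed. This makes the diagonal of an integral Hermitian matrix integral over ℤ. -/
theorem exists_int_of_star_eq (hm : m ≠ 0) {a : 𝓞 (ImagQuad m)} (ha : star a = a) :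
    ∃ k : ℤ, a = k := by
  obtain ⟨p, q, hpq⟩ := exists_rat_of_mem_imagQuad a.1.2
  have h1 : star (a.1.1 : ℂ) = a.1.1 := congrArg (algebraMap (𝓞 (ImagQuad m)) ℂ) ha
  rw [hpq] at h1
  rw [Complex.star_def, Complex.conj_eq_iff_im] at h1
  have hq : q = 0 := by
    simpa [hm] using h1
  have h3 : algebraMap (𝓞 (ImagQuad m)) (ImagQuad m) a = algebraMap ℚ (ImagQuad m) p := by
    refine Subtype.ext (hpq.trans ?_)
    rw [hq]
    simp
  have h4 : IsIntegral ℤ p := by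
    have := NumberField.RingOfIntegers.isIntegral_coe a
    rw [h3] at this
    exact (isIntegral_algebraMap_iff (algebraMap ℚ (ImagQuad m)).injective).1 this
  obtain ⟨k, hk⟩ := IsIntegrallyClosed.isIntegral_iff.1 h4
  refine ⟨k, ?_⟩
  apply NumberField.RingOfIntegers.ext
  exact h3.trans (by rw [← hk]; simp)

theorem finrank_imagQuad_le (m : ℕ) : Module.finrank ℚ (ImagQuad m) ≤ 2 := by
  set α : ℂ := ((Real.sqrt m : ℝ) : ℂ) * Complex.I with hα
  have hp : (Polynomial.X ^ 2 + Polynomial.C (m : ℚ)).Monic := by monicity!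
  have h0 : Polynomial.aeval α (Polynomial.X ^ 2 + Polynomial.C (m : ℚ)) = 0 := by
    simp [hα, sqrt_mul_I_sq]
  have hint : IsIntegral ℚ α := ⟨_, hp, h0⟩
  rw [IntermediateField.adjoin.finrank hint]
  refine (Polynomial.natDegree_le_natDegree (minpoly.min ℚ α hp h0)).trans ?_
  compute_degree

/-- The norm is the product over the embeddings into ℂ. The degree is at most two, so the inclusion
and its conjugate, distinct because m ≠ 0, exhaust them. -/
theorem norm_imagQuad (hm : m ≠ 0) (x : ImagQuad m) :
    ((Algebra.norm ℚ x : ℚ) : ℂ) = x.1 * star x.1 := by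
  classical
  set σ : ImagQuad m →ₐ[ℚ] ℂ := (ImagQuad m).val with hσ
  set τ : ImagQuad m →ₐ[ℚ] ℂ := (ImagQuad m).val.comp (conjAlgHom m) with hτ
  have hne : σ ≠ τ := by
    intro h
    have h1 := DFunLike.congr_fun h (⟨((Real.sqrt m : ℝ) : ℂ) * Complex.I,
      IntermediateField.mem_adjoin_simple_self ℚ _⟩ : ImagQuad m)
    have h2 : ((Real.sqrt m : ℝ) : ℂ) * Complex.I = star (((Real.sqrt m : ℝ) : ℂ) * Complex.I) := h1
    rw [eq_comm, Complex.star_def, Complex.conj_eq_iff_im] at h2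
    simp [hm] at h2
  have huniv : (Finset.univ : Finset (ImagQuad m →ₐ[ℚ] ℂ)) = {σ, τ} := by
    symm
    refine Finset.eq_univ_of_card _ (le_antisymm ?_ ?_)
    · exact Finset.card_le_univ _
    · rw [Finset.card_pair hne, AlgHom.card]
      exact finrank_imagQuad_le m
  have := Algebra.norm_eq_prod_embeddings ℚ ℂ x
  rw [huniv, Finset.prod_pair hne] at this
  exact this

theorem absNorm_span_singleton_eq (hm : m ≠ 0) (a : 𝓞 (ImagQuad m)) :
    (Ideal.absNorm (Ideal.span {a}) : ℝ) = ‖algebraMap (𝓞 (ImagQuad m)) ℂ a‖ ^ 2 := by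
  have h1 : ((Algebra.norm ℤ a : ℤ) : ℂ) = ((‖algebraMap (𝓞 (ImagQuad m)) ℂ a‖ ^ 2 : ℝ) : ℂ) := by
    have h2 := norm_imagQuad hm (a : ImagQuad m)
    rw [← Algebra.coe_norm_int, Rat.cast_intCast] at h2
    rw [h2, Complex.star_def, Complex.mul_conj, Complex.normSq_eq_norm_sq]
    rfl
  have h3 : ((Algebra.norm ℤ a : ℤ) : ℝ) = ‖algebraMap (𝓞 (ImagQuad m)) ℂ a‖ ^ 2 := by
    exact_mod_cast h1
  rw [Ideal.absNorm_span_singleton, Nat.cast_natAbs, Int.cast_abs, h3, abs_of_nonneg (sq_nonneg _)]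

end ImagQuad

/-! ### Levi elements and ideal twists. -/

section Levi

variable {m n r : ℕ} {Λ : Submodule (𝓞 (ImagQuad m)) (Fin r → ℂ)}

theorem det_mem_pow {R : Type*} [CommRing R] {k : ℕ} {I : Ideal R} {L : Matrix (Fin k) (Fin k) R}
    (hL : ∀ i j, L i j ∈ I) : L.det ∈ I ^ k := by
  rw [Matrix.det_apply']
  refine Ideal.sum_mem _ fun σ _ => Ideal.mul_mem_left _ _ ?_
  have := Ideal.prod_mem_prod (s := Finset.univ) (I := fun _ : Fin k => I)
    (x := fun i => L (σ i) i) fun i _ => hL _ _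
  simpa using this

theorem adjugate_mem_pow {R : Type*} [CommRing R] {k : ℕ} {I : Ideal R}
    {L : Matrix (Fin (k + 1)) (Fin (k + 1)) R} (hL : ∀ i j, L i j ∈ I) (i j : Fin (k + 1)) :
    L.adjugate i j ∈ I ^ k := by
  rw [Matrix.adjugate_fin_succ_eq_det_submatrix]
  exact Ideal.mul_mem_left _ _ (det_mem_pow fun _ _ => hL _ _)

theorem mem_entryIdeal {R : Type*} [CommRing R] (L : Matrix (Fin n) (Fin n) R) (i j : Fin n) :
    L i j ∈ entryIdeal L := Ideal.subset_span ⟨i, j, rfl⟩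

/-- Right multiplication by `L` maps `Λ^n` onto `(I(L) Λ)^n` if `I(L)^n = (det L)`. -/
theorem mulRight_mem_iff (hn : 0 < n) {L : Matrix (Fin n) (Fin n) (𝓞 (ImagQuad m))}
    (hdet : L.det ≠ 0) (hL : entryIdeal L ^ n = Ideal.span {L.det}) (V : Fin n → Fin r → ℂ) :
    (∀ i, V i ∈ Λ) ↔
      ∀ j, mulRight (L.map (algebraMap (𝓞 (ImagQuad m)) ℂ)) V j ∈ entryIdeal L • Λ := by
  obtain ⟨k, rfl⟩ := Nat.exists_eq_succ_of_ne_zero hn.ne'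
  have hd : algebraMap (𝓞 (ImagQuad m)) ℂ L.det ≠ 0 := by
    rw [Ne, map_eq_zero_iff _ algebraMap_ringOfIntegers_injective]
    exact hdet
  constructor
  · intro hV j
    rw [mulRight_apply]
    refine Submodule.sum_mem _ fun i _ => ?_
    rw [Matrix.map_apply, algebraMap_smul]
    exact Submodule.smul_mem_smul (mem_entryIdeal L i j) (hV i)
  · intro hV j
    have h1 : mulRight (L.adjugate.map (algebraMap (𝓞 (ImagQuad m)) ℂ))
        (mulRight (L.map (algebraMap (𝓞 (ImagQuad m)) ℂ)) V) = L.det • V := by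
      rw [mulRight_mulRight, ← Matrix.map_mul, Matrix.mul_adjugate]
      funext j
      rw [mulRight_apply, Finset.sum_eq_single j]
      · simp
      · intro i _ hij
        simp [Matrix.one_apply_ne hij]
      · simp
    -- Cofactors lie in the (n-1)-st power of the entry ideal I, so multiplying a tuple in IΛ by the
    -- adjugate lands in I^n Λ = (det L)Λ, and det L can be cancelled.
    have h2 : L.det • V j ∈ (entryIdeal L ^ (k + 1)) • Λ := by
      rw [← Pi.smul_apply, ← h1, mulRight_apply, pow_succ, Submodule.mul_smul]
      refine Submodule.sum_mem _ fun i _ => ?_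
      rw [Matrix.map_apply, algebraMap_smul]
      exact Submodule.smul_mem_smul (adjugate_mem_pow (mem_entryIdeal L) i j) (hV i)
    rw [hL, Submodule.ideal_span_singleton_smul] at h2
    obtain ⟨y, hy, hyV⟩ := (Submodule.mem_smul_pointwise_iff_exists _ _ _).1 h2
    have : y = V j := by
      rw [← algebraMap_smul ℂ L.det y, ← algebraMap_smul ℂ L.det (V j)] at hyV
      exact smul_right_injective _ hd hyV
    exact this ▸ hy

/-- Right multiplication by L, division by |u| and the isometry from the twisted lattice compose to
a bijection of Λ^n with the Gram matrices that `leviMatrix_mem_automorphyMonoid` requires. -/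
theorem leviMatrix_mem_of_mem_leviSet (hm : m ≠ 0) (hn : 0 < n) (hΛ : DiscreteTopology Λ)
    (hI : ∀ I : (Ideal (𝓞 (ImagQuad m)))⁰, orderOf (ClassGroup.mk0 I) ∣ n →
      Isometric (idealTwist (I : Ideal _) Λ) Λ)
    {A : Matrix (Fin n) (Fin n) ℂ} (hA : A ∈ leviSet (ImagQuad m) n) (k : ℤ) :
    leviMatrix A ∈ automorphyMonoid (theta n Λ) k := by
  obtain ⟨hA1, u, L, hu, hAL, hL⟩ := hA
  set φ := algebraMap (𝓞 (ImagQuad m)) ℂ with hφ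
  have hdet : φ L.det = u ^ n := by
    rw [hAL, Matrix.det_smul, Fintype.card_fin, ← RingHom.mapMatrix_apply, ← RingHom.map_det,
      inv_pow, inv_mul_eq_one₀ (pow_ne_zero _ hu)] at hA1
    exact hA1.symm
  have hdet0 : L.det ≠ 0 := by
    intro h
    rw [h, map_zero] at hdet
    exact pow_ne_zero _ hu hdet.symm
  set I := entryIdeal L with hIdef
  have hI0 : I ≠ ⊥ := by
    intro h
    rw [h, ← Ideal.zero_eq_bot, zero_pow hn.ne', eq_comm, Ideal.zero_eq_bot,
      Ideal.span_singleton_eq_bot] at hL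
    exact hdet0 hL
  set I' : (Ideal (𝓞 (ImagQuad m)))⁰ := ⟨I, mem_nonZeroDivisors_of_ne_zero hI0⟩ with hI'
  have hord : orderOf (ClassGroup.mk0 I') ∣ n := by
    refine orderOf_dvd_of_pow_eq_one ?_
    rw [← map_pow, ClassGroup.mk0_eq_one_iff]
    exact ⟨⟨L.det, hL⟩⟩
  -- Take norms in I^n = (det L) with det L = u^n, then extract the n-th root.
  have hnorm : (Ideal.absNorm I : ℝ) = ‖u‖ ^ 2 := by
    have h1 := absNorm_span_singleton_eq hm L.det
    rw [← hL, map_pow, ← hφ, hdet, norm_pow, ← pow_mul, mul_comm n 2, pow_mul] at h1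
    push_cast at h1
    exact (pow_left_inj₀ (Nat.cast_nonneg _) (sq_nonneg _) hn.ne').1 h1
  have hs : Real.sqrt (Ideal.absNorm I : ℝ) = ‖u‖ := by
    rw [hnorm, Real.sqrt_sq (norm_nonneg u)]
  have hu' : ‖u‖ ≠ 0 := norm_ne_zero_iff.2 hu
  obtain ⟨f, hf⟩ := hI I' hord
  have htwist : ∀ x : Fin r → ℂ, x ∈ idealTwist I Λ ↔ ‖u‖ • x ∈ I • Λ := by
    intro x
    rw [idealTwist, hs, Submodule.mem_smul_pointwise_iff_exists]
    constructor
    · rintro ⟨y, hy, rfl⟩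
      rwa [smul_inv_smul₀ hu']
    · intro h
      exact ⟨_, h, inv_smul_smul₀ hu' x⟩
  have hmem : ∀ (V : tuples n Λ) (j : Fin n), ‖u‖⁻¹ • mulRight (L.map φ) V.1 j ∈ idealTwist I Λ := by
    intro V j
    rw [htwist, smul_inv_smul₀ hu']
    exact (mulRight_mem_iff hn hdet0 hL V.1).1 V.2 j
  set g : tuples n Λ → tuples n Λ := fun V =>
    ⟨fun j => (f ⟨_, hmem V j⟩ : Fin r → ℂ), fun j => (f ⟨_, hmem V j⟩).2⟩ with hg
  have hLinj : Function.Injective (mulRight (r := r) (L.map φ)) := by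
    intro V W hVW
    have hun : IsUnit (L.map φ).det := by
      rw [← RingHom.mapMatrix_apply, ← RingHom.map_det, hdet]
      exact (isUnit_iff_ne_zero.2 (pow_ne_zero _ hu))
    have := congrArg (mulRight (L.map φ)⁻¹) hVW
    rwa [mulRight_mulRight, mulRight_mulRight, Matrix.mul_nonsing_inv _ hun, mulRight_one,
      mulRight_one] at this
  have hbij : Function.Bijective g := by
    constructor
    · intro V W hVW
      refine Subtype.ext (hLinj (funext fun j => ?_))
      have h1 : (f ⟨_, hmem V j⟩ : Fin r → ℂ) = f ⟨_, hmem W j⟩ :=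
        congrFun (congrArg Subtype.val hVW) j
      have h2 := congrArg Subtype.val (f.injective (Subtype.ext h1))
      exact smul_right_injective _ (inv_ne_zero hu') h2
    · intro W
      set X : Fin n → Fin r → ℂ := fun j => ‖u‖ • (f.symm ⟨W.1 j, W.2 j⟩ : Fin r → ℂ) with hX
      have hun : IsUnit (L.map φ).det := by
        rw [← RingHom.mapMatrix_apply, ← RingHom.map_det, hdet]
        exact (isUnit_iff_ne_zero.2 (pow_ne_zero _ hu))
      have hVX : mulRight (L.map φ) (mulRight (L.map φ)⁻¹ X) = X := by
        rw [mulRight_mulRight, Matrix.nonsing_inv_mul _ hun, mulRight_one]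
      have hV : ∀ i, mulRight (L.map φ)⁻¹ X i ∈ Λ := by
        rw [mulRight_mem_iff hn hdet0 hL]
        intro j
        rw [hVX]
        exact (htwist _).1 (f.symm ⟨W.1 j, W.2 j⟩).2
      refine ⟨⟨_, hV⟩, Subtype.ext (funext fun j => ?_)⟩
      have h1 : (⟨_, hmem ⟨_, hV⟩ j⟩ : idealTwist I Λ) = f.symm ⟨W.1 j, W.2 j⟩ := by
        refine Subtype.ext ?_
        change ‖u‖⁻¹ • mulRight (L.map φ) (mulRight (L.map φ)⁻¹ X) j = _
        rw [hVX, hX]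
        exact inv_smul_smul₀ hu' _
      change ((f ⟨_, hmem ⟨_, hV⟩ j⟩ : Λ) : Fin r → ℂ) = W.1 j
      rw [h1, LinearEquiv.apply_symm_apply]
  refine leviMatrix_mem_automorphyMonoid hΛ hA1 (Equiv.ofBijective g hbij) (fun V => ?_) k
  ext i j
  have h1 : gram (Equiv.ofBijective g hbij V).1 i j =
      herm (‖u‖⁻¹ • mulRight (L.map φ) V.1 i) (‖u‖⁻¹ • mulRight (L.map φ) V.1 j) :=
    hf ⟨_, hmem V i⟩ ⟨_, hmem V j⟩
  -- Here the scalar is u⁻¹, whereas the bijection uses |u|⁻¹; the Hermitian products agree because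
  -- conj(u)·u = |u|².
  have h2 : ∀ j, mulRight A V.1 j = u⁻¹ • mulRight (L.map φ) V.1 j := by
    intro j
    rw [mulRight_apply, mulRight_apply, hAL, Finset.smul_sum]
    refine Finset.sum_congr rfl fun i _ => ?_
    rw [Matrix.smul_apply, smul_assoc]
  rw [h1]
  change herm (mulRight A V.1 i) (mulRight A V.1 j) = _
  rw [h2, h2, herm, herm, star_smul, star_smul, smul_dotProduct, dotProduct_smul, smul_dotProduct,
    dotProduct_smul, smul_smul, smul_smul, star_trivial (‖u‖⁻¹ : ℝ), smul_eq_mul, Complex.real_smul]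
  congr 1
  rw [star_inv₀, ← mul_inv, Complex.star_def, ← Complex.normSq_eq_conj_mul_self,
    Complex.normSq_eq_norm_sq]
  push_cast
  rw [sq, mul_inv]

end Levi
end HermitianTheta
end

noncomputable section
namespace HermitianTheta

/-! ### Simultaneous approximation and thin sets. -/

section Approximation

/-- An approximation principle: conditions that are invariant modulo pairwise coprime ideals and
can be satisfied one by one can be satisfied simultaneously. -/
theorem exists_forall_of_isCoprime {R M ι : Type*} [CommRing R] [AddCommGroup M] [Module R M]
    (F : Finset ι) (I : ι → Ideal R)
    (hI : ∀ i ∈ F, ∀ j ∈ F, i ≠ j → IsCoprime (I i) (I j)) (good : ι → M → Prop)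
    (hinv : ∀ i ∈ F, ∀ g h : M, ∀ a ∈ I i, good i g → good i (g + a • h))
    (hex : ∀ i ∈ F, ∃ g, good i g) : ∃ g, ∀ i ∈ F, good i g := by
  classical
  induction F using Finset.induction_on with
  | empty => exact ⟨0, by simp⟩
  | insert i F hi ih =>
    obtain ⟨g, hg⟩ := ih (fun a ha b hb => hI a (Finset.mem_insert_of_mem ha) b
      (Finset.mem_insert_of_mem hb)) (fun a ha => hinv a (Finset.mem_insert_of_mem ha))
      (fun a ha => hex a (Finset.mem_insert_of_mem ha))
    obtain ⟨g', hg'⟩ := hex i (Finset.mem_insert_self i F)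
    have hcop : IsCoprime (∏ j ∈ F, I j) (I i) := IsCoprime.prod_left fun j hj =>
      hI j (Finset.mem_insert_of_mem hj) i (Finset.mem_insert_self i F) fun h => hi (h ▸ hj)
    obtain ⟨x, hx, y, hy, hxy⟩ := Ideal.isCoprime_iff_exists.1 hcop
    refine ⟨g + x • (g' - g), fun j hj => ?_⟩
    rcases Finset.mem_insert.1 hj with rfl | hjF
    · have : g + x • (g' - g) = g' + y • (g - g') := by
        rw [eq_sub_of_add_eq' hxy]
        module
      rw [this]
      exact hinv j hj _ _ _ hy hg'
    · exact hinv j hj _ _ _ (Ideal.le_of_dvd (Finset.dvd_prod_of_mem I hjF) hx) (hg j hjF)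

/-- A subset of a group that is contained in a coset of a subgroup of index at least three. -/
def IsThin {G : Type*} [AddCommGroup G] (A : Set G) : Prop :=
  ∃ H : AddSubgroup G, (∀ g ∈ A, ∀ g' ∈ A, g - g' ∈ H) ∧
    ∃ u v : G, u ∉ H ∧ v ∉ H ∧ u - v ∉ H

/-- Suppose A and B cover the group. Translates of points outside K land in A, which forces K ≤ H;
translates of u and v land in B, which puts u - v in K ≤ H, a contradiction. Index two would not
suffice, since two cosets then cover. -/
theorem IsThin.exists_notMem {G : Type*} [AddCommGroup G] {A B : Set G} (hA : IsThin A)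
    (hB : IsThin B) : ∃ g, g ∉ A ∧ g ∉ B := by
  obtain ⟨H, hH, u, v, hu, hv, huv⟩ := hA
  obtain ⟨K, hK, w, z, hw, hz, hwz⟩ := hB
  by_contra! hcon
  by_cases hA0 : ∃ a, a ∈ A
  swap
  · push Not at hA0
    refine hw ?_
    simpa using hK w (hcon w (hA0 w)) 0 (hcon 0 (hA0 0))
  by_cases hB0 : ∃ b, b ∈ B
  swap
  · push Not at hB0
    have h : ∀ g, g ∈ A := fun g => by_contra fun h => hB0 g (hcon g h)
    refine hu ?_
    simpa using hH u (h u) 0 (h 0)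
  obtain ⟨a, ha⟩ := hA0
  obtain ⟨b, hb⟩ := hB0
  have hA1 : ∀ x, x ∉ H → a + x ∈ B := fun x hx => hcon _ fun h => hx (by
    simpa using hH _ h a ha)
  have hB1 : ∀ x, x ∉ K → b + x ∈ A := fun x hx => by_contra fun h => hx (by
    simpa using hK _ (hcon _ h) b hb)
  have hKH : ∀ x ∈ K, x ∈ H := by
    intro x hx
    have h1 := hH _ (hB1 (w + x) fun h => hw (by simpa using K.sub_mem h hx)) _ (hB1 w hw)
    simpa using h1
  have h2 := hK _ (hA1 u hu) _ (hA1 v hv)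
  exact huv (hKH _ (by simpa using h2))

end Approximation

/-! ### Primes above a rational prime. -/

section PrimesAbove

variable {K : Type*} [Field K] [NumberField K]

/-- The norm divides a power of p and is not 1, so it is a positive power of p. -/
theorem prime_le_absNorm {p : ℕ} (hp : p.Prime) {P : Ideal (𝓞 K)} (hP : P.IsPrime)
    (hpP : (p : 𝓞 K) ∈ P) : p ≤ Ideal.absNorm P := by
  have h1 : Ideal.absNorm P ∣ p ^ Module.finrank ℤ (𝓞 K) := by
    rw [← Ideal.absNorm_span_natCast]
    exact Ideal.absNorm_dvd_absNorm_of_le ((Ideal.span_singleton_le_iff_mem _).2 hpP)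
  obtain ⟨k, -, hk⟩ := (Nat.dvd_prime_pow hp).1 h1
  have h2 : k ≠ 0 := by
    rintro rfl
    exact hP.ne_top (Ideal.absNorm_eq_one_iff.1 (by simpa using hk))
  rw [hk]
  exact Nat.le_self_pow h2 p

theorem isMaximal_of_natCast_mem {p : ℕ} (hp : p ≠ 0) {P : Ideal (𝓞 K)} (hP : P.IsPrime)
    (hpP : (p : 𝓞 K) ∈ P) : P.IsMaximal :=
  hP.isMaximal fun h => by
    rw [h, Ideal.mem_bot] at hpP
    exact hp (by exact_mod_cast hpP)

/-- In a quadratic field there are at most two primes above a rational prime. -/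
theorem eq_or_eq_or_eq_of_natCast_mem (hK : Module.finrank ℚ K ≤ 2) {p : ℕ} (hp : p.Prime)
    {P Q M : Ideal (𝓞 K)} (hP : P.IsPrime) (hQ : Q.IsPrime) (hM : M.IsPrime)
    (hpP : (p : 𝓞 K) ∈ P) (hpQ : (p : 𝓞 K) ∈ Q) (hpM : (p : 𝓞 K) ∈ M) :
    P = Q ∨ P = M ∨ Q = M := by
  by_contra! h
  obtain ⟨h1, h2, h3⟩ := h
  have := isMaximal_of_natCast_mem hp.ne_zero hP hpP
  have := isMaximal_of_natCast_mem hp.ne_zero hQ hpQ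
  have := isMaximal_of_natCast_mem hp.ne_zero hM hpM
  have hdvd : P * Q * M ∣ Ideal.span {(p : 𝓞 K)} := by
    refine IsCoprime.mul_dvd (IsCoprime.mul_left (Ideal.isCoprime_of_isMaximal h2)
      (Ideal.isCoprime_of_isMaximal h3)) (IsCoprime.mul_dvd (Ideal.isCoprime_of_isMaximal h1)
      ?_ ?_) ?_
    all_goals rw [Ideal.dvd_iff_le, Ideal.span_singleton_le_iff_mem]; assumption
  have h4 := Ideal.absNorm_dvd_absNorm_of_le (Ideal.le_of_dvd hdvd)
  rw [Ideal.absNorm_span_natCast, map_mul, map_mul, NumberField.RingOfIntegers.rank] at h4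
  have h5 := Nat.le_of_dvd (pow_pos hp.pos _) h4
  have h6 : p * p * p ≤ p ^ 2 := (Nat.mul_le_mul (Nat.mul_le_mul (prime_le_absNorm hp hP hpP)
    (prime_le_absNorm hp hQ hpQ)) (prime_le_absNorm hp hM hpM)).trans
    (h5.trans (Nat.pow_le_pow_right hp.pos hK))
  have h7 := hp.two_le
  nlinarith [Nat.mul_le_mul h7 h7]

/-- Thin conditions at all primes above a rational prime can be avoided simultaneously. -/
theorem exists_forall_prime_notMem (hK : Module.finrank ℚ K ≤ 2) {G : Type*} [AddCommGroup G]
    {p : ℕ} (hp : p.Prime) (A : Ideal (𝓞 K) → Set G)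
    (hA : ∀ P : Ideal (𝓞 K), P.IsPrime → (p : 𝓞 K) ∈ P → IsThin (A P)) :
    ∃ g, ∀ P : Ideal (𝓞 K), P.IsPrime → (p : 𝓞 K) ∈ P → g ∉ A P := by
  by_cases h0 : ∃ P : Ideal (𝓞 K), P.IsPrime ∧ (p : 𝓞 K) ∈ P
  swap
  · push Not at h0
    exact ⟨0, fun P hP hpP => absurd hpP (h0 P hP)⟩
  obtain ⟨P, hP, hpP⟩ := h0
  by_cases h1 : ∃ Q : Ideal (𝓞 K), Q.IsPrime ∧ (p : 𝓞 K) ∈ Q ∧ P ≠ Q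
  · obtain ⟨Q, hQ, hpQ, hPQ⟩ := h1
    obtain ⟨g, hgP, hgQ⟩ := (hA P hP hpP).exists_notMem (hA Q hQ hpQ)
    refine ⟨g, fun M hM hpM => ?_⟩
    rcases eq_or_eq_or_eq_of_natCast_mem hK hp hP hQ hM hpP hpQ hpM with h | rfl | rfl
    · exact absurd h hPQ
    · exact hgP
    · exact hgQ
  · push Not at h1
    obtain ⟨g, hg, -⟩ := (hA P hP hpP).exists_notMem (hA P hP hpP)
    exact ⟨g, fun M hM hpM => h1 M hM hpM ▸ hg⟩

theorem exists_prime_dvd_of_natCast_mem {R : Type*} [CommRing R] {P : Ideal R} (hP : P.IsPrime)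
    {N : ℕ} (hN : N ≠ 0) (h : (N : R) ∈ P) : ∃ p, p.Prime ∧ p ∣ N ∧ (p : R) ∈ P := by
  induction N using Nat.recOnMul with
  | zero => exact absurd rfl hN
  | one => exact absurd ((Ideal.eq_top_iff_one _).2 (by simpa using h)) hP.ne_top
  | prime p hp => exact ⟨p, hp, dvd_rfl, h⟩
  | mul a b iha ihb =>
    rw [Nat.cast_mul] at h
    rcases hP.mem_or_mem h with h | h
    · obtain ⟨p, hp, hd, hm⟩ := iha (left_ne_zero_of_mul hN) h
      exact ⟨p, hp, hd.mul_right b, hm⟩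
    · obtain ⟨p, hp, hd, hm⟩ := ihb (right_ne_zero_of_mul hN) h
      exact ⟨p, hp, hd.mul_left a, hm⟩

end PrimesAbove

/-! ### A stable range condition with symmetric matrices. -/

section Rows

variable {n : ℕ}

/-- The symmetric integral matrices. -/
def symmInt (n : ℕ) : AddSubgroup (Matrix (Fin n) (Fin n) ℤ) where
  carrier := {S | S.IsSymm}
  zero_mem' := Matrix.isSymm_zero
  add_mem' h h' := h.add h'
  neg_mem' h := h.neg

/-- The map `S ↦ cS` on symmetric integral matrices. -/
def rowMap {R : Type*} [CommRing R] (c : Fin n → R) : symmInt n →+ (Fin n → R) where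
  toFun S := Matrix.vecMul c (S.1.map (Int.castRingHom R))
  map_zero' := by simp
  map_add' S T := by
    rw [← Matrix.vecMul_add]
    congr 1
    ext i j
    simp

theorem rowMap_apply {R : Type*} [CommRing R] (c : Fin n → R) (S : symmInt n) (j : Fin n) :
    rowMap c S j = ∑ i, c i * (S.1 i j : R) := rfl

/-- The symmetric matrix with a one at the diagonal position `i`. -/
def diagUnit (i : Fin n) : symmInt n :=
  ⟨Matrix.single i i 1, by
    change (Matrix.single i i (1 : ℤ)).transpose = _
    rw [Matrix.transpose_single]⟩

/-- The symmetric matrix `E_{ij} + E_{ji}`. -/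
def symmUnit (i j : Fin n) : symmInt n :=
  ⟨Matrix.single i j 1 + Matrix.single j i 1, by
    change (Matrix.single i j (1 : ℤ) + Matrix.single j i 1).transpose = _
    rw [Matrix.transpose_add, Matrix.transpose_single, Matrix.transpose_single, add_comm]⟩

variable {R : Type*} [CommRing R]

theorem rowMap_diagUnit (c : Fin n → R) (i : Fin n) :
    rowMap c (diagUnit i) = Pi.single i (c i) := by
  funext k
  rw [rowMap_apply, diagUnit, Finset.sum_eq_single i]
  · rcases eq_or_ne i k with rfl | h
    · simp
    · simp [h, h.symm]
  · intro l _ hl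
    simp [hl.symm]
  · simp

theorem rowMap_symmUnit (c : Fin n → R) (i j : Fin n) :
    rowMap c (symmUnit i j) = Pi.single j (c i) + Pi.single i (c j) := by
  funext k
  rw [rowMap_apply, symmUnit]
  simp only [Matrix.add_apply, Int.cast_add, mul_add, Finset.sum_add_distrib, Matrix.single_apply,
    Int.cast_ite, Int.cast_one, Int.cast_zero, mul_ite, mul_one, mul_zero, Pi.add_apply,
    Pi.single_apply, ite_and]
  simp [eq_comm]

/-- If c is nonzero mod P, two bad S differ by an element of {S : cS ≡ 0}, and a diagonal unit
together with a symmetric unit shows index at least three; this needs a second position l. If c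
vanishes mod P, then d does not, there is no bad S, and the trivial subgroup serves. -/
theorem isThin_rowMap {i₀ j₀ : Fin n} (hij : i₀ ≠ j₀) (c d : Fin n → R) {P : Ideal R}
    (h : (∃ k, c k ∉ P) ∨ ∃ k, d k ∉ P) :
    IsThin {S : symmInt n | ∀ k, d k + rowMap c S k ∈ P} := by
  let H : AddSubgroup (symmInt n) :=
    { carrier := {S | ∀ k, rowMap c S k ∈ P}
      zero_mem' := by simp
      add_mem' := fun h h' k => by simpa using P.add_mem (h k) (h' k)
      neg_mem' := fun h k => by simpa using h k }
  by_cases hc : ∃ k, c k ∉ P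
  · obtain ⟨k, hk⟩ := hc
    obtain ⟨l, hl⟩ : ∃ l, l ≠ k := by
      rcases eq_or_ne i₀ k with rfl | h
      · exact ⟨j₀, hij.symm⟩
      · exact ⟨i₀, h⟩
    refine ⟨H, fun g hg g' hg' j => ?_, diagUnit k, symmUnit k l, fun h => hk ?_, fun h => hk ?_,
      fun h => hk ?_⟩
    · simpa using P.sub_mem (hg j) (hg' j)
    · simpa [rowMap_diagUnit] using h k
    · simpa [rowMap_symmUnit, hl, hl.symm] using h l
    · simpa [rowMap_symmUnit, rowMap_diagUnit, hl, hl.symm] using h l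
  · have hd := h.resolve_left hc
    obtain ⟨k, hk⟩ := hd
    push Not at hc
    have h0 : ∀ S : symmInt n, rowMap c S k ∈ P := fun S => by
      rw [rowMap_apply]
      exact Ideal.sum_mem _ fun l _ => P.mul_mem_right _ (hc l)
    refine ⟨⊥, fun g hg => absurd ((P.add_mem_iff_left (h0 g)).1 (hg k)) hk, diagUnit i₀,
      symmUnit i₀ j₀, fun h => ?_, fun h => ?_, fun h => ?_⟩
    · have := congrFun (congrFun (congrArg Subtype.val h) i₀) i₀
      simp [diagUnit] at this
    · have := congrFun (congrFun (congrArg Subtype.val h) i₀) j₀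
      simp [symmUnit, hij, hij.symm] at this
    · have := congrFun (congrFun (congrArg Subtype.val h) i₀) j₀
      simp [symmUnit, diagUnit, hij, hij.symm] at this

theorem span_range_eq_top_iff (x : Fin n → R) :
    Ideal.span (Set.range x) = ⊤ ↔ ∀ P : Ideal R, P.IsMaximal → ∃ k, x k ∉ P := by
  constructor
  · intro h P hP
    by_contra! hx
    refine hP.ne_top (top_le_iff.1 (h ▸ Ideal.span_le.2 ?_))
    rintro _ ⟨k, rfl⟩
    exact hx k
  · intro h
    by_contra hx
    obtain ⟨P, hP, hle⟩ := Ideal.exists_le_maximal _ hx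
    obtain ⟨k, hk⟩ := h P hP
    exact hk (hle (Ideal.subset_span ⟨k, rfl⟩))

variable {K : Type*} [Field K] [NumberField K]

/-- A stable range condition: if `(c, d)` is unimodular, then so is `d + cS` for some symmetric
integral matrix `S`. -/
theorem exists_symmInt_span_eq_top (hK : Module.finrank ℚ K ≤ 2) {c d : Fin n → 𝓞 K}
    {i j : Fin n} (hij : i ≠ j) (hci : c i ≠ 0)
    (hcd : ∀ P : Ideal (𝓞 K), P.IsMaximal → (∃ k, c k ∉ P) ∨ ∃ k, d k ∉ P) :
    ∃ S : symmInt n, Ideal.span (Set.range (d + rowMap c S)) = ⊤ := by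
  -- Away from primes dividing N, the entry c i is a unit and 2 is a unit. The latter gives ℤ at
  -- least three residue classes, as thinness requires.
  set N : ℕ := 2 * Ideal.absNorm (Ideal.span {c i}) with hN
  have hN0 : N ≠ 0 := mul_ne_zero two_ne_zero (by
    rw [Ne, Ideal.absNorm_eq_zero_iff, Ideal.span_singleton_eq_bot]
    exact hci)
  have hmax : ∀ {p : ℕ}, p.Prime → ∀ P : Ideal (𝓞 K), P.IsPrime → (p : 𝓞 K) ∈ P → P.IsMaximal :=
    fun hp P hP hpP => isMaximal_of_natCast_mem hp.ne_zero hP hpP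
  have hcop : ∀ (F : Finset ℕ), (∀ p ∈ F, p.Prime) → ∀ p ∈ F, ∀ q ∈ F, p ≠ q →
      IsCoprime (Ideal.span {(p : ℤ)}) (Ideal.span {(q : ℤ)}) := by
    intro F hF p hp q hq hpq
    rw [Ideal.isCoprime_span_singleton_iff, Nat.isCoprime_iff_coprime]
    exact (Nat.coprime_primes (hF p hp) (hF q hq)).2 hpq
  have hdvd : ∀ {p : ℕ} {a : ℤ} {P : Ideal (𝓞 K)}, a ∈ Ideal.span {(p : ℤ)} → (p : 𝓞 K) ∈ P →
      (a : 𝓞 K) ∈ P := by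
    intro p a P ha hp
    obtain ⟨b, rfl⟩ := Ideal.mem_span_singleton.1 ha
    push_cast
    exact P.mul_mem_right _ hp
  -- the primes dividing `N`
  obtain ⟨S₀, hS₀⟩ := exists_forall_of_isCoprime (R := ℤ) (M := symmInt n) N.primeFactors
    (fun p => Ideal.span {(p : ℤ)}) (hcop _ fun p hp => Nat.prime_of_mem_primeFactors hp)
    (fun p S => ∀ P : Ideal (𝓞 K), P.IsPrime → (p : 𝓞 K) ∈ P →
      S ∉ {S : symmInt n | ∀ k, d k + rowMap c S k ∈ P})
    (fun p _ S T a ha hS P hP hpP h => hS P hP hpP fun k => by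
      have h1 : d k + rowMap c (S + a • T) k = d k + rowMap c S k + a * rowMap c T k := by
        rw [map_add, map_zsmul, Pi.add_apply, Pi.smul_apply, zsmul_eq_mul, add_assoc]
      exact (P.add_mem_iff_left (P.mul_mem_right _ (hdvd ha hpP))).1 (h1 ▸ h k))
    (fun p hp => exists_forall_prime_notMem hK (Nat.prime_of_mem_primeFactors hp)
      (fun P => {S : symmInt n | ∀ k, d k + rowMap c S k ∈ P}) fun P hP hpP =>
        isThin_rowMap hij c d (hcd P (hmax (Nat.prime_of_mem_primeFactors hp) P hP hpP)))
  -- make the entry `j` nonzero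
  obtain ⟨t, ht⟩ : ∃ t : ℤ, d j + rowMap c S₀ j + c i * (N * t) ≠ 0 := by
    by_cases h : d j + rowMap c S₀ j = 0
    · exact ⟨1, by simp [h, hci, hN0]⟩
    · exact ⟨0, by simpa using h⟩
  -- Entries j and i after adding N t times a symmetric unit. All further changes to S are multiples
  -- of N, so the choice at primes dividing N persists. A final diagonal change at position i leaves
  -- x alone, so only primes dividing the norm of x remain dangerous.
  set x := d j + rowMap c S₀ j + c i * (N * t) with hx
  set y := d i + rowMap c S₀ i + c j * (N * t) with hy
  set N' := Ideal.absNorm (Ideal.span {x}) with hN'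
  have hN'0 : N' ≠ 0 := by
    rw [Ne, Ideal.absNorm_eq_zero_iff, Ideal.span_singleton_eq_bot]
    exact ht
  have hF : ∀ p ∈ N'.primeFactors \ N.primeFactors, p.Prime ∧ ¬ p ∣ N := by
    intro p hp
    rw [Finset.mem_sdiff, Nat.mem_primeFactors, Nat.mem_primeFactors] at hp
    exact ⟨hp.1.1, fun h => hp.2 ⟨hp.1.1, h, hN0⟩⟩
  -- At such a prime P, the condition y + c i N s ∈ P confines s to one class modulo P ∩ ℤ, because
  -- c i and N are units there.
  obtain ⟨s, hs⟩ := exists_forall_of_isCoprime (R := ℤ) (M := ℤ)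
    (N'.primeFactors \ N.primeFactors)
    (fun p => Ideal.span {(p : ℤ)}) (hcop _ fun p hp => (hF p hp).1)
    (fun p s => ∀ P : Ideal (𝓞 K), P.IsPrime → (p : 𝓞 K) ∈ P →
      s ∉ {s : ℤ | y + c i * (N * s) ∈ P})
    (fun p _ s u a ha hS P hP hpP h => hS P hP hpP (by
      have h1 : y + c i * (N * ((s + a • u : ℤ) : 𝓞 K)) =
          y + c i * (N * s) + a * (c i * N * u) := by
        push_cast [smul_eq_mul]
        ring
      change y + c i * (N * ((s + a • u : ℤ) : 𝓞 K)) ∈ P at h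
      exact (P.add_mem_iff_left (P.mul_mem_right _ (hdvd ha hpP))).1 (h1 ▸ h)))
    (fun p hp => exists_forall_prime_notMem hK (hF p hp).1
      (fun P => {s : ℤ | y + c i * (N * s) ∈ P}) fun P hP hpP => by
        have hNP : (N : 𝓞 K) ∉ P := fun h => by
          have hc : IsCoprime (p : ℤ) (N : ℤ) := Nat.isCoprime_iff_coprime.2
            (((hF p hp).1.coprime_iff_not_dvd).2 (hF p hp).2)
          obtain ⟨a, b, hab⟩ := hc
          refine hP.ne_top ((Ideal.eq_top_iff_one _).2 ?_)
          have : (1 : 𝓞 K) = a * (p : 𝓞 K) + b * (N : 𝓞 K) := by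
            exact_mod_cast congrArg (Int.cast : ℤ → 𝓞 K) hab.symm
          rw [this]
          exact P.add_mem (P.mul_mem_left _ hpP) (P.mul_mem_left _ h)
        have h2P : (2 : 𝓞 K) ∉ P := fun h => hNP (by
          rw [hN]
          push_cast
          exact P.mul_mem_right _ h)
        have hcP : c i ∉ P := fun h => hNP (by
          rw [hN]
          push_cast
          exact P.mul_mem_left _ ((Ideal.span_singleton_le_iff_mem _).2 h
            (Ideal.absNorm_mem (Ideal.span {c i}))))
        have hcNP : ∀ a : ℤ, c i * (N * a) ∈ P → (a : 𝓞 K) ∈ P := fun a h =>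
          (hP.mem_or_mem ((hP.mem_or_mem h).resolve_left hcP)).resolve_left hNP
        refine ⟨(P.comap (algebraMap ℤ (𝓞 K))).toAddSubgroup, fun g hg g' hg' => ?_, 2, 1,
          fun h => h2P ?_, fun h => hP.ne_top ((Ideal.eq_top_iff_one _).2 ?_),
          fun h => hP.ne_top ((Ideal.eq_top_iff_one _).2 ?_)⟩
        · refine hcNP _ ?_
          have := P.sub_mem hg hg'
          have h1 : c i * (N * ((g - g' : ℤ) : 𝓞 K)) =
              (y + c i * (N * g)) - (y + c i * (N * g')) := by
            push_cast
            ring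
          rw [h1]
          exact this
        · simpa using (show algebraMap ℤ (𝓞 K) 2 ∈ P from h)
        · simpa using (show algebraMap ℤ (𝓞 K) 1 ∈ P from h)
        · simpa using (show algebraMap ℤ (𝓞 K) (2 - 1) ∈ P from h))
  refine ⟨S₀ + (N * t : ℤ) • symmUnit i j + (N * s : ℤ) • diagUnit i, ?_⟩
  set S : symmInt n := S₀ + (N * t : ℤ) • symmUnit i j + (N * s : ℤ) • diagUnit i with hS
  have hrow : ∀ k, (d + rowMap c S) k = d k + rowMap c S₀ k +
      (N : 𝓞 K) * (t * (Pi.single (M := fun _ => 𝓞 K) j (c i) k +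
        Pi.single (M := fun _ => 𝓞 K) i (c j) k) +
        s * Pi.single (M := fun _ => 𝓞 K) i (c i) k) := by
    intro k
    rw [hS, map_add, map_add, map_zsmul, map_zsmul, rowMap_diagUnit, rowMap_symmUnit]
    simp only [Pi.add_apply, Pi.smul_apply]
    simp only [zsmul_eq_mul]
    push_cast
    ring
  have hj : (d + rowMap c S) j = x := by
    rw [hrow, hx]
    simp [hij.symm]
    ring
  have hi : (d + rowMap c S) i = y + c i * (N * s) := by
    rw [hrow, hy]
    simp [hij]
    ring
  rw [span_range_eq_top_iff]
  intro P hP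
  by_contra! hcon
  have hxP : x ∈ P := hj ▸ hcon j
  obtain ⟨p, hp, hpN, hpP⟩ := exists_prime_dvd_of_natCast_mem hP.isPrime hN'0
    ((Ideal.span_singleton_le_iff_mem _).2 hxP (Ideal.absNorm_mem (Ideal.span {x})))
  by_cases hpF : p ∈ N.primeFactors
  · refine hS₀ p hpF P hP.isPrime hpP fun k => ?_
    have hNP : (N : 𝓞 K) ∈ P := by
      obtain ⟨b, hb⟩ := Nat.dvd_of_mem_primeFactors hpF
      rw [hb]
      push_cast
      exact P.mul_mem_right _ hpP
    have h1 := hcon k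
    rw [hrow] at h1
    exact (P.add_mem_iff_left (P.mul_mem_right _ hNP)).1 h1
  · refine hs p (Finset.mem_sdiff.2 ⟨Nat.mem_primeFactors.2 ⟨hp, hpN, hN'0⟩, hpF⟩) P hP.isPrime
      hpP ?_
    change y + c i * (N * s) ∈ P
    rw [← hi]
    exact hcon i

end Rows
end HermitianTheta
end

noncomputable section
namespace HermitianTheta

/-! ### Unimodular rows over a Dedekind domain. -/

section SpecialLinear

variable {n : ℕ} {R : Type*} [CommRing R]

theorem det_one_add_vecMulVec (w v : Fin n → R) (h : v ⬝ᵥ w = 0) :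
    (1 + Matrix.vecMulVec w v).det = 1 := by
  rw [Matrix.vecMulVec_eq Unit, Matrix.det_one_add_replicateCol_mul_replicateRow, h, add_zero]

/-- Two rows in the same orbit of `SL_n(R)`. -/
def SLEquiv (x y : Fin n → R) : Prop :=
  ∃ U : Matrix (Fin n) (Fin n) R, U.det = 1 ∧ Matrix.vecMul x U = y

theorem SLEquiv.trans {x y z : Fin n → R} (h : SLEquiv x y) (h' : SLEquiv y z) : SLEquiv x z := by
  obtain ⟨U, hU, rfl⟩ := h
  obtain ⟨V, hV, rfl⟩ := h'
  exact ⟨U * V, by rw [Matrix.det_mul, hU, hV, one_mul], by rw [Matrix.vecMul_vecMul]⟩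

/-- The transvection 1 + wv has determinant 1 because v·w = 0, and it sends x to x + (x·w)v.
Choosing w and v realises every row operation below. -/
theorem slEquiv_add_smul (x w v : Fin n → R) (h : v ⬝ᵥ w = 0) :
    SLEquiv x (x + (x ⬝ᵥ w) • v) :=
  ⟨_, det_one_add_vecMulVec w v h, by
    rw [Matrix.vecMul_add, Matrix.vecMul_one, Matrix.vecMul_vecMulVec]⟩

theorem SLEquiv.span_eq_top {x y : Fin n → R} (h : SLEquiv x y)
    (hx : Ideal.span (Set.range x) = ⊤) : Ideal.span (Set.range y) = ⊤ := by
  obtain ⟨U, hU, rfl⟩ := h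
  have hun : IsUnit U.det := hU ▸ isUnit_one
  refine top_le_iff.1 (hx ▸ Ideal.span_le.2 ?_)
  rintro _ ⟨k, rfl⟩
  have h1 : x = Matrix.vecMul (Matrix.vecMul x U) U⁻¹ := by
    rw [Matrix.vecMul_vecMul, Matrix.mul_nonsing_inv _ hun, Matrix.vecMul_one]
  have h2 : x k = ∑ i, Matrix.vecMul x U i * U⁻¹ i k := congrFun h1 k
  rw [h2]
  exact Ideal.sum_mem _ fun i _ => Ideal.mul_mem_right _ _ (Ideal.subset_span ⟨i, rfl⟩)

variable [IsDedekindDomain R]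

/-- The special linear group over a Dedekind domain is transitive on unimodular rows. -/
theorem slEquiv_single_of_span_eq_top (x : Fin (n + 2) → R)
    (hx : Ideal.span (Set.range x) = ⊤) : SLEquiv x (Pi.single 0 1) := by
  classical
  match n, x, hx with
  | 0, x, hx =>
    have h1 : (1 : R) ∈ Ideal.span (Set.range x) := hx ▸ Submodule.mem_top
    obtain ⟨c, hc⟩ := Ideal.mem_span_range_iff_exists_fun.1 h1
    rw [Fin.sum_univ_two] at hc
    refine ⟨!![c 0, -x 1; c 1, x 0], ?_, ?_⟩
    · rw [Matrix.det_fin_two_of]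
      linear_combination hc
    · funext k
      fin_cases k
      · simp [Matrix.vecMul, dotProduct, Fin.sum_univ_two]
        linear_combination hc
      · simp [Matrix.vecMul, dotProduct, Fin.sum_univ_two]
        ring
  | n + 1, x, hx =>
    -- make the first entry nonzero
    obtain ⟨y, hxy, hy0⟩ : ∃ y, SLEquiv x y ∧ y 0 ≠ 0 := by
      by_cases h0 : x 0 = 0
      · obtain ⟨k, hk⟩ : ∃ k, x k ≠ 0 := by
          by_contra! h
          have hx0 : Ideal.span (Set.range x) ≤ ⊥ := Ideal.span_le.2 (by
            rintro _ ⟨k, rfl⟩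
            exact h k)
          rw [hx] at hx0
          exact top_ne_bot (le_bot_iff.1 hx0)
        have hk0 : k ≠ 0 := fun h => hk (h ▸ h0)
        refine ⟨_, slEquiv_add_smul x (Pi.single k 1) (Pi.single 0 1) ?_, ?_⟩
        · simp [hk0]
        · simpa [h0] using hk
      · exact ⟨x, ⟨1, Matrix.det_one, Matrix.vecMul_one x⟩, h0⟩
    have hy := hxy.span_eq_top hx
    refine hxy.trans ?_
    clear hxy hx x
    -- make the first two entries coprime
    obtain ⟨z, hyz, a, b, hab⟩ : ∃ z, SLEquiv y z ∧ ∃ a b, a * z 0 + b * z 1 = 1 := by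
      have hfin : {v : IsDedekindDomain.HeightOneSpectrum R |
          v.asIdeal ∣ Ideal.span {y 0}}.Finite := Ideal.finite_factors (by
        rw [Ne, Ideal.zero_eq_bot, Ideal.span_singleton_eq_bot]
        exact hy0)
      -- Finitely many primes contain y 0. Modulo each of them some other entry is nonzero, so
      -- adding a combination of the entries beyond the first two moves y 1 out of all of them.
      obtain ⟨t, ht⟩ := exists_forall_of_isCoprime (R := R) (M := Fin (n + 1 + 2) → R) hfin.toFinset
        (fun v => v.asIdeal)
        (fun v _ w _ hvw => by
          have := v.isMaximal
          have := w.isMaximal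
          exact Ideal.isCoprime_of_isMaximal fun h =>
            hvw (IsDedekindDomain.HeightOneSpectrum.ext h))
        (fun v t => y 1 + ∑ k, (if k = 0 ∨ k = 1 then 0 else y k * t k) ∉ v.asIdeal)
        (fun v _ g h a ha hg hgh => hg (by
          have h1 : y 1 + ∑ k, (if k = 0 ∨ k = 1 then 0 else y k * (g + a • h) k) =
              (y 1 + ∑ k, (if k = 0 ∨ k = 1 then 0 else y k * g k)) +
              a * ∑ k, (if k = 0 ∨ k = 1 then 0 else y k * h k) := by
            rw [Finset.mul_sum, add_assoc (y 1), ← Finset.sum_add_distrib]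
            congr 1
            refine Finset.sum_congr rfl fun k _ => ?_
            split_ifs
            · simp
            · simp only [Pi.add_apply, Pi.smul_apply, smul_eq_mul]
              ring
          rw [h1] at hgh
          exact (v.asIdeal.add_mem_iff_left (v.asIdeal.mul_mem_right _ ha)).1 hgh))
        (fun v hv => by
          by_cases h1 : y 1 ∈ v.asIdeal
          · obtain ⟨k, hk⟩ := (span_range_eq_top_iff y).1 hy v.asIdeal v.isMaximal
            have hk0 : k ≠ 0 := by
              rintro rfl
              exact hk (Ideal.dvd_span_singleton.1 (hfin.mem_toFinset.1 hv))
            have hk1 : k ≠ 1 := by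
              rintro rfl
              exact hk h1
            refine ⟨Pi.single k 1, fun h => hk ?_⟩
            rw [Finset.sum_eq_single k] at h
            · simpa [hk0, hk1] using (v.asIdeal.add_mem_iff_right h1).1 h
            · intro l _ hl
              simp [hl]
            · simp
          · exact ⟨0, by simpa using h1⟩)
      set w : Fin (n + 1 + 2) → R := fun k => if k = 0 ∨ k = 1 then 0 else t k with hw
      refine ⟨_, slEquiv_add_smul y w (Pi.single 1 1) (by simp [hw]), ?_⟩
      set z := y + (y ⬝ᵥ w) • (Pi.single 1 1 : Fin (n + 1 + 2) → R) with hz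
      have hz0 : z 0 = y 0 := by simp [hz]
      have hz1 : z 1 = y 1 + ∑ k, (if k = 0 ∨ k = 1 then 0 else y k * t k) := by
        simp [hz, hw, dotProduct]
      by_contra! hcon
      have hne : Ideal.span {z 0, z 1} ≠ ⊤ := fun h => by
        obtain ⟨a, b, hab⟩ := Ideal.mem_span_pair.1 ((Ideal.eq_top_iff_one _).1 h)
        exact hcon a b hab
      obtain ⟨P, hP, hle⟩ := Ideal.exists_le_maximal _ hne
      have h0 : y 0 ∈ P := hz0 ▸ hle (Ideal.subset_span (by simp))
      have h1 : z 1 ∈ P := hle (Ideal.subset_span (by simp))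
      have hPbot : P ≠ ⊥ := by
        rintro rfl
        exact hy0 h0
      refine ht ⟨P, hP.isPrime, hPbot⟩ (hfin.mem_toFinset.2 ?_) (hz1 ▸ h1)
      exact Ideal.dvd_span_singleton.2 h0
    refine hyz.trans ?_
    clear hyz hy hy0 y
    have h02 : (0 : Fin (n + 1 + 2)) ≠ 2 := by
      simp [Fin.ext_iff, Nat.mod_eq_of_lt (show 2 < n + 1 + 2 by omega)]
    have h12 : (1 : Fin (n + 1 + 2)) ≠ 2 := by
      simp [Fin.ext_iff, Nat.mod_eq_of_lt (show 2 < n + 1 + 2 by omega)]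
    -- make the third entry one
    obtain ⟨u, hzu, hu⟩ : ∃ u, SLEquiv z u ∧ u 2 = 1 := by
      refine ⟨_, slEquiv_add_smul z (Pi.single 0 ((1 - z 2) * a) + Pi.single 1 ((1 - z 2) * b))
        (Pi.single 2 1) (by simp [h02, h12]), ?_⟩
      simp
      linear_combination (1 - z 2) * hab
    refine hzu.trans ?_
    -- With third entry 1, one transvection gives every other entry its value in the target row; the
    -- first entry is then 1, and a second transvection clears the third.
    refine (slEquiv_add_smul u (Pi.single 2 1)
      (fun k => if k = 2 then 0 else (Pi.single 0 1 : Fin (n + 1 + 2) → R) k - u k)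
      (by simp)).trans ?_
    convert slEquiv_add_smul _ (Pi.single 0 1) (-Pi.single 2 1 : Fin (n + 1 + 2) → R)
      (by simp [h02.symm]) using 1
    funext k
    rcases eq_or_ne k 2 with rfl | hk
    · simp [hu, h02, h02.symm]
    · simp [hu, hk, h02]

end SpecialLinear
end HermitianTheta
end

noncomputable section
namespace HermitianTheta

/-! ### The embedding from degree n to degree n + 1. -/

section Pad

open Matrix

variable {n : ℕ} {R : Type*} [CommRing R]

/-- The block matrix `diag(x, A)`. -/
def pad (x : R) (A : Matrix (Fin n) (Fin n) R) : Matrix (Fin (n + 1)) (Fin (n + 1)) R :=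
  Matrix.of (Fin.cons (Fin.cons x 0) fun i => Fin.cons 0 (A i))

@[simp] theorem pad_zero_zero (x : R) (A : Matrix (Fin n) (Fin n) R) : pad x A 0 0 = x := rfl

@[simp] theorem pad_zero_succ (x : R) (A : Matrix (Fin n) (Fin n) R) (j : Fin n) :
    pad x A 0 j.succ = 0 := rfl

@[simp] theorem pad_succ_zero (x : R) (A : Matrix (Fin n) (Fin n) R) (i : Fin n) :
    pad x A i.succ 0 = 0 := rfl

@[simp] theorem pad_succ_succ (x : R) (A : Matrix (Fin n) (Fin n) R) (i j : Fin n) :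
    pad x A i.succ j.succ = A i j := rfl

theorem pad_mul (x y : R) (A B : Matrix (Fin n) (Fin n) R) :
    pad x A * pad y B = pad (x * y) (A * B) := by
  ext i j
  refine Fin.cases ?_ (fun i => ?_) i <;> refine Fin.cases ?_ (fun j => ?_) j <;>
    simp [Matrix.mul_apply, Fin.sum_univ_succ]

theorem pad_add (x y : R) (A B : Matrix (Fin n) (Fin n) R) :
    pad x A + pad y B = pad (x + y) (A + B) := by
  ext i j
  refine Fin.cases ?_ (fun i => ?_) i <;> refine Fin.cases ?_ (fun j => ?_) j <;> simp

theorem pad_sub (x y : R) (A B : Matrix (Fin n) (Fin n) R) :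
    pad x A - pad y B = pad (x - y) (A - B) := by
  ext i j
  refine Fin.cases ?_ (fun i => ?_) i <;> refine Fin.cases ?_ (fun j => ?_) j <;> simp

theorem pad_one : pad 1 (1 : Matrix (Fin n) (Fin n) R) = 1 := by
  ext i j
  refine Fin.cases ?_ (fun i => ?_) i <;> refine Fin.cases ?_ (fun j => ?_) j <;>
    simp [Matrix.one_apply, Fin.succ_ne_zero, (Fin.succ_ne_zero _).symm]

theorem pad_zero : pad 0 (0 : Matrix (Fin n) (Fin n) R) = 0 := by
  ext i j
  refine Fin.cases ?_ (fun i => ?_) i <;> refine Fin.cases ?_ (fun j => ?_) j <;> simp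

theorem pad_inj {x y : R} {A B : Matrix (Fin n) (Fin n) R} (h : pad x A = pad y B) : A = B := by
  ext i j
  simpa using congrFun (congrFun h i.succ) j.succ

theorem eq_pad {A : Matrix (Fin (n + 1)) (Fin (n + 1)) R} {x : R} (h00 : A 0 0 = x)
    (h0 : ∀ j : Fin n, A 0 j.succ = 0) (h1 : ∀ i : Fin n, A i.succ 0 = 0) :
    A = pad x (A.submatrix Fin.succ Fin.succ) := by
  ext i j
  refine Fin.cases ?_ (fun i => ?_) i <;> refine Fin.cases ?_ (fun j => ?_) j <;> simp [*]

theorem det_pad (x : R) (A : Matrix (Fin n) (Fin n) R) : (pad x A).det = x * A.det := by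
  rw [det_succ_row_zero, Fin.sum_univ_succ]
  have : (pad x A).submatrix Fin.succ Fin.succ = A := by
    ext i j
    simp
  simp [this]

/-- The embedding of the unitary group of degree `n` into the one of degree `n + 1`. -/
def embed (M : Matrix (Fin n ⊕ Fin n) (Fin n ⊕ Fin n) R) :
    Matrix (Fin (n + 1) ⊕ Fin (n + 1)) (Fin (n + 1) ⊕ Fin (n + 1)) R :=
  fromBlocks (pad 1 M.toBlocks₁₁) (pad 0 M.toBlocks₁₂) (pad 0 M.toBlocks₂₁) (pad 1 M.toBlocks₂₂)

theorem embed_fromBlocks (A B C D : Matrix (Fin n) (Fin n) R) :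
    embed (fromBlocks A B C D) = fromBlocks (pad 1 A) (pad 0 B) (pad 0 C) (pad 1 D) := rfl

theorem embed_mul (M N : Matrix (Fin n ⊕ Fin n) (Fin n ⊕ Fin n) R) :
    embed (M * N) = embed M * embed N := by
  obtain ⟨A, B, C, D, rfl⟩ : ∃ A B C D, M = fromBlocks A B C D :=
    ⟨_, _, _, _, (fromBlocks_toBlocks M).symm⟩
  obtain ⟨A', B', C', D', rfl⟩ : ∃ A B C D, N = fromBlocks A B C D :=
    ⟨_, _, _, _, (fromBlocks_toBlocks N).symm⟩
  rw [fromBlocks_multiply, embed_fromBlocks, embed_fromBlocks, embed_fromBlocks,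
    fromBlocks_multiply]
  simp only [pad_mul, pad_add]
  simp

/-- Collecting the two new indices in front turns the embedded matrix into diag(1, M). -/
theorem det_embed (M : Matrix (Fin n ⊕ Fin n) (Fin n ⊕ Fin n) R) : (embed M).det = M.det := by
  let f : Unit ⊕ Fin n ≃ Fin (n + 1) := Equiv.ofBijective (Sum.elim (fun _ => 0) Fin.succ) <| by
    constructor
    · rintro (i | i) (j | j) h
      · rfl
      · exact absurd h (Fin.succ_ne_zero j).symm
      · exact absurd h (Fin.succ_ne_zero i)
      · exact congrArg Sum.inr (Fin.succ_injective _ h)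
    · intro i
      refine Fin.cases ⟨Sum.inl (), rfl⟩ (fun i => ⟨Sum.inr i, rfl⟩) i
  let e : (Unit ⊕ Unit) ⊕ (Fin n ⊕ Fin n) ≃ Fin (n + 1) ⊕ Fin (n + 1) :=
    (Equiv.sumSumSumComm Unit Unit (Fin n) (Fin n)).trans (Equiv.sumCongr f f)
  rw [← det_submatrix_equiv_self e]
  have : (embed M).submatrix e e = fromBlocks 1 0 0 M := by
    ext i j
    rcases i with (i | i) | (i | i) <;> rcases j with (j | j) | (j | j) <;> rfl
  rw [this, det_fromBlocks_zero₂₁, det_one, one_mul]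

theorem single_mul_sum (f : Fin (n + 1) → R) :
    ∑ k, (Pi.single (M := fun _ => R) 0 1 k) * f k = f 0 := by
  rw [Finset.sum_eq_single 0]
  · simp
  · intro k _ hk
    simp [hk]
  · simp

theorem mul_apply_of_row {A : Matrix (Fin (n + 1)) (Fin (n + 1)) R} (hA : A 0 = Pi.single 0 1)
    (B : Matrix (Fin (n + 1)) (Fin (n + 1)) R) (j : Fin (n + 1)) : (A * B) 0 j = B 0 j := by
  rw [mul_apply, hA, single_mul_sum fun k => B k j]

theorem mul_apply_of_row_zero {A : Matrix (Fin (n + 1)) (Fin (n + 1)) R} (hA : A 0 = 0)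
    (B : Matrix (Fin (n + 1)) (Fin (n + 1)) R) (j : Fin (n + 1)) : (A * B) 0 j = 0 := by
  rw [mul_apply, hA]
  simp

end Pad

/-! ### Generating the unitary group by unipotent and Levi matrices. -/

section UnitaryGroup

open Matrix

variable {n : ℕ} {R : Type*} [CommRing R] [StarRing R]

/-- The special unitary group of the standard skew-Hermitian form over `R`. -/
def specialUnitaryOver (n : ℕ) (R : Type*) [CommRing R] [StarRing R] :
    Submonoid (Matrix (Fin n ⊕ Fin n) (Fin n ⊕ Fin n) R) where
  carrier := {M | M.det = 1 ∧ Mᴴ * J (Fin n) R * M = J (Fin n) R}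
  one_mem' := ⟨det_one, by simp⟩
  mul_mem' := by
    rintro M N ⟨hM, hM'⟩ ⟨hN, hN'⟩
    refine ⟨by rw [det_mul, hM, hN, one_mul], ?_⟩
    calc (M * N)ᴴ * J (Fin n) R * (M * N) = Nᴴ * (Mᴴ * J (Fin n) R * M) * N := by
          rw [conjTranspose_mul]
          simp only [Matrix.mul_assoc]
      _ = J (Fin n) R := by rw [hM', hN']

theorem fromBlocks_form_iff {A B C D : Matrix (Fin n) (Fin n) R} :
    (fromBlocks A B C D)ᴴ * J (Fin n) R * fromBlocks A B C D = J (Fin n) R ↔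
      Aᴴ * C = Cᴴ * A ∧ Bᴴ * D = Dᴴ * B ∧ Aᴴ * D - Cᴴ * B = 1 := by
  rw [J, fromBlocks_conjTranspose, fromBlocks_multiply, fromBlocks_multiply, fromBlocks_inj]
  simp only [Matrix.mul_zero, Matrix.mul_one, Matrix.mul_neg, zero_add, add_zero, Matrix.neg_mul]
  constructor
  · rintro ⟨h1, h2, h3, h4⟩
    refine ⟨(add_neg_eq_zero.1 h1).symm, (add_neg_eq_zero.1 h4).symm, ?_⟩
    rw [← neg_inj, ← h2]
    abel
  · rintro ⟨h1, h2, h3⟩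
    refine ⟨by rw [h1]; abel, by rw [← h3]; abel, ?_, by rw [h2]; abel⟩
    have := congrArg conjTranspose h3
    rw [conjTranspose_sub, conjTranspose_mul, conjTranspose_mul, conjTranspose_conjTranspose,
      conjTranspose_conjTranspose, conjTranspose_one] at this
    rw [← this]
    abel

/-- The column relations exhibit a left inverse; for square matrices over a commutative ring it is
also a right inverse, which gives the row relations. -/
theorem fromBlocks_form_adjoint {A B C D : Matrix (Fin n) (Fin n) R}
    (h : (fromBlocks A B C D)ᴴ * J (Fin n) R * fromBlocks A B C D = J (Fin n) R) :
    A * Bᴴ = B * Aᴴ ∧ C * Dᴴ = D * Cᴴ ∧ A * Dᴴ - B * Cᴴ = 1 := by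
  obtain ⟨h1, h2, h3⟩ := fromBlocks_form_iff.1 h
  have h3' : Dᴴ * A - Bᴴ * C = 1 := by
    have := congrArg conjTranspose h3
    rwa [conjTranspose_sub, conjTranspose_mul, conjTranspose_mul, conjTranspose_conjTranspose,
      conjTranspose_conjTranspose, conjTranspose_one] at this
  have h4 : fromBlocks Dᴴ (-Bᴴ) (-Cᴴ) Aᴴ * fromBlocks A B C D = 1 := by
    rw [fromBlocks_multiply, ← fromBlocks_one, fromBlocks_inj]
    simp only [Matrix.neg_mul]
    refine ⟨?_, ?_, ?_, ?_⟩
    · rw [← h3']; abel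
    · rw [h2]; abel
    · rw [h1]; abel
    · rw [← h3]; abel
  rw [mul_eq_one_comm, fromBlocks_multiply, ← fromBlocks_one, fromBlocks_inj] at h4
  simp only [Matrix.mul_neg] at h4
  obtain ⟨h5, h6, h7, -⟩ := h4
  refine ⟨?_, ?_, ?_⟩
  · rw [neg_add_eq_zero] at h6
    exact h6
  · rw [← sub_eq_add_neg, sub_eq_zero] at h7
    exact h7
  · rw [← h5]; abel

/-- The unipotent and Levi generators. -/
def unitaryGenerators (n : ℕ) (R : Type*) [CommRing R] [StarRing R] :
    Set (Matrix (Fin n ⊕ Fin n) (Fin n ⊕ Fin n) R) :=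
  {M | (∃ S : Matrix (Fin n) (Fin n) R, S.IsHermitian ∧ M = fromBlocks 1 S 0 1) ∨
    (∃ S : Matrix (Fin n) (Fin n) R, S.IsHermitian ∧ M = fromBlocks 1 0 S 1) ∨
    ∃ U V : Matrix (Fin n) (Fin n) R, U.det = 1 ∧ Uᴴ * V = 1 ∧ M = fromBlocks U 0 0 V}

/-- The monoid generated by the unipotent and Levi matrices. -/
def generatedMonoid (n : ℕ) (R : Type*) [CommRing R] [StarRing R] :
    Submonoid (Matrix (Fin n ⊕ Fin n) (Fin n ⊕ Fin n) R) :=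
  Submonoid.closure (unitaryGenerators n R)

theorem upper_mem_generatedMonoid {S : Matrix (Fin n) (Fin n) R} (hS : S.IsHermitian) :
    fromBlocks 1 S 0 1 ∈ generatedMonoid n R :=
  Submonoid.subset_closure (Or.inl ⟨S, hS, rfl⟩)

theorem lower_mem_generatedMonoid {S : Matrix (Fin n) (Fin n) R} (hS : S.IsHermitian) :
    fromBlocks 1 0 S 1 ∈ generatedMonoid n R :=
  Submonoid.subset_closure (Or.inr (Or.inl ⟨S, hS, rfl⟩))

theorem levi_mem_generatedMonoid {U V : Matrix (Fin n) (Fin n) R} (hU : U.det = 1)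
    (hUV : Uᴴ * V = 1) : fromBlocks U 0 0 V ∈ generatedMonoid n R :=
  Submonoid.subset_closure (Or.inr (Or.inr ⟨U, V, hU, hUV, rfl⟩))

theorem det_eq_one_of_conjTranspose_mul {U V : Matrix (Fin n) (Fin n) R} (hU : U.det = 1)
    (hUV : Uᴴ * V = 1) : V.det = 1 := by
  have := congrArg det hUV
  rwa [det_mul, det_conjTranspose, hU, star_one, one_mul, det_one] at this

theorem generatedMonoid_le : generatedMonoid n R ≤ specialUnitaryOver n R := by
  refine Submonoid.closure_le.2 ?_
  rintro _ (⟨S, hS, rfl⟩ | ⟨S, hS, rfl⟩ | ⟨U, V, hU, hUV, rfl⟩)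
  · refine ⟨by simp, fromBlocks_form_iff.2 ⟨by simp, ?_, by simp⟩⟩
    rw [hS.eq]; simp
  · refine ⟨by simp, fromBlocks_form_iff.2 ⟨?_, by simp, by simp⟩⟩
    rw [hS.eq]; simp
  · refine ⟨by rw [det_fromBlocks_zero₂₁, hU, det_eq_one_of_conjTranspose_mul hU hUV, one_mul],
      fromBlocks_form_iff.2 ⟨by simp, by simp, by simp [hUV]⟩⟩

/-- The generating set is closed under inverses, so the monoid is a group and factors from it may be
cancelled. -/
theorem exists_mul_eq_one_of_mem_generatedMonoid
    {M : Matrix (Fin n ⊕ Fin n) (Fin n ⊕ Fin n) R} (hM : M ∈ generatedMonoid n R) :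
    ∃ N ∈ generatedMonoid n R, M * N = 1 := by
  induction hM using Submonoid.closure_induction with
  | mem M hM =>
    obtain ⟨S, hS, rfl⟩ | ⟨S, hS, rfl⟩ | ⟨U, V, hU, hUV, rfl⟩ := hM
    · exact ⟨_, upper_mem_generatedMonoid hS.neg, by simp [fromBlocks_multiply]⟩
    · exact ⟨_, lower_mem_generatedMonoid hS.neg, by simp [fromBlocks_multiply]⟩
    · have h1 : V * Uᴴ = 1 := mul_eq_one_comm.1 hUV
      have h2 : U * Vᴴ = 1 := by
        have := congrArg conjTranspose h1
        rwa [conjTranspose_mul, conjTranspose_conjTranspose, conjTranspose_one] at this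
      refine ⟨_, levi_mem_generatedMonoid (U := Vᴴ) (V := Uᴴ) ?_ ?_, ?_⟩
      · rw [det_conjTranspose, det_eq_one_of_conjTranspose_mul hU hUV, star_one]
      · rw [conjTranspose_conjTranspose, h1]
      · simp [fromBlocks_multiply, h1, h2]
  | one => exact ⟨1, one_mem _, one_mul 1⟩
  | mul M N _ _ ihM ihN =>
    obtain ⟨M', hM', h1⟩ := ihM
    obtain ⟨N', hN', h2⟩ := ihN
    refine ⟨N' * M', mul_mem hN' hM', ?_⟩
    rw [Matrix.mul_assoc, ← Matrix.mul_assoc N, h2, Matrix.one_mul, h1]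

theorem mem_of_mul_mem_right {M g : Matrix (Fin n ⊕ Fin n) (Fin n ⊕ Fin n) R}
    (hg : g ∈ generatedMonoid n R) (h : M * g ∈ generatedMonoid n R) :
    M ∈ generatedMonoid n R := by
  obtain ⟨g', hg', h1⟩ := exists_mul_eq_one_of_mem_generatedMonoid hg
  have := mul_mem h hg'
  rwa [Matrix.mul_assoc, h1, Matrix.mul_one] at this

theorem mem_of_mul_mem_left {M g : Matrix (Fin n ⊕ Fin n) (Fin n ⊕ Fin n) R}
    (hg : g ∈ generatedMonoid n R) (h : g * M ∈ generatedMonoid n R) :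
    M ∈ generatedMonoid n R := by
  obtain ⟨g', hg', h1⟩ := exists_mul_eq_one_of_mem_generatedMonoid hg
  have := mul_mem hg' h
  rwa [← Matrix.mul_assoc, mul_eq_one_comm.1 h1, Matrix.one_mul] at this

theorem J_mem_generatedMonoid : J (Fin n) R ∈ generatedMonoid n R := by
  have h1 : (1 : Matrix (Fin n) (Fin n) R).IsHermitian := isHermitian_one
  have : J (Fin n) R = fromBlocks 1 (-1) 0 1 * fromBlocks 1 0 1 1 * fromBlocks 1 (-1) 0 1 := by
    simp [J, fromBlocks_multiply]
  rw [this]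
  exact mul_mem (mul_mem (upper_mem_generatedMonoid h1.neg) (lower_mem_generatedMonoid h1))
    (upper_mem_generatedMonoid h1.neg)

theorem conjTranspose_pad (x : R) (A : Matrix (Fin n) (Fin n) R) :
    (pad x A)ᴴ = pad (star x) Aᴴ := by
  ext i j
  refine Fin.cases ?_ (fun i => ?_) i <;> refine Fin.cases ?_ (fun j => ?_) j <;> simp

theorem embed_mem_generatedMonoid {M : Matrix (Fin n ⊕ Fin n) (Fin n ⊕ Fin n) R}
    (hM : M ∈ generatedMonoid n R) : embed M ∈ generatedMonoid (n + 1) R := by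
  induction hM using Submonoid.closure_induction with
  | mem M hM =>
    obtain ⟨S, hS, rfl⟩ | ⟨S, hS, rfl⟩ | ⟨U, V, hU, hUV, rfl⟩ := hM
    · rw [embed_fromBlocks, pad_one, pad_zero]
      refine upper_mem_generatedMonoid ?_
      rw [IsHermitian, conjTranspose_pad, hS.eq, star_zero]
    · rw [embed_fromBlocks, pad_one, pad_zero]
      refine lower_mem_generatedMonoid ?_
      rw [IsHermitian, conjTranspose_pad, hS.eq, star_zero]
    · rw [embed_fromBlocks, pad_zero]
      refine levi_mem_generatedMonoid (by rw [det_pad, hU, one_mul]) ?_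
      rw [conjTranspose_pad, pad_mul, hUV, star_one, one_mul, pad_one]
  | one =>
    rw [← fromBlocks_one, embed_fromBlocks, pad_one, pad_zero, fromBlocks_one]
    exact one_mem _
  | mul M N _ _ ihM ihN =>
    rw [embed_mul]
    exact mul_mem ihM ihN

theorem mem_specialUnitaryOver_of_embed {M : Matrix (Fin n ⊕ Fin n) (Fin n ⊕ Fin n) R}
    (h : embed M ∈ specialUnitaryOver (n + 1) R) : M ∈ specialUnitaryOver n R := by
  obtain ⟨A, B, C, D, rfl⟩ : ∃ A B C D, M = fromBlocks A B C D :=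
    ⟨_, _, _, _, (fromBlocks_toBlocks M).symm⟩
  obtain ⟨h1, h2⟩ := h
  rw [embed_fromBlocks, fromBlocks_form_iff] at h2
  simp only [conjTranspose_pad, pad_mul, pad_sub] at h2
  rw [← pad_one] at h2
  exact ⟨by rw [← det_embed, h1],
    fromBlocks_form_iff.2 ⟨pad_inj h2.1, pad_inj h2.2.1, pad_inj h2.2.2⟩⟩

/-- A Hermitian matrix with prescribed first column. -/
def hermitianOfCol (v : Fin (n + 1) → R) : Matrix (Fin (n + 1)) (Fin (n + 1)) R :=
  Matrix.of fun i j => if j = 0 then v i else if i = 0 then star (v j) else 0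

theorem isHermitian_hermitianOfCol {v : Fin (n + 1) → R} (hv : star (v 0) = v 0) :
    (hermitianOfCol v).IsHermitian := by
  ext i j
  rw [conjTranspose_apply, hermitianOfCol, of_apply, of_apply]
  by_cases hi : i = 0 <;> by_cases hj : j = 0 <;> simp [hi, hj, hv]

theorem hermitianOfCol_apply_zero (v : Fin (n + 1) → R) (i : Fin (n + 1)) :
    hermitianOfCol v i 0 = v i := by
  simp [hermitianOfCol]

theorem hermitianOfCol_zero_apply {v : Fin (n + 1) → R} (hv : star (v 0) = v 0)
    (j : Fin (n + 1)) : hermitianOfCol v 0 j = star (v j) := by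
  rcases eq_or_ne j 0 with rfl | hj
  · simp [hermitianOfCol, hv]
  · simp [hermitianOfCol, hj]

/-- Matrices whose first row and column in the upper left block are standard. -/
theorem mem_generatedMonoid_of_row_of_col
    (ih : ∀ M ∈ specialUnitaryOver n R, M ∈ generatedMonoid n R)
    {A B C D : Matrix (Fin (n + 1)) (Fin (n + 1)) R}
    (hM : fromBlocks A B C D ∈ specialUnitaryOver (n + 1) R)
    (hA : A 0 = Pi.single 0 1) (hB : B 0 = 0) (hA' : ∀ i, A i 0 = Pi.single (M := fun _ => R) 0 1 i) :
    fromBlocks A B C D ∈ generatedMonoid (n + 1) R := by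
  have hAc : Aᴴ 0 = Pi.single 0 1 := by
    funext k
    rw [conjTranspose_apply, hA' k]
    rcases eq_or_ne k 0 with rfl | hk
    · simp
    · simp [hk]
  have hC00 : star (C 0 0) = C 0 0 := by
    obtain ⟨h1, -, -⟩ := fromBlocks_form_iff.1 hM.2
    have h2 := congrFun (congrFun (congrArg conjTranspose h1) 0) 0
    rw [conjTranspose_apply, mul_apply_of_row hAc, conjTranspose_mul, conjTranspose_conjTranspose,
      mul_apply_of_row hAc] at h2
    exact h2
  -- A lower unipotent with first column -C i 0 clears the first column of C. It can be Hermitian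
  -- only because C 0 0 is self-adjoint, which follows from A*C = C*A.
  have hv : star ((fun i => -C i 0) 0) = (fun i => -C i 0) 0 := by simp [hC00]
  have hS := isHermitian_hermitianOfCol (v := fun i => -C i 0) hv
  refine mem_of_mul_mem_left (lower_mem_generatedMonoid hS) ?_
  have hM' := mul_mem (generatedMonoid_le (lower_mem_generatedMonoid hS)) hM
  rw [fromBlocks_multiply] at hM' ⊢
  simp only [Matrix.one_mul, Matrix.zero_mul, add_zero] at hM' ⊢
  set C' := hermitianOfCol (fun i => -C i 0) * A + C with hC'def
  set D' := hermitianOfCol (fun i => -C i 0) * B + D with hD'def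
  have hC' : ∀ i, C' i 0 = 0 := by
    intro i
    rw [hC'def, Matrix.add_apply, mul_apply]
    have : ∀ k, hermitianOfCol (fun i => -C i 0) i k * A k 0 =
        Pi.single (M := fun _ => R) 0 1 k * hermitianOfCol (fun i => -C i 0) i k := by
      intro k
      rw [hA', mul_comm]
    simp_rw [this]
    rw [single_mul_sum fun k => hermitianOfCol (fun i => -C i 0) i k, hermitianOfCol_apply_zero]
    simp
  -- The row and column relations now make the first row and column of all four blocks standard, so
  -- the matrix comes from degree n.
  obtain ⟨h1, h2, h3⟩ := fromBlocks_form_iff.1 hM'.2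
  obtain ⟨h4, h5, h6⟩ := fromBlocks_form_adjoint hM'.2
  have hCc : C'ᴴ 0 = 0 := by
    funext k
    rw [conjTranspose_apply, hC' k, star_zero, Pi.zero_apply]
  have hBcol : ∀ j, B j 0 = 0 := by
    intro j
    have := congrFun (congrFun h4 0) j
    rw [mul_apply_of_row hA, mul_apply_of_row_zero hB, conjTranspose_apply] at this
    exact star_eq_zero.1 this
  have hDcol : ∀ j, D' j 0 = (1 : Matrix (Fin (n + 1)) (Fin (n + 1)) R) j 0 := by
    intro j
    have := congrFun (congrFun h6 0) j
    rw [Matrix.sub_apply, mul_apply_of_row hA, mul_apply_of_row_zero hB, conjTranspose_apply,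
      sub_zero] at this
    rw [← star_star (D' j 0), this, ← conjTranspose_apply, conjTranspose_one]
  have hCrow : ∀ j, C' 0 j = 0 := by
    intro j
    have := congrFun (congrFun h1 0) j
    rwa [mul_apply_of_row hAc, mul_apply_of_row_zero hCc] at this
  have hDrow : ∀ j, D' 0 j = (1 : Matrix (Fin (n + 1)) (Fin (n + 1)) R) 0 j := by
    intro j
    have := congrFun (congrFun h3 0) j
    rwa [Matrix.sub_apply, mul_apply_of_row hAc, mul_apply_of_row_zero hCc, sub_zero] at this
  have hemb : fromBlocks A B C' D' = embed (fromBlocks (A.submatrix Fin.succ Fin.succ)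
      (B.submatrix Fin.succ Fin.succ) (C'.submatrix Fin.succ Fin.succ)
      (D'.submatrix Fin.succ Fin.succ)) := by
    rw [embed_fromBlocks, ← eq_pad, ← eq_pad, ← eq_pad, ← eq_pad]
    · rw [hDrow]; simp
    · intro j; rw [hDrow]; simp [(Fin.succ_ne_zero j).symm]
    · intro j; rw [hDcol]; simp [Fin.succ_ne_zero j]
    · rw [hCrow]
    · intro j; rw [hCrow]
    · intro j; rw [hC']
    · rw [hB]; rfl
    · intro j; rw [hB]; rfl
    · intro j; rw [hBcol]
    · rw [hA]; simp
    · intro j; rw [hA]; simp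
    · intro j; rw [hA']; simp
  rw [hemb] at hM' ⊢
  exact embed_mem_generatedMonoid (ih _ (mem_specialUnitaryOver_of_embed hM'))

theorem mem_generatedMonoid_of_row
    (ih : ∀ M ∈ specialUnitaryOver n R, M ∈ generatedMonoid n R)
    {A B C D : Matrix (Fin (n + 1)) (Fin (n + 1)) R}
    (hM : fromBlocks A B C D ∈ specialUnitaryOver (n + 1) R)
    (hA : A 0 = Pi.single 0 1) (hB : B 0 = 0) :
    fromBlocks A B C D ∈ generatedMonoid (n + 1) R := by
  set e : Fin (n + 1) → R := Pi.single 0 1 with he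
  set a : Fin (n + 1) → R := fun i => A i 0 - e i with ha
  have ha0 : a 0 = 0 := by simp [ha, hA, he]
  have hea : e ⬝ᵥ (-a) = 0 := by simp [he, ha0]
  -- A transvection subtracting multiples of the first row to clear the first column of A. It has
  -- determinant 1 because a 0 = 0.
  have hlevi : fromBlocks (1 + vecMulVec (-a) e) 0 0 (1 + vecMulVec e (star a)) ∈
      generatedMonoid (n + 1) R := by
    refine levi_mem_generatedMonoid (det_one_add_vecMulVec _ _ hea) ?_
    have hse : star e = e := by
      funext k
      rcases eq_or_ne k 0 with rfl | hk
      · simp [he]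
      · simp [he, hk]
    rw [conjTranspose_add, conjTranspose_one, conjTranspose_vecMulVec, hse, Matrix.add_mul,
      Matrix.one_mul, Matrix.mul_add, Matrix.mul_one, vecMulVec_mul_vecMulVec, star_neg]
    have : (-star a) ⬝ᵥ e = 0 := by simp [he, ha0]
    rw [this]
    ext i j
    simp [vecMulVec_apply]
  refine mem_of_mul_mem_left hlevi ?_
  have hM' := mul_mem (generatedMonoid_le hlevi) hM
  rw [fromBlocks_multiply] at hM' ⊢
  simp only [Matrix.zero_mul, add_zero, zero_add] at hM' ⊢
  refine mem_generatedMonoid_of_row_of_col ih hM' ?_ ?_ ?_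
  · funext j
    rw [Matrix.add_mul, Matrix.one_mul, vecMulVec_mul, Matrix.add_apply, vecMulVec_apply]
    simp [ha0, hA, he]
  · funext j
    rw [Matrix.add_mul, Matrix.one_mul, vecMulVec_mul, Matrix.add_apply, vecMulVec_apply]
    simp [ha0, hB]
  · intro i
    rw [Matrix.add_mul, Matrix.one_mul, vecMulVec_mul, Matrix.add_apply, vecMulVec_apply]
    simp [ha, he, hA]

/-- Since AB* is Hermitian and A has standard first row, B 0 0 is self-adjoint. A Hermitian S with
first row -B 0 therefore exists, and right multiplication by its upper unipotent clears the first
row of B. -/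
theorem mem_generatedMonoid_of_left_row
    (ih : ∀ M ∈ specialUnitaryOver n R, M ∈ generatedMonoid n R)
    {A B C D : Matrix (Fin (n + 1)) (Fin (n + 1)) R}
    (hM : fromBlocks A B C D ∈ specialUnitaryOver (n + 1) R) (hA : A 0 = Pi.single 0 1) :
    fromBlocks A B C D ∈ generatedMonoid (n + 1) R := by
  have hb : star (B 0 0) = B 0 0 := by
    obtain ⟨h1, -, -⟩ := fromBlocks_form_adjoint hM.2
    have h2 := congrFun (congrFun (congrArg conjTranspose h1) 0) 0
    rw [conjTranspose_mul, conjTranspose_conjTranspose, conjTranspose_apply, ← h1,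
      mul_apply_of_row hA, conjTranspose_apply, star_star] at h2
    exact h2
  have hv : star ((fun i => -star (B 0 i)) 0) = (fun i => -star (B 0 i)) 0 := by simp [hb]
  have hS := isHermitian_hermitianOfCol (v := fun i => -star (B 0 i)) hv
  refine mem_of_mul_mem_right (upper_mem_generatedMonoid hS) ?_
  have hM' := mul_mem hM (generatedMonoid_le (upper_mem_generatedMonoid hS))
  rw [fromBlocks_multiply] at hM' ⊢
  simp only [Matrix.mul_one, Matrix.mul_zero, add_zero] at hM' ⊢
  refine mem_generatedMonoid_of_row ih hM' hA ?_
  funext j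
  rw [Matrix.add_apply, mul_apply_of_row hA, hermitianOfCol_zero_apply (v := fun i => -star (B 0 i)) hv]
  simp

theorem mem_generatedMonoid_of_slEquiv
    (ih : ∀ M ∈ specialUnitaryOver n R, M ∈ generatedMonoid n R)
    {A B C D : Matrix (Fin (n + 1)) (Fin (n + 1)) R}
    (hM : fromBlocks A B C D ∈ specialUnitaryOver (n + 1) R)
    (hA : SLEquiv (A 0) (Pi.single 0 1)) :
    fromBlocks A B C D ∈ generatedMonoid (n + 1) R := by
  obtain ⟨U, hU, hAU⟩ := hA
  have hun : IsUnit (Uᴴ).det := by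
    rw [det_conjTranspose, hU, star_one]
    exact isUnit_one
  have hlevi := levi_mem_generatedMonoid hU (Matrix.mul_nonsing_inv _ hun)
  refine mem_of_mul_mem_right hlevi ?_
  have hM' := mul_mem hM (generatedMonoid_le hlevi)
  rw [fromBlocks_multiply] at hM' ⊢
  simp only [Matrix.mul_zero, add_zero, zero_add] at hM' ⊢
  exact mem_generatedMonoid_of_left_row ih hM' hAU

/-- The induction step for generation by unipotent and Levi matrices. -/
theorem mem_generatedMonoid_succ
    (ih : ∀ M ∈ specialUnitaryOver n R, M ∈ generatedMonoid n R)
    (hSL : ∀ x : Fin (n + 1) → R, Ideal.span (Set.range x) = ⊤ → SLEquiv x (Pi.single 0 1))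
    (hrow : ∀ c d : Fin (n + 1) → R,
      (∀ P : Ideal R, P.IsMaximal → (∃ k, c k ∉ P) ∨ ∃ k, d k ∉ P) →
      ∃ S : Matrix (Fin (n + 1)) (Fin (n + 1)) R, S.IsHermitian ∧
        Ideal.span (Set.range (d + vecMul c S)) = ⊤)
    {M : Matrix (Fin (n + 1) ⊕ Fin (n + 1)) (Fin (n + 1) ⊕ Fin (n + 1)) R}
    (hM : M ∈ specialUnitaryOver (n + 1) R) : M ∈ generatedMonoid (n + 1) R := by
  obtain ⟨A, B, C, D, rfl⟩ : ∃ A B C D, M = fromBlocks A B C D :=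
    ⟨_, _, _, _, (fromBlocks_toBlocks M).symm⟩
  obtain ⟨S, hS, hspan⟩ := hrow (A 0) (B 0) (by
    intro P hP
    by_contra! hcon
    obtain ⟨-, -, h6⟩ := fromBlocks_form_adjoint hM.2
    have h7 := congrFun (congrFun h6 0) 0
    rw [Matrix.one_apply_eq, Matrix.sub_apply, mul_apply, mul_apply] at h7
    refine hP.ne_top ((Ideal.eq_top_iff_one _).2 ?_)
    rw [← h7]
    exact P.sub_mem (Ideal.sum_mem _ fun k _ => P.mul_mem_right _ (hcon.1 k))
      (Ideal.sum_mem _ fun k _ => P.mul_mem_right _ (hcon.2 k)))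
  -- The unipotent turns B into B + AS and J moves this block to the upper left, so the first row
  -- there becomes the unimodular row just found.
  have hg := mul_mem (upper_mem_generatedMonoid hS) (J_mem_generatedMonoid (n := n + 1) (R := R))
  refine mem_of_mul_mem_right hg ?_
  have hM' := mul_mem hM (generatedMonoid_le hg)
  rw [J, fromBlocks_multiply, fromBlocks_multiply] at hM' ⊢
  refine mem_generatedMonoid_of_slEquiv ih hM' (hSL _ ?_)
  convert hspan using 3
  funext j
  simp [Matrix.mul_apply, vecMul, dotProduct, add_comm]

end UnitaryGroup
end HermitianTheta
end

noncomputable section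
namespace HermitianTheta

/-! ### Degree one and SL₂(ℤ). -/

section DegreeOne

open Matrix MatrixGroups

variable {R : Type*} [CommRing R] [StarRing R]

/-- The image of `SL₂(ℤ)` in the unitary group of degree one. -/
def slToUnitary (R : Type*) [CommRing R] (g : SL(2, ℤ)) :
    Matrix (Fin 1 ⊕ Fin 1) (Fin 1 ⊕ Fin 1) R :=
  fromBlocks (of fun _ _ => (g 0 0 : R)) (of fun _ _ => (g 0 1 : R))
    (of fun _ _ => (g 1 0 : R)) (of fun _ _ => (g 1 1 : R))

theorem slToUnitary_mul (R : Type*) [CommRing R] (g h : SL(2, ℤ)) :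
    slToUnitary R (g * h) = slToUnitary R g * slToUnitary R h := by
  rw [slToUnitary, slToUnitary, slToUnitary, fromBlocks_multiply, fromBlocks_inj]
  refine ⟨?_, ?_, ?_, ?_⟩ <;>
  · ext i j
    simp [Matrix.mul_apply, Fin.sum_univ_two]

theorem slToUnitary_mem (g : SL(2, ℤ)) : slToUnitary R g ∈ generatedMonoid 1 R := by
  have hg : g ∈ Submonoid.closure ({ModularGroup.S, ModularGroup.T} ∪
      {ModularGroup.S, ModularGroup.T}⁻¹) := by
    rw [← Subgroup.closure_toSubmonoid, SpecialLinearGroup.SL2Z_generators]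
    trivial
  have h1 : (1 : Matrix (Fin 1) (Fin 1) R).IsHermitian := isHermitian_one
  have hJ := J_mem_generatedMonoid (n := 1) (R := R)
  have hof : ∀ x : R, (of fun _ _ => x : Matrix (Fin 1) (Fin 1) R) = x • 1 := by
    intro x
    ext i j
    simp [Subsingleton.elim i j]
  induction hg using Submonoid.closure_induction with
  | mem g hg =>
    rw [Set.union_def, Set.mem_ofPred, Set.mem_inv] at hg
    simp only [Set.mem_insert_iff, Set.mem_singleton_iff, inv_eq_iff_eq_inv] at hg
    rcases hg with (rfl | rfl) | (rfl | rfl)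
    · convert hJ using 1
      simp [slToUnitary, hof, ModularGroup.S, J]
    · convert upper_mem_generatedMonoid h1 using 1
      simp [slToUnitary, hof, ModularGroup.T]
    · convert mul_mem (mul_mem hJ hJ) hJ using 1
      have hS : (ModularGroup.S⁻¹ : SL(2, ℤ)).1 = !![0, 1; -1, 0] := by
        rw [SpecialLinearGroup.SL2_inv_expl, ModularGroup.S]
        simp
        rfl
      simp [slToUnitary, hof, hS, J, fromBlocks_multiply]
    · convert upper_mem_generatedMonoid h1.neg using 1
      simp [slToUnitary, hof]
  | one =>
    convert one_mem (generatedMonoid 1 R) using 1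
    simp [slToUnitary, hof]
  | mul g h _ _ ihg ihh =>
    rw [slToUnitary_mul]
    exact mul_mem ihg ihh

/-- The form identifies M* with a J-conjugate of M⁻¹, and for det M = 1 in size two the same holds
for the transpose. Hence every entry equals its conjugate and is a rational integer. -/
theorem mem_generatedMonoid_one [CharZero R] (hint : ∀ a : R, star a = a → ∃ k : ℤ, a = k)
    {M : Matrix (Fin 1 ⊕ Fin 1) (Fin 1 ⊕ Fin 1) R} (hM : M ∈ specialUnitaryOver 1 R) :
    M ∈ generatedMonoid 1 R := by
  obtain ⟨A, B, C, D, rfl⟩ : ∃ A B C D, M = fromBlocks A B C D :=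
    ⟨_, _, _, _, (fromBlocks_toBlocks M).symm⟩
  obtain ⟨h1, h2, h3⟩ := fromBlocks_form_iff.1 hM.2
  have hdet := hM.1
  have e1 := congrFun (congrFun h1 0) 0
  have e2 := congrFun (congrFun h2 0) 0
  have e3 := congrFun (congrFun h3 0) 0
  rw [← det_submatrix_equiv_self (finSumFinEquiv (m := 1) (n := 1)).symm, det_fin_two] at hdet
  have e4 : A 0 0 * D 0 0 - B 0 0 * C 0 0 = 1 := hdet
  simp only [Matrix.mul_apply, Matrix.sub_apply, Fin.sum_univ_one, conjTranspose_apply,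
    Matrix.one_apply_eq] at e1 e2 e3
  have e3' : star (D 0 0) * A 0 0 - star (B 0 0) * C 0 0 = 1 := by
    have := congrArg star e3
    rwa [star_sub, star_mul, star_mul, star_star, star_star, star_one] at this
  obtain ⟨a, ha⟩ := hint (A 0 0) (by
    linear_combination (-star (A 0 0)) * e4 + A 0 0 * e3 - B 0 0 * e1)
  obtain ⟨b, hb⟩ := hint (B 0 0) (by
    linear_combination (-star (B 0 0)) * e4 + A 0 0 * e2 + B 0 0 * e3')
  obtain ⟨c, hc⟩ := hint (C 0 0) (by
    linear_combination (-star (C 0 0)) * e4 - D 0 0 * e1 + C 0 0 * e3)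
  obtain ⟨d, hd⟩ := hint (D 0 0) (by
    linear_combination (-star (D 0 0)) * e4 + D 0 0 * e3' + C 0 0 * e2)
  rw [ha, hb, hc, hd] at e4
  have hdet' : (!![a, b; c, d] : Matrix (Fin 2) (Fin 2) ℤ).det = 1 := by
    rw [det_fin_two_of]
    exact_mod_cast e4
  have heq : fromBlocks A B C D = slToUnitary R ⟨!![a, b; c, d], hdet'⟩ := by
    unfold slToUnitary
    rw [fromBlocks_inj]
    refine ⟨?_, ?_, ?_, ?_⟩ <;>
    · ext i j
      simp [Subsingleton.elim i 0, Subsingleton.elim j 0, ha, hb, hc, hd]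
  rw [heq]
  exact slToUnitary_mem _

end DegreeOne

/-! ### The modular group preserves theta, and the conclusion. -/

section ModularGroup

open Matrix

variable {m n r : ℕ} {Λ : Submodule (𝓞 (ImagQuad m)) (Fin r → ℂ)}

/-- The Hermitian modular group is generated by unipotent and Levi matrices. -/
theorem specialUnitaryOver_le_generatedMonoid (hm : m ≠ 0) (n : ℕ) :
    ∀ M ∈ specialUnitaryOver (n + 1) (𝓞 (ImagQuad m)),
      M ∈ generatedMonoid (n + 1) (𝓞 (ImagQuad m)) := by
  induction n with
  | zero => exact fun M hM => mem_generatedMonoid_one (fun a ha => exists_int_of_star_eq hm ha) hM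
  | succ n ih =>
    refine fun M hM => mem_generatedMonoid_succ ih slEquiv_single_of_span_eq_top (fun c d hcd => ?_)
      hM
    by_cases hc : c = 0
    · refine ⟨0, isHermitian_zero, ?_⟩
      rw [vecMul_zero, add_zero, span_range_eq_top_iff]
      exact fun P hP => (hcd P hP).resolve_left (by simp [hc])
    · obtain ⟨i, hi⟩ := Function.ne_iff.1 hc
      obtain ⟨j, hj⟩ := exists_ne i
      obtain ⟨S, hS⟩ := exists_symmInt_span_eq_top (finrank_imagQuad_le m) hj.symm hi hcd
      refine ⟨S.1.map (Int.castRingHom _), ?_, hS⟩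
      ext k l
      have h : S.1 l k = S.1 k l := congrFun (congrFun S.2 k) l
      simp [h]

theorem conjTranspose_map_algebraMap {ι : Type*} (A : Matrix ι ι (𝓞 (ImagQuad m))) :
    (A.map (algebraMap (𝓞 (ImagQuad m)) ℂ))ᴴ = Aᴴ.map (algebraMap (𝓞 (ImagQuad m)) ℂ) := by
  ext i j
  rfl

/-- Integral Levi generators are the case u = 1: since det U = 1 lies in the n-th power of the entry
ideal, that power is the unit ideal, and the twist argument applies. -/
theorem generatedMonoid_le_comap_automorphyMonoid (hm : m ≠ 0) (hn : 0 < n)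
    (hΛ : IsThetaLattice Λ)
    (hI : ∀ I : (Ideal (𝓞 (ImagQuad m)))⁰, orderOf (ClassGroup.mk0 I) ∣ n →
      Isometric (idealTwist (I : Ideal _) Λ) Λ) :
    generatedMonoid n (𝓞 (ImagQuad m)) ≤ (automorphyMonoid (theta n Λ) r).comap
      (algebraMap (𝓞 (ImagQuad m)) ℂ).mapMatrix.toMonoidHom := by
  set φ := algebraMap (𝓞 (ImagQuad m)) ℂ with hφ
  have hherm : ∀ S : Matrix (Fin n) (Fin n) (𝓞 (ImagQuad m)), S.IsHermitian →
      (S.map φ).IsHermitian ∧ ∀ i, ∃ k : ℤ, S.map φ i i = k := by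
    intro S hS
    refine ⟨?_, fun i => ?_⟩
    · rw [IsHermitian, conjTranspose_map_algebraMap, hS.eq]
    · obtain ⟨k, hk⟩ := exists_int_of_star_eq hm (hS.apply i i)
      exact ⟨k, by rw [map_apply, hk, map_intCast]⟩
  refine Submonoid.closure_le.2 ?_
  rintro _ (⟨S, hS, rfl⟩ | ⟨S, hS, rfl⟩ | ⟨U, V, hU, hUV, rfl⟩)
  · change (fromBlocks 1 S 0 1).map φ ∈ automorphyMonoid (theta n Λ) r
    rw [fromBlocks_map, Matrix.map_one _ (map_zero φ) (map_one φ), Matrix.map_zero _ (map_zero φ)]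
    exact upper_mem_automorphyMonoid hΛ (hherm S hS).1 (hherm S hS).2 fun i j => ⟨S i j, rfl⟩
  · change (fromBlocks 1 0 S 1).map φ ∈ automorphyMonoid (theta n Λ) r
    rw [fromBlocks_map, Matrix.map_one _ (map_zero φ) (map_one φ), Matrix.map_zero _ (map_zero φ)]
    exact lower_mem_automorphyMonoid hΛ (hherm S hS).1 (hherm S hS).2 fun i j => ⟨S i j, rfl⟩
  · change (fromBlocks U 0 0 V).map φ ∈ automorphyMonoid (theta n Λ) r
    have hV : (U.map φ)ᴴ⁻¹ = V.map φ := by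
      refine inv_eq_right_inv ?_
      rw [conjTranspose_map_algebraMap, ← Matrix.map_mul, hUV,
        Matrix.map_one _ (map_zero φ) (map_one φ)]
    rw [fromBlocks_map, Matrix.map_zero _ (map_zero φ), ← hV]
    refine leviMatrix_mem_of_mem_leviSet hm hn hΛ.discrete hI ⟨?_, 1, U, one_ne_zero, by simp [hφ],
      ?_⟩ r
    · rw [← RingHom.mapMatrix_apply, ← RingHom.map_det, hU, map_one]
    · have := det_mem_pow (mem_entryIdeal U)
      rw [hU] at this ⊢
      rw [Ideal.span_singleton_one, Ideal.eq_top_iff_one]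
      exact this

theorem mem_automorphyMonoid_of_mem_modularGroup (hm : m ≠ 0) (hn : 0 < n)
    (hΛ : IsThetaLattice Λ)
    (hI : ∀ I : (Ideal (𝓞 (ImagQuad m)))⁰, orderOf (ClassGroup.mk0 I) ∣ n →
      Isometric (idealTwist (I : Ideal _) Λ) Λ)
    {G : Matrix (Fin n ⊕ Fin n) (Fin n ⊕ Fin n) ℂ} (hG : G ∈ modularGroup (ImagQuad m) n) :
    G ∈ automorphyMonoid (theta n Λ) r := by
  obtain ⟨⟨hdet, hJ⟩, hint⟩ := hG
  choose M hM using hint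
  set φ := algebraMap (𝓞 (ImagQuad m)) ℂ with hφ
  have hGM : G = Matrix.map (of M) φ := by
    ext i j
    exact hM i j
  have hSU : of M ∈ specialUnitaryOver n (𝓞 (ImagQuad m)) := by
    constructor
    · apply algebraMap_ringOfIntegers_injective
      rw [RingHom.map_det, RingHom.mapMatrix_apply, ← hφ, ← hGM, hdet, map_one]
    · apply Matrix.map_injective algebraMap_ringOfIntegers_injective
      have hJmap : (J (Fin n) (𝓞 (ImagQuad m))).map φ = J (Fin n) ℂ := by
        rw [J, fromBlocks_map, Matrix.map_zero _ (map_zero φ), Matrix.map_neg _ (map_neg φ),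
          Matrix.map_one _ (map_zero φ) (map_one φ), J]
      change Matrix.map (_ * _ * _) φ = Matrix.map _ φ
      rw [Matrix.map_mul, Matrix.map_mul, ← conjTranspose_map_algebraMap, ← hφ, ← hGM, hJmap, hJ]
  obtain ⟨k, rfl⟩ := Nat.exists_eq_succ_of_ne_zero hn.ne'
  rw [hGM]
  exact generatedMonoid_le_comap_automorphyMonoid hm hn hΛ hI
    (specialUnitaryOver_le_generatedMonoid hm k _ hSU)

end ModularGroup
end HermitianTheta
end

theorem corollary1 (m : ℕ) (hm : Squarefree m) (n : ℕ) (hn : 0 < n) (r : ℕ)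
    (Λ : Submodule (𝓞 (HermitianTheta.ImagQuad m)) (Fin r → ℂ))
    (hΛ : HermitianTheta.IsThetaLattice Λ)
    (hI : ∀ I : (Ideal (𝓞 (HermitianTheta.ImagQuad m)))⁰,
      orderOf (ClassGroup.mk0 I) ∣ n →
        HermitianTheta.Isometric (HermitianTheta.idealTwist (I : Ideal _) Λ) Λ) :
    (∀ T : Matrix (Fin n) (Fin n) ℂ, (HermitianTheta.representations Λ T).Finite) ∧
    (∀ Z ∈ HermitianTheta.halfSpace n, Summable (HermitianTheta.thetaTerm Λ Z)) ∧
    HermitianTheta.IsModularForm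
      (HermitianTheta.extendedModularGroup (HermitianTheta.ImagQuad m) n) (r : ℤ)
      (HermitianTheta.theta n Λ) := by
  refine ⟨HermitianTheta.finite_representations hΛ.discrete,
    fun Z hZ => (HermitianTheta.hasSum_thetaTerm hΛ.discrete hZ).summable,
    HermitianTheta.differentiableOn_theta hΛ.discrete, ?_,
    HermitianTheta.exists_bound_theta hΛ.discrete⟩
  rintro M ⟨A, hA, G, hG, rfl⟩
  exact (mul_mem
    (HermitianTheta.leviMatrix_mem_of_mem_leviSet hm.ne_zero hn hΛ.discrete hI hA (r : ℤ))
    (HermitianTheta.mem_automorphyMonoid_of_mem_modularGroup hm.ne_zero hn hΛ hI hG)).2
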